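/- Throughout, $W:\mathbb R\to[0,\infty)$ is smooth and $1$-periodic with $W(t)=0$ if and only if $t\in\mathbb Z$; $\Omega=B_{10}(0)\subset\mathbb R^2$; $(a,b)^\perp=(-b,a)$; traces on $\partial\Omega$ are taken in the usual sense; a function lies in $SBV(D;\mathbb Z)$ (resp. $SBV(D;\mathbb Z^{m})$) if it (resp. each of its components) lies in $SBV(D)$ and is integer valued a.e. An expression $|\lambda|^2$, with $\lambda$ a vector measure on an open set $D$, stands for $|p|^2$ if $\lambda=p\,dx$ with $p\in L^2(D;\mathbb R^2)$; if there is no such $p$, the energy containing the expression is $+\infty$. **(a) One prescribed jump.** Let $P\ne Q$ be points of $\mathbb R^2$ with $\max(|P|,|Q|)=1$, let $0<2\delta<|P-Q|$, let $s=[P,Q]$, $\tau_s=\frac{Q-P}{|Q-P|}$, $\Sigma_s=\tau_s\,\mathcal H^1\llcorner s$ and $\Omega_\delta=\Omega\setminus(\overline{B_\delta(P)}\cup \overline{B_\delta(Q)})$. Put $H_s=\{u\in W^{1,2}(\Omega_\delta\setminus s)\cap SBV(\Omega_\delta): u|_{\partial\Omega}=0\}$ and $$F_\varepsilon(u,\Omega_\delta)=\int_{\Omega_\delta}\varepsilon|Du^\perp-\Sigma_s|^2+\tfrac1\varepsilon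 W(u)\,dx .$$ If $\varepsilon_k>0$, $\varepsilon_k\to0$, $u_k\in H_s$ and $\sup_kF_{\varepsilon_k}(u_k,\Omega_\delta)<\infty$, then a subsequence of $(u_k)$ converges in $L^1(\Omega_\delta)$ to some $u\in SBV(\Omega_\delta;\mathbb Z)$. **(b) Several prescribed jumps.** Let $N\ge1$, let $P_1,\dots,P_N\in\mathbb R^2$ be distinct points with $\max_i|P_i|=1$, let $\Psi$ be a norm on $\mathbb R^{N-1}$ with dual norm $\Psi^*(y)=\sup\{\langle y,v\rangle:\Psi(v)\le1\}$, and let $\delta>0$ with $2\delta<|P_i-P_j|$ for all $i\ne j$. Put $\Omega_\delta=\Omega\setminus\bigcup_{i}\overline{B_\delta(P_i)}$ and, for $1\le i\le N-1$, $\gamma_i=[P_i,P_N]$, $\tau_i=\frac{P_N-P_i}{|P_N-P_i|}$, $\Gamma_i=\tau_i\,\mathcal H^1\llcorner\gamma_i$, $H_i=\{u\in W^{1,2}(\Omega\setminus\gamma_i)\cap SBV(\Omega):u|_{\partial\Omega}=0\}$, $H=H_1\times\dots\times H_{N-1}$, $e^i_\varepsilon(u)=\varepsilon|Du^\perp-\Gamma_i|^2+\frac1\varepsilon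 W(u)$ (on $\Omega_\delta$) and $$F^\Psi_\varepsilon(U,\Omega_\delta)=\sup\Big\{\sum_{i=1}^{N-1}\int_{\Omega_\delta}\phi_i\,e^i_\varepsilon(u_i)\,dx:\ \phi\in C_c^\infty(\Omega_\delta;\mathbb R^{N-1}),\ \Psi^*(\phi(x))\le1\ \text{for all }x\Big\}$$ for $U=(u_1,\dots,u_{N-1})\in H$. If $\varepsilon_k>0$, $\varepsilon_k\to0$, $U_k\in H$ and $\sup_kF^\Psi_{\varepsilon_k}(U_k,\Omega_\delta)<\infty$, then a subsequence of $(U_k)$ converges in $[L^1(\Omega_\delta)]^{N-1}$ to some $U\in SBV(\Omega_\delta;\mathbb Z^{N-1})$. -/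

import Mathlib

open MeasureTheory Filter Topology
open scoped ENNReal NNReal ContDiff

noncomputable section

namespace ModicaMortola

/-- The Euclidean plane. -/
abbrev Plane : Type := EuclideanSpace ℝ (Fin 2)

/-- The partial derivative of `φ` in the `j`-th coordinate direction. -/
def pderiv (j : Fin 2) (φ : Plane → ℝ) (x : Plane) : ℝ :=
  fderiv ℝ φ x (EuclideanSpace.single j 1)

/-- Scalar test functions: `φ ∈ C_c^∞(D)`. -/
structure IsTest (D : Set Plane) (φ : Plane → ℝ) : Prop where
  smooth : ContDiff ℝ ∞ φ
  compact : HasCompactSupport φ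
  support : tsupport φ ⊆ D

/-! ### Functions of bounded variation -/

/-- `Du = σ μ` is the polar decomposition of the distributional gradient of `u` on `D`:
`μ = |Du|` is a finite measure carried by `D`, `σ` is a Borel unit vector field, and
`∫_D u ∂_j φ dx = - ∫ φ σ_j dμ` for all test functions. -/
structure IsGradientMeasure (D : Set Plane) (u : Plane → ℝ) (μ : Measure Plane)
    (σ : Plane → Plane) : Prop where
  finite : IsFiniteMeasure μ
  carried : μ Dᶜ = 0
  measurable : Measurable σ
  unit : ∀ᵐ x ∂μ, ‖σ x‖ = 1
  byParts : ∀ φ : Plane → ℝ, IsTest D φ → ∀ j : Fin 2,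
    ∫ x in D, u x * pderiv j φ x = - ∫ x, φ x * σ x j ∂μ

/-- The approximate discontinuity set `S_u` of `u` : the points at which `u` has no approximate
limit. -/
def approxDiscontinuitySet (u : Plane → ℝ) : Set Plane :=
  {x | ¬ ∃ z : ℝ, Tendsto (fun r : ℝ => ⨍ y in Metric.ball x r, |u y - z|) (𝓝[>] 0) (𝓝 0)}

/-- `u ∈ SBV(D)` : `u ∈ L¹(D)`, the distributional gradient is a finite measure `Du` on `D`, and
the Cantor part `Dˢu ⌞ (D \ S_u)` vanishes, where `Dˢu` is the singular part of `Du` with respect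
to Lebesgue measure. -/
def MemSBV (D : Set Plane) (u : Plane → ℝ) : Prop :=
  IntegrableOn u D ∧ ∃ (μ : Measure Plane) (σ : Plane → Plane), IsGradientMeasure D u μ σ ∧
    μ.singularPart volume (D \ approxDiscontinuitySet u) = 0

/-- `u ∈ SBV(D; ℤ)`. -/
def MemSBVInt (D : Set Plane) (u : Plane → ℝ) : Prop :=
  MemSBV D u ∧ ∀ᵐ x ∂(volume.restrict D), ∃ k : ℤ, u x = k

/-! ### Sobolev functions and boundary traces -/

/-- `u ∈ W^{1,2}(D)` with weak gradient `g`. -/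
structure IsSobolevGradient (D : Set Plane) (u : Plane → ℝ) (g : Plane → Plane) : Prop where
  memLp : MemLp u 2 (volume.restrict D)
  memLp_grad : MemLp g 2 (volume.restrict D)
  byParts : ∀ φ : Plane → ℝ, IsTest D φ → ∀ j : Fin 2,
    ∫ x in D, u x * pderiv j φ x = - ∫ x in D, g x j * φ x

/-- The disc `Ω = B_10(0)`. -/
def Om : Set Plane := Metric.ball 0 10

/-- Let `V` be an open neighbourhood of `∂Ω` and `u ∈ W^{1,2}(Ω ∩ V)` with weak gradient `g`.
The function `T` is the trace of `u` on `∂Ω` : the Gauss-Green formula, with exterior normal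
`x / 10`, holds for every smooth function with compact support in `V`. -/
def IsTrace (V : Set Plane) (u : Plane → ℝ) (g : Plane → Plane) (T : Plane → ℝ) : Prop :=
  ∀ φ : Plane → ℝ, IsTest V φ → ∀ j : Fin 2,
    ∫ x in Om ∩ V, u x * pderiv j φ x =
      - (∫ x in Om ∩ V, g x j * φ x)
        + ∫ x in Metric.sphere (0 : Plane) 10, T x * φ x * (x j / 10) ∂(μH[1])

/-- The class `{u ∈ W^{1,2}((Ω \ E) \ s) ∩ SBV(Ω \ E) : u = 0 on ∂Ω}`, for `E`, `s` closed sets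
that do not meet `∂Ω`. -/
def jumpClass (E s : Set Plane) : Set (Plane → ℝ) :=
  {u | MemSBV (Om \ E) u ∧ ∃ g : Plane → Plane,
    IsSobolevGradient ((Om \ E) \ s) u g ∧ IsTrace (E ∪ s)ᶜ u g 0}

/-- The union of the closed discs of radius `δ` centred at the points of `A`. -/
def holes (A : Set Plane) (δ : ℝ) : Set Plane := ⋃ p ∈ A, Metric.closedBall p δ

/-- The perforated disc `Ω_δ = Ω \ ⋃_{p ∈ A} B_δ(p)`. -/
def OmDelta (A : Set Plane) (δ : ℝ) : Set Plane := Om \ holes A δ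

/-! ### The energies -/

/-- The action on a test function `φ ∈ C_c^∞(D)` of the distribution
`Du^⊥ = (-D₂u, D₁u)`, where `⟨D_j u, φ⟩ = -∫_D u ∂_j φ dx`. -/
def rotGrad (D : Set Plane) (u φ : Plane → ℝ) : Plane :=
  !₂[∫ x in D, u x * pderiv 1 φ x, - ∫ x in D, u x * pderiv 0 φ x]

/-- The action on a test function of the vector measure `τ · H¹ ⌞ [a, b]`, with
`τ = (b - a) / |b - a|`. -/
def segmentMeasure (a b : Plane) (φ : Plane → ℝ) : Plane :=
  ∫ x in segment ℝ a b, φ x • (‖b - a‖⁻¹ • (b - a)) ∂(μH[1])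

/-- On `D`, the measure `Du^⊥ - τ · H¹ ⌞ [a, b]` is absolutely continuous with respect to
Lebesgue measure, with density `p ∈ L²(D; ℝ²)`. -/
def IsRotDensity (D : Set Plane) (a b : Plane) (u : Plane → ℝ) (p : Plane → Plane) : Prop :=
  MemLp p 2 (volume.restrict D) ∧ ∀ φ : Plane → ℝ, IsTest D φ →
    rotGrad D u φ - segmentMeasure a b φ = ∫ x in D, φ x • p x

/-- The energy density `ε |p|² + W(u) / ε`. -/
def density (W : ℝ → ℝ) (ε : ℝ) (u : Plane → ℝ) (p : Plane → Plane) (x : Plane) : ℝ :=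
  ε * ‖p x‖ ^ 2 + 1 / ε * W (u x)

/-- `F_ε(u, D) = ∫_D ε |Du^⊥ - τ · H¹ ⌞ [a, b]|² + W(u) / ε dx`, which is `+∞` unless
`Du^⊥ - τ · H¹ ⌞ [a, b]` has a density in `L²(D)`; the density is unique almost everywhere, and
the infimum over the empty family is `+∞`. -/
def energy (W : ℝ → ℝ) (ε : ℝ) (D : Set Plane) (a b : Plane) (u : Plane → ℝ) : ℝ≥0∞ :=
  ⨅ (p : Plane → Plane) (_ : IsRotDensity D a b u p),
    ∫⁻ x in D, ENNReal.ofReal (density W ε u p x)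

/-- The dual norm `Ψ*(y) = sup {⟨y, v⟩ : Ψ(v) ≤ 1}`. -/
def dualNorm {n : ℕ} (Ψ : Seminorm ℝ (Fin n → ℝ)) (y : Fin n → ℝ) : ℝ≥0∞ :=
  ⨆ (v : Fin n → ℝ) (_ : Ψ v ≤ 1), ENNReal.ofReal (∑ i, y i * v i)

/-- The `Ψ`-mass on `D` of the vector measure `e dx`, for `e ∈ L¹(D; ℝⁿ)`: the supremum of
`∑ i, ∫_D φ_i e_i dx` over `φ ∈ C_c^∞(D; ℝⁿ)` with `Ψ*(φ(x)) ≤ 1` for all `x`. -/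
def psiMass {n : ℕ} (Ψ : Seminorm ℝ (Fin n → ℝ)) (D : Set Plane) (e : Fin n → Plane → ℝ) :
    ℝ≥0∞ :=
  ⨆ (φ : Fin n → Plane → ℝ) (_ : ∀ i, IsTest D (φ i))
    (_ : ∀ x, dualNorm Ψ (fun i => φ i x) ≤ 1),
    ENNReal.ofReal (∑ i, ∫ x in D, φ i x * e i x)

/-- `F_ε^Ψ(U, D)`, the `Ψ`-mass on `D` of `(e_ε^1(u_1), …, e_ε^n(u_n)) dx`, where
`e_ε^i(u) = ε |Du^⊥ - Γ_i|² + W(u) / ε` and `Γ_i = τ_i · H¹ ⌞ [P_i, P_N]`, `N = n + 1`. It is `+∞`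
unless every `Du_i^⊥ - Γ_i` has a density in `L²(D)`. -/
def psiEnergy {n : ℕ} (Ψ : Seminorm ℝ (Fin n → ℝ)) (W : ℝ → ℝ) (ε : ℝ) (D : Set Plane)
    (P : Fin (n + 1) → Plane) (U : Fin n → Plane → ℝ) : ℝ≥0∞ :=
  ⨅ (p : Fin n → Plane → Plane)
    (_ : ∀ i, IsRotDensity D (P i.castSucc) (P (Fin.last n)) (U i) (p i)),
    psiMass Ψ D (fun i => density W ε (U i) (p i))

/-- `W` is a smooth nonnegative `1`-periodic potential whose zero set is `ℤ`. -/
structure IsPotential (W : ℝ → ℝ) : Prop where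
  smooth : ContDiff ℝ ∞ W
  nonneg : ∀ t, 0 ≤ W t
  periodic : Function.Periodic W 1
  zero_iff : ∀ t, W t = 0 ↔ ∃ k : ℤ, t = k

end ModicaMortola

end

open ModicaMortola

/-! The argument is the Modica-Mortola compactness proof, adapted to a prescribed unit jump. Let `Φ`
be the primitive of `√W` (`primitive`). Since `W` is `1`-periodic, `Φ(t - 1) = Φ(t) - Φ(1)`:
shifting `u` by one unit on one side of the segment changes `Φ(u)` there by a constant and leaves
`√W(u)` unchanged. Hence, if `p` is the density of `Du^⊥ - Γ`, the gradient of `Φ(u)` is `√W(u) rot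
p` plus `Φ(1)` times a fixed measure on the segment (`integral_primitive_mul_pderiv`). By `2 √W |p|
≤ ε |p|² + W / ε` the first term is bounded in `L¹` by the energy, and the second does not depend on
`k`. Because `u` has trace zero, its extension by zero outside `Ω` creates no variation on `∂Ω`. So
the functions `v_k = Φ(u_k)`, extended by zero, have uniformly bounded variation in the whole plane
minus the closed discs.

Compactness of `v_k` in `L¹` is `exists_subseq_tendsto_of_varBound`. As `v_k` vanishes far away, a
Poincaré inequality on balls (`exists_closedBall_bound`), propagated by connectedness of the
perforated plane, bounds the mass on compact sets. Nothing is prescribed on the boundaries of the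
discs; a radial test field (`exists_annulus_bound`) shows that a thin annulus of width parameter `η`
carries mass `O(η)`. Away from the discs, mollification converges at a rate controlled by the
variation, and Arzelà-Ascoli yields finite nets.

Let `v₀` be the limit and `u₀ = Φ⁻¹(v₀)`. The inverse of `Φ` is not Lipschitz, but `|s - t| ≤ η + C
|Φ(s) - Φ(t)|` suffices for `u_k → u₀` in `L¹`. Since `∫ W(u_k) = O(ε_k)`, `u₀` is integer valued,
so `v₀ = Φ(1) u₀`; weak limits of the bounded densities then show that `Du₀` is a finite measure
(`exists_isGradientMeasure_of_tendsto`).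

It remains to exclude a Cantor part (`measure_diff_approxDiscontinuitySet`). Put `f(t) = t -
sin(2πt)/(2π)`. Then `f ∘ u₀ = u₀`, while `f'` vanishes on the integers, and approximate limits of
an integer valued function are integers. The chain rule therefore forces `Du₀` to vanish on the
points of approximate continuity.

For several jumps, equivalence of norms in finite dimension bounds the energy of each component by
the `Ψ`-mass, and successive extraction gives a common subsequence. -/

noncomputable section

namespace ModicaMortola

/-! ### Mollification -/

/-- The radius of the support of the `n`-th mollifier. -/
def rad (n : ℕ) : ℝ := 1 / ((n : ℝ) + 1)

lemma rad_pos (n : ℕ) : 0 < rad n := by unfold rad; positivity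

lemma tendsto_rad : Tendsto rad atTop (𝓝 0) := tendsto_one_div_add_atTop_nhds_zero_nat

/-- A bump function of radius `rad n` around the origin. -/
def bump (n : ℕ) : ContDiffBump (0 : Plane) where
  rIn := rad n / 2
  rOut := rad n
  rIn_pos := half_pos (rad_pos n)
  rIn_lt_rOut := half_lt_self (rad_pos n)

/-- The standard mollifier. -/
def ker (n : ℕ) : Plane → ℝ := (bump n).normed volume

/-- The mollification of `u`. -/
def moll (n : ℕ) (u : Plane → ℝ) (x : Plane) : ℝ := ∫ y, u y * ker n (x - y)

lemma ker_nonneg (n : ℕ) (x : Plane) : 0 ≤ ker n x := (bump n).nonneg_normed x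

lemma ker_neg (n : ℕ) (x : Plane) : ker n (-x) = ker n x := (bump n).normed_neg x

lemma ker_sub_comm (n : ℕ) (x y : Plane) : ker n (x - y) = ker n (y - x) := by
  rw [← ker_neg, neg_sub]

lemma contDiff_ker (n : ℕ) : ContDiff ℝ ∞ (ker n) := (bump n).contDiff_normed

lemma continuous_ker (n : ℕ) : Continuous (ker n) := (contDiff_ker n).continuous

lemma hasCompactSupport_ker (n : ℕ) : HasCompactSupport (ker n) :=
  (bump n).hasCompactSupport_normed

lemma ker_eq_zero {n : ℕ} {x : Plane} (h : rad n ≤ ‖x‖) : ker n x = 0 := by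
  have : x ∉ Function.support (ker n) := by
    rw [ker, ContDiffBump.support_normed_eq, mem_ball_zero_iff, not_lt]
    exact h
  simpa using this

lemma integral_ker (n : ℕ) : ∫ x, ker n x = 1 := (bump n).integral_normed

lemma integrable_ker (n : ℕ) : Integrable (ker n) := (bump n).integrable_normed

lemma integral_ker_sub (n : ℕ) (x : Plane) : ∫ y, ker n (x - y) = 1 := by
  rw [integral_sub_left_eq_self (ker n) volume x, integral_ker]

lemma integrable_ker_sub (n : ℕ) (x : Plane) : Integrable fun y => ker n (x - y) :=
  (integrable_ker n).comp_sub_left x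

/-- The factor `4` is `(rOut / rIn) ^ 2`: the bump equals one on a ball of half the radius, and the
plane has dimension two. -/
lemma ker_le (n : ℕ) (x : Plane) :
    ker n x ≤ 4 / volume.real (Metric.closedBall (0 : Plane) (rad n)) := by
  have := (bump n).normed_le_div_measure_closedBall_rOut volume 2
    (by simp [bump]; linarith) x
  simpa [show (2:ℝ) ^ 2 = 4 by norm_num] using! this

lemma exists_bound {f : Plane → ℝ} (hf : Continuous f) (hc : HasCompactSupport f) :
    ∃ C, 0 < C ∧ ∀ x, |f x| ≤ C := by
  obtain ⟨C, hC⟩ := hc.exists_bound_of_continuous hf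
  exact ⟨max C 1, by positivity, fun x => (hC x).trans (le_max_left _ _)⟩

lemma moll_eq_convolution (n : ℕ) (u : Plane → ℝ) :
    moll n u = convolution u (ker n) (ContinuousLinearMap.mul ℝ ℝ) volume := by
  ext x; rw [convolution_mul]; rfl

lemma moll_eq_convolution' (n : ℕ) (u : Plane → ℝ) (x : Plane) :
    moll n u x = convolution (ker n) u (ContinuousLinearMap.lsmul ℝ ℝ) volume x := by
  rw [convolution_lsmul_swap, moll]
  simp_rw [smul_eq_mul, mul_comm]

lemma contDiff_moll (n : ℕ) {u : Plane → ℝ} (hu : LocallyIntegrable u) :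
    ContDiff ℝ ∞ (moll n u) := by
  rw [moll_eq_convolution]
  exact (hasCompactSupport_ker n).contDiff_convolution_right _ hu (contDiff_ker n)

lemma continuous_moll (n : ℕ) {u : Plane → ℝ} (hu : LocallyIntegrable u) :
    Continuous (moll n u) := (contDiff_moll n hu).continuous

lemma pderiv_moll (n : ℕ) {u : Plane → ℝ} (hu : LocallyIntegrable u) (j : Fin 2) (x : Plane) :
    pderiv j (moll n u) x = ∫ y, u y * pderiv j (ker n) (x - y) := by
  have h1 : ContDiff ℝ 1 (ker n) := (contDiff_ker n).of_le (by exact_mod_cast le_top)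
  rw [pderiv, moll_eq_convolution, ((hasCompactSupport_ker n).hasFDerivAt_convolution_right
    (ContinuousLinearMap.mul ℝ ℝ) hu h1 x).fderiv, convolution_precompR_apply _ hu
    ((hasCompactSupport_ker n).fderiv ℝ) (h1.continuous_fderiv one_ne_zero), convolution_mul]
  rfl

lemma ae_tendsto_moll {u : Plane → ℝ} (hu : LocallyIntegrable u) :
    ∀ᵐ x, Tendsto (fun n => moll n u x) atTop (𝓝 (u x)) := by
  have := ContDiffBump.ae_convolution_tendsto_right_of_locallyIntegrable (φ := bump)
    (K := 2) (l := atTop) (μ := (volume : Measure Plane)) tendsto_rad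
    (Eventually.of_forall fun n => by simp [bump]; linarith) hu
  filter_upwards [this] with x hx
  simpa only [moll_eq_convolution'] using! hx

lemma integrable_mul_bdd {u k : Plane → ℝ} (hu : Integrable u) (hk : Continuous k) {C : ℝ}
    (hC : ∀ x, |k x| ≤ C) : Integrable fun x => u x * k x :=
  hu.mul_bdd (c := C) hk.aestronglyMeasurable (Eventually.of_forall hC)

lemma integrable_mul_ker {u : Plane → ℝ} (hu : Integrable u) (n : ℕ) (x : Plane) :
    Integrable fun y => u y * ker n (x - y) := by
  obtain ⟨C, -, hC⟩ := exists_bound (continuous_ker n) (hasCompactSupport_ker n)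
  exact integrable_mul_bdd hu ((continuous_ker n).comp (continuous_const.sub continuous_id))
    fun y => hC _

lemma abs_moll_le (n : ℕ) {u : Plane → ℝ} {c : ℝ} (h : ∀ x, |u x| ≤ c) (x : Plane) :
    |moll n u x| ≤ c := by
  rw [moll]
  calc |∫ y, u y * ker n (x - y)| ≤ ∫ y, c * ker n (x - y) := by
        rw [← Real.norm_eq_abs]
        refine norm_integral_le_of_norm_le ((integrable_ker_sub n x).const_mul c)
          (Eventually.of_forall fun y => ?_)
        rw [norm_mul, Real.norm_eq_abs, Real.norm_eq_abs, abs_of_nonneg (ker_nonneg n _)]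
        exact mul_le_mul_of_nonneg_right (h y) (ker_nonneg n _)
    _ = c := by rw [integral_const_mul, integral_ker_sub, mul_one]

lemma moll_sub_const (n : ℕ) {u : Plane → ℝ} (hu : Integrable u) (x : Plane) (z : ℝ) :
    moll n u x - z = ∫ y, (u y - z) * ker n (x - y) := by
  simp_rw [sub_mul]
  rw [integral_sub (integrable_mul_ker hu n x) ((integrable_ker_sub n x).const_mul z),
    integral_const_mul, integral_ker_sub, mul_one, moll]

lemma tsupport_moll_subset (n : ℕ) (u : Plane → ℝ) :
    tsupport (moll n u) ⊆ Metric.cthickening (rad n) (tsupport u) := by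
  refine closure_minimal ?_ Metric.isClosed_cthickening
  intro x hx
  by_contra hcon
  apply hx
  have : ∀ y, u y * ker n (x - y) = 0 := by
    intro y
    by_cases hy : u y = 0
    · simp [hy]
    · rw [ker_eq_zero, mul_zero]
      by_contra hlt
      exact hcon (Metric.mem_cthickening_of_dist_le x y _ _ (subset_tsupport u hy)
        (by rw [dist_eq_norm]; linarith))
  simp [moll, this]

lemma hasCompactSupport_moll (n : ℕ) {u : Plane → ℝ} (hu : HasCompactSupport u) :
    HasCompactSupport (moll n u) :=
  HasCompactSupport.of_support_subset_isCompact (K := Metric.cthickening (rad n) (tsupport u))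
    (IsCompact.cthickening hu) ((subset_tsupport _).trans (tsupport_moll_subset n u))

lemma pderiv_ker_neg (n : ℕ) (j : Fin 2) (x : Plane) :
    pderiv j (ker n) (-x) = - pderiv j (ker n) x := by
  have h1 : HasFDerivAt (ker n) (fderiv ℝ (ker n) (-x)) (-x) :=
    ((contDiff_ker n).differentiable (by simp) _).hasFDerivAt
  have h2 := h1.comp x (hasFDerivAt_id x).neg
  have h : ker n ∘ Neg.neg = ker n := by ext y; exact ker_neg n y
  rw [h] at h2
  simp [pderiv, h2.fderiv]

/-! ### Derivatives of test functions, and duality of mollification. -/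

lemma IsTest.continuous_pderiv {D : Set Plane} {φ : Plane → ℝ} (h : IsTest D φ) (j : Fin 2) :
    Continuous (pderiv j φ) :=
  (h.smooth.continuous_fderiv (by simp)).clm_apply continuous_const

lemma tsupport_pderiv_subset (j : Fin 2) (φ : Plane → ℝ) :
    tsupport (pderiv j φ) ⊆ tsupport φ := by
  refine closure_minimal (fun x hx => ?_) (isClosed_tsupport φ)
  by_contra hc
  apply hx
  have := (tsupport_fderiv_subset ℝ (f := φ))
  have h2 : fderiv ℝ φ x = 0 := by
    by_contra h3
    exact hc (this (subset_tsupport _ h3))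
  simp [pderiv, h2]

lemma IsTest.hasCompactSupport_pderiv {D : Set Plane} {φ : Plane → ℝ} (h : IsTest D φ)
    (j : Fin 2) : HasCompactSupport (pderiv j φ) :=
  h.compact.mono' ((subset_tsupport _).trans (tsupport_pderiv_subset j φ))

lemma IsTest.mono {D E : Set Plane} {φ : Plane → ℝ} (h : IsTest D φ) (hDE : D ⊆ E) :
    IsTest E φ := ⟨h.smooth, h.compact, h.support.trans hDE⟩

lemma isTest_ker (n : ℕ) : IsTest Set.univ (ker n) :=
  ⟨contDiff_ker n, hasCompactSupport_ker n, Set.subset_univ _⟩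

/-- Fubini's theorem for the action of a bounded continuous kernel. -/
lemma integral_kernel_comm {u g k : Plane → ℝ} (hu : Integrable u) (hg : Integrable g)
    (hk : Continuous k) {C : ℝ} (hC : ∀ x, |k x| ≤ C) :
    ∫ x, g x * ∫ y, u y * k (x - y) = ∫ y, u y * ∫ x, g x * k (x - y) := by
  simp_rw [← integral_const_mul]
  rw [integral_integral_swap]
  · refine integral_congr_ae (Eventually.of_forall fun y => integral_congr_ae
      (Eventually.of_forall fun x => ?_))
    simp only; ring
  · have h1 := (hg.mul_prod hu).mul_bdd (c := C) (g := fun p : Plane × Plane => k (p.1 - p.2))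
      (hk.comp (continuous_fst.sub continuous_snd)).aestronglyMeasurable
      (Eventually.of_forall fun p => hC _)
    refine h1.congr (Eventually.of_forall fun p => ?_)
    simp only [Function.uncurry]; ring

lemma integral_mul_moll_comm (n : ℕ) {u g : Plane → ℝ} (hu : Integrable u) (hg : Integrable g) :
    ∫ x, g x * moll n u x = ∫ x, u x * moll n g x := by
  obtain ⟨C, -, hC⟩ := exists_bound (continuous_ker n) (hasCompactSupport_ker n)
  refine (integral_kernel_comm hu hg (continuous_ker n) hC).trans ?_
  simp_rw [moll, fun y x => ker_sub_comm n y x]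

/-- The kernel is even, so its partial derivatives are odd; this produces the sign when Fubini moves
the kernel from one factor to the other. -/
lemma integral_mul_pderiv_moll (n : ℕ) {u g : Plane → ℝ} (hu : Integrable u) (hg : Integrable g)
    (j : Fin 2) :
    ∫ x, g x * pderiv j (moll n u) x = - ∫ x, u x * pderiv j (moll n g) x := by
  obtain ⟨C, -, hC⟩ := exists_bound ((isTest_ker n).continuous_pderiv j)
    ((isTest_ker n).hasCompactSupport_pderiv j)
  simp_rw [pderiv_moll n hu.locallyIntegrable, pderiv_moll n hg.locallyIntegrable]
  rw [integral_kernel_comm hu hg ((isTest_ker n).continuous_pderiv j) hC, ← integral_neg]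
  refine integral_congr_ae (Eventually.of_forall fun y => ?_)
  simp only
  rw [← mul_neg, ← integral_neg]
  congr 1
  refine integral_congr_ae (Eventually.of_forall fun x => ?_)
  simp only
  rw [← neg_sub y x, pderiv_ker_neg]; ring

/-- The mollification of an integrable function does not increase the `L¹` norm. -/
lemma lintegral_moll_le (n : ℕ) {u : Plane → ℝ} (hu : Integrable u) :
    ∫⁻ x, ‖moll n u x‖ₑ ≤ ∫⁻ x, ‖u x‖ₑ := by
  calc ∫⁻ x, ‖moll n u x‖ₑ ≤ ∫⁻ x, ∫⁻ y, ‖u y‖ₑ * ‖ker n (x - y)‖ₑ := by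
        refine lintegral_mono fun x => (enorm_integral_le_lintegral_enorm _).trans ?_
        simp_rw [enorm_mul]; exact le_rfl
    _ = ∫⁻ y, ∫⁻ x, ‖u y‖ₑ * ‖ker n (x - y)‖ₑ := by
        refine lintegral_lintegral_swap ?_
        refine AEMeasurable.mul (M := ℝ≥0∞) ?_ ?_
        · exact hu.aestronglyMeasurable.enorm.comp_snd
        · exact ((continuous_ker n).comp (continuous_fst.sub continuous_snd)).enorm.aemeasurable
    _ = ∫⁻ y, ‖u y‖ₑ := by
        refine lintegral_congr fun y => ?_
        rw [lintegral_const_mul _ (by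
            have := (continuous_ker n).comp (continuous_id.sub (continuous_const (y := y)))
            exact this.enorm.measurable),
          lintegral_sub_right_eq_self (fun x => ‖ker n x‖ₑ) y]
        have : ∫⁻ x, ‖ker n x‖ₑ = 1 := by
          rw [← ofReal_integral_norm_eq_lintegral_enorm (integrable_ker n)]
          simp_rw [Real.norm_of_nonneg (ker_nonneg n _), integral_ker, ENNReal.ofReal_one]
        rw [this, mul_one]

lemma integrable_moll (n : ℕ) {u : Plane → ℝ} (hu : Integrable u) : Integrable (moll n u) :=
  ⟨(continuous_moll n hu.locallyIntegrable).aestronglyMeasurable,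
    (lintegral_moll_le n hu).trans_lt hu.hasFiniteIntegral⟩

/-- Mollifications converge in `L¹`. -/
lemma tendsto_integral_moll_sub {u : Plane → ℝ} (hu : Integrable u) :
    Tendsto (fun n => ∫ x, |moll n u x - u x|) atTop (𝓝 0) := by
  have hle : ∀ n, ∫ x, |moll n u x| ≤ ∫ x, |u x| := fun n => by
    have h := ENNReal.toReal_mono hu.hasFiniteIntegral.ne (lintegral_moll_le n hu)
    rwa [← integral_norm_eq_lintegral_enorm hu.1,
      ← integral_norm_eq_lintegral_enorm (integrable_moll n hu).1] at h
  -- dominated convergence for the nonnegative functions below, bounded by `2 |u|`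
  have h1 : Tendsto (fun n => ∫ x, (|moll n u x - u x| - |moll n u x| + |u x|)) atTop
      (𝓝 (∫ x : Plane, (0:ℝ))) := by
    refine tendsto_integral_of_dominated_convergence (fun x => 2 * |u x|) (fun n => ?_)
      (hu.abs.const_mul 2) (fun n => ?_) ?_
    · exact (((((integrable_moll n hu).sub hu).abs).sub (integrable_moll n hu).abs).add hu.abs).1
    · refine Eventually.of_forall fun x => ?_
      rw [Real.norm_eq_abs, abs_le]
      have h1 := abs_sub_abs_le_abs_sub (moll n u x) (u x)
      have h2 := abs_sub (moll n u x) (u x)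
      constructor <;> linarith [abs_nonneg (u x)]
    · filter_upwards [ae_tendsto_moll hu.locallyIntegrable] with x hx
      have := ((hx.sub_const (u x)).abs.sub hx.abs).add_const |u x|
      simpa using this
  rw [integral_zero] at h1
  -- Mollification does not increase the `L¹` norm, so the terms `-|moll n u| + |u|` have a
  -- nonnegative integral and can be dropped.
  refine squeeze_zero (fun n => integral_nonneg fun x => abs_nonneg _) (fun n => ?_) h1
  have hi := integrable_moll n hu
  have e1 := integral_add ((hi.sub hu).abs.sub hi.abs) hu.abs
  have e2 := integral_sub (hi.sub hu).abs hi.abs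
  simp only [Pi.sub_apply] at e1 e2
  linarith [hle n]

/-! ### Composition of weakly differentiable functions with `C¹` functions -/

/-- The threshold for `n` depends only on `K` and `U`. This uniformity matters because `g` will
itself vary with `n`. -/
lemma eventually_isTest_moll {K U : Set Plane} (hK : IsCompact K) (hU : IsOpen U) (hKU : K ⊆ U) :
    ∀ᶠ n in atTop, ∀ g : Plane → ℝ, LocallyIntegrable g → tsupport g ⊆ K →
      IsTest U (moll n g) := by
  obtain ⟨r, hr, hrU⟩ := hK.exists_cthickening_subset_open hU hKU
  filter_upwards [tendsto_rad.eventually (gt_mem_nhds hr)] with n hn g hg hgK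
  have hc : HasCompactSupport g := hK.of_isClosed_subset (isClosed_tsupport g) hgK
  refine ⟨contDiff_moll n hg, hasCompactSupport_moll n hc, ?_⟩
  refine (tsupport_moll_subset n g).trans ((Metric.cthickening_mono hn.le _).trans ?_)
  exact (Metric.cthickening_subset_of_subset r hgK).trans hrU

lemma abs_sub_le_of_deriv_le {f : ℝ → ℝ} (hf : ContDiff ℝ 1 f) {L : ℝ}
    (hL : ∀ t, |deriv f t| ≤ L) (a b : ℝ) : |f a - f b| ≤ L * |a - b| :=
  Convex.norm_image_sub_le_of_norm_deriv_le (𝕜 := ℝ) (s := Set.univ)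
    (fun t _ => hf.differentiable one_ne_zero t) (fun t _ => hL t) convex_univ trivial trivial

lemma integrable_comp_mul {u k : Plane → ℝ} (hu : Integrable u) (hk : Continuous k)
    (hc : HasCompactSupport k) {f : ℝ → ℝ} (hf : Continuous f) {L : ℝ}
    (hL : ∀ a b, |f a - f b| ≤ L * |a - b|) : Integrable fun x => f (u x) * k x := by
  obtain ⟨C, hC0, hC⟩ := exists_bound hk hc
  have hL0 : 0 ≤ L := by simpa using (abs_nonneg _).trans (hL 1 0)
  refine Integrable.mono' (g := fun x => |f 0| * |k x| + L * C * |u x|)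
    (((hk.integrable_of_hasCompactSupport hc).abs.const_mul _).add (hu.abs.const_mul _))
    ((hf.comp_aestronglyMeasurable hu.1).mul hk.aestronglyMeasurable)
    (Eventually.of_forall fun x => ?_)
  rw [Real.norm_eq_abs, abs_mul]
  have h1 : |f (u x)| ≤ |f 0| + L * |u x| := by
    have := hL (u x) 0
    rw [sub_zero] at this
    linarith [abs_sub_abs_le_abs_sub (f (u x)) (f 0)]
  calc |f (u x)| * |k x| ≤ (|f 0| + L * |u x|) * |k x| := by gcongr
    _ = |f 0| * |k x| + L * |u x| * |k x| := by ring
    _ ≤ |f 0| * |k x| + L * |u x| * C := by gcongr; exact hC x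
    _ = _ := by ring

/-- Integration by parts and the classical chain rule for the smooth function `moll n u`, followed
by transposing the mollifier. The right side is the distributional derivative of `u` itself, tested
with a smooth function, so it remains meaningful when that derivative is only a measure. -/
lemma integral_comp_moll_mul_pderiv (n : ℕ) {U : Set Plane} {u : Plane → ℝ} (hu : Integrable u)
    {f : ℝ → ℝ} (hf : ContDiff ℝ 1 f) {φ : Plane → ℝ} (hφ : IsTest U φ) (j : Fin 2) :
    ∫ x, f (moll n u x) * pderiv j φ x =
      ∫ x, u x * pderiv j (moll n fun y => φ y * deriv f (moll n u y)) x := by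
  have hm : ContDiff ℝ 1 (moll n u) :=
    (contDiff_moll n hu.locallyIntegrable).of_le (by exact_mod_cast le_top)
  have hF : ContDiff ℝ 1 (fun x => f (moll n u x)) := hf.comp hm
  have hd : ∀ x, pderiv j (fun x => f (moll n u x)) x
      = deriv f (moll n u x) * pderiv j (moll n u) x := fun x => by
    have h1 : HasDerivAt f (deriv f (moll n u x)) (moll n u x) :=
      (hf.differentiable one_ne_zero _).hasDerivAt
    have h2 := h1.comp_hasFDerivAt x (hm.differentiable one_ne_zero x).hasFDerivAt
    simp only [pderiv]
    rw [show (fun x => f (moll n u x)) = f ∘ moll n u from rfl, h2.fderiv]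
    simp
  have hcd : Continuous (deriv f) := hf.continuous_deriv_one
  have hg : Continuous fun y => φ y * deriv f (moll n u y) :=
    hφ.smooth.continuous.mul (hcd.comp hm.continuous)
  have hgc : HasCompactSupport fun y => φ y * deriv f (moll n u y) := hφ.compact.mul_right
  have key := integral_mul_pderiv_moll n hu (hg.integrable_of_hasCompactSupport hgc) j
  have hFc : Continuous (fun x => pderiv j (fun x => f (moll n u x)) x) :=
    (hF.continuous_fderiv one_ne_zero).clm_apply continuous_const
  have hparts := integral_mul_fderiv_eq_neg_fderiv_mul_of_integrable (μ := (volume : Measure Plane))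
    (f := fun x => f (moll n u x)) (g := φ) (v := EuclideanSpace.single j 1)
    ((hFc.mul hφ.smooth.continuous).integrable_of_hasCompactSupport hφ.compact.mul_left)
    ((hF.continuous.mul (hφ.continuous_pderiv j)).integrable_of_hasCompactSupport
      (hφ.hasCompactSupport_pderiv j).mul_left)
    ((hF.continuous.mul hφ.smooth.continuous).integrable_of_hasCompactSupport
      hφ.compact.mul_left)
    (fun x _ => hF.differentiable one_ne_zero x)
    (fun x _ => hφ.smooth.differentiable (by simp) x)
  refine hparts.trans ?_
  rw [← neg_eq_iff_eq_neg.mpr key]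
  congr 1
  refine integral_congr_ae (Eventually.of_forall fun x => ?_)
  have := hd x
  simp only [pderiv] at this ⊢
  rw [this]; ring

/-- Approximation of the distributional derivative of `f ∘ u` by the one of `u`. -/
lemma tendsto_integral_mul_pderiv_moll {U : Set Plane} {u : Plane → ℝ} (hu : Integrable u)
    {f : ℝ → ℝ} (hf : ContDiff ℝ 1 f) {L : ℝ} (hL : ∀ t, |deriv f t| ≤ L)
    {φ : Plane → ℝ} (hφ : IsTest U φ) (j : Fin 2) :
    Tendsto (fun n => ∫ x, u x * pderiv j (moll n fun y => φ y * deriv f (moll n u y)) x) atTop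
      (𝓝 (∫ x, f (u x) * pderiv j φ x)) := by
  simp_rw [← integral_comp_moll_mul_pderiv _ hu hf hφ j]
  obtain ⟨C, hC0, hC⟩ := exists_bound (hφ.continuous_pderiv j) (hφ.hasCompactSupport_pderiv j)
  have hlip := abs_sub_le_of_deriv_le hf hL
  have hL0 : 0 ≤ L := (abs_nonneg _).trans (hL 0)
  have hi : ∀ {v : Plane → ℝ}, Integrable v → Integrable fun x => f (v x) * pderiv j φ x :=
    fun hv => integrable_comp_mul hv (hφ.continuous_pderiv j) (hφ.hasCompactSupport_pderiv j)
      hf.continuous hlip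
  rw [tendsto_iff_norm_sub_tendsto_zero]
  have h0 := (tendsto_integral_moll_sub hu).const_mul (L * C)
  rw [mul_zero] at h0
  refine squeeze_zero (fun n => norm_nonneg _) (fun n => ?_) h0
  rw [← integral_sub (hi (integrable_moll n hu)) (hi hu), ← integral_const_mul]
  refine norm_integral_le_of_norm_le (((integrable_moll n hu).sub hu).abs.const_mul _)
    (Eventually.of_forall fun x => ?_)
  rw [← sub_mul, norm_mul, Real.norm_eq_abs, Real.norm_eq_abs]
  calc |f (moll n u x) - f (u x)| * |pderiv j φ x|
      ≤ (L * |moll n u x - u x|) * C := by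
        gcongr
        · exact hlip _ _
        · exact hC x
    _ = L * C * |moll n u x - u x| := by ring

lemma abs_moll_sub_le (n : ℕ) {g : Plane → ℝ} (hg : Integrable g) {x : Plane} {c ε : ℝ}
    (h : ∀ y, dist y x < rad n → |g y - c| ≤ ε) : |moll n g x - c| ≤ ε := by
  rw [moll_sub_const n hg, ← Real.norm_eq_abs]
  calc ‖∫ y, (g y - c) * ker n (x - y)‖ ≤ ∫ y, ε * ker n (x - y) := by
        refine norm_integral_le_of_norm_le ((integrable_ker_sub n x).const_mul ε)
          (Eventually.of_forall fun y => ?_)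
        rw [norm_mul, Real.norm_eq_abs, Real.norm_eq_abs, abs_of_nonneg (ker_nonneg n _)]
        by_cases hy : dist y x < rad n
        · exact mul_le_mul_of_nonneg_right (h y hy) (ker_nonneg n _)
        · rw [ker_eq_zero (by rw [← dist_eq_norm, dist_comm]; linarith)]; simp
    _ = ε := by rw [integral_const_mul, integral_ker_sub, mul_one]

/-- The ball of radius `rad n` around `y` lies in the ball of radius `2 * rad n` around `x`. The
constant is `16 = 4 * 4`: one factor from `ker_le`, one from the ratio of the two areas. -/
lemma abs_moll_sub_le_average (n : ℕ) {u : Plane → ℝ} (hu : Integrable u) {x y : Plane} (z : ℝ)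
    (hy : dist y x ≤ rad n) :
    |moll n u y - z| ≤ 16 * ⨍ w in Metric.closedBall x (2 * rad n), |u w - z| := by
  have hr := rad_pos n
  set B := Metric.closedBall x (2 * rad n) with hB
  have hv : volume.real B = 4 * volume.real (Metric.closedBall (0 : Plane) (rad n)) := by
    rw [measureReal_def, measureReal_def, Measure.addHaar_closedBall _ _ (by positivity),
      Measure.addHaar_closedBall _ _ hr.le]
    simp [ENNReal.toReal_mul, ENNReal.toReal_ofReal, hr.le, mul_pow]
    ring
  have hv0 : 0 < volume.real (Metric.closedBall (0 : Plane) (rad n)) :=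
    ENNReal.toReal_pos (Metric.measure_closedBall_pos _ _ hr).ne' measure_closedBall_lt_top.ne
  rw [moll_sub_const n hu, setAverage_eq, smul_eq_mul, ← Real.norm_eq_abs]
  have hint : IntegrableOn (fun w => |u w - z|) B :=
    (hu.integrableOn.sub (integrableOn_const measure_closedBall_lt_top.ne)).abs
  have hcalc : ‖∫ w, (u w - z) * ker n (y - w)‖ ≤
      ∫ w, B.indicator (fun w => 4 / volume.real (Metric.closedBall (0 : Plane) (rad n))
        * |u w - z|) w := by
    refine norm_integral_le_of_norm_le ((integrable_indicator_iff
      Metric.isClosed_closedBall.measurableSet).2 (hint.const_mul _))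
      (Eventually.of_forall fun w => ?_)
    rw [norm_mul, Real.norm_eq_abs, Real.norm_eq_abs, abs_of_nonneg (ker_nonneg n _)]
    by_cases hw : w ∈ B
    · rw [Set.indicator_of_mem hw, mul_comm]
      exact mul_le_mul_of_nonneg_right (ker_le n _) (abs_nonneg _)
    · rw [Set.indicator_of_notMem hw, ker_eq_zero, mul_zero]
      by_contra hlt
      apply hw
      rw [hB, Metric.mem_closedBall]
      have := dist_triangle w y x
      rw [dist_comm w y, dist_eq_norm y w] at this
      linarith
  refine hcalc.trans (le_of_eq ?_)
  rw [integral_indicator Metric.isClosed_closedBall.measurableSet, integral_const_mul, hv]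
  field_simp
  norm_num
  rfl

/-- Behaviour of the mollified chain rule at a point of approximate continuity. -/
lemma tendsto_moll_mul_comp_moll {u : Plane → ℝ} (hu : Integrable u) {x : Plane} {z : ℝ}
    (hx : Tendsto (fun n => ⨍ w in Metric.closedBall x (2 * rad n), |u w - z|) atTop (𝓝 0))
    {φ : Plane → ℝ} (hφ : Continuous φ) (hc : HasCompactSupport φ) {h : ℝ → ℝ}
    (hh : Continuous h) :
    Tendsto (fun n => moll n (fun y => φ y * h (moll n u y)) x) atTop (𝓝 (φ x * h z)) := by
  have hcont : ContinuousAt (fun p : Plane × ℝ => φ p.1 * h p.2) (x, z) :=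
    ((hφ.comp continuous_fst).mul (hh.comp continuous_snd)).continuousAt
  rw [Metric.tendsto_atTop']
  intro ε hε
  obtain ⟨η, hη, hηε⟩ := Metric.continuousAt_iff.1 hcont (ε / 2) (half_pos hε)
  have e1 := tendsto_rad.eventually (gt_mem_nhds hη)
  have e2 := hx.eventually (gt_mem_nhds (show 0 < η / 16 by positivity))
  obtain ⟨N, hN⟩ := (e1.and e2).exists_forall_of_atTop
  refine ⟨N, fun n hn => ?_⟩
  obtain ⟨h1, h2⟩ := hN n hn.le
  have hm := continuous_moll n hu.locallyIntegrable
  have hg : Integrable fun y => φ y * h (moll n u y) :=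
    (hφ.mul (hh.comp hm)).integrable_of_hasCompactSupport hc.mul_right
  rw [Real.dist_eq]
  refine (abs_moll_sub_le n hg (ε := ε / 2) fun y hy => ?_).trans_lt (half_lt_self hε)
  -- The average around `x` controls `moll n u` at every point of the support of the outer kernel,
  -- hence the second mollification also converges.
  have h3 : dist ((y, moll n u y) : Plane × ℝ) (x, z) < η := by
    rw [Prod.dist_eq, max_lt_iff, Real.dist_eq]
    refine ⟨hy.trans h1, ?_⟩
    have := abs_moll_sub_le_average n hu z hy.le
    linarith
  have := hηε h3
  rw [Real.dist_eq] at this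
  exact this.le

lemma ae_tendsto_average {u : Plane → ℝ} (hu : Integrable u) :
    ∀ᵐ x, Tendsto (fun n => ⨍ w in Metric.closedBall x (2 * rad n), |u w - u x|) atTop (𝓝 0) := by
  filter_upwards [(Besicovitch.vitaliFamily (volume : Measure Plane)).ae_tendsto_average_norm_sub
    hu.locallyIntegrable] with x hx
  have h1 : Tendsto (fun n => 2 * rad n) atTop (𝓝[>] 0) := by
    refine tendsto_nhdsWithin_iff.2 ⟨?_, Eventually.of_forall fun n => ?_⟩
    · simpa using tendsto_rad.const_mul 2
    · have := rad_pos n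
      simp only [Set.mem_Ioi]; positivity
  exact (hx.comp (Besicovitch.tendsto_filterAt _ x)).comp h1

/-- The distributional derivative of `f ∘ u` as a limit of measures. -/
lemma tendsto_integral_moll_mul_measure {U : Set Plane} (hU : IsOpen U) {u : Plane → ℝ}
    (hu : Integrable u) {μ : Measure Plane} {s : Plane → ℝ} {j : Fin 2}
    (hs : ∀ φ, IsTest U φ → ∫ x, u x * pderiv j φ x = - ∫ x, φ x * s x ∂μ)
    {f : ℝ → ℝ} (hf : ContDiff ℝ 1 f) {L : ℝ} (hL : ∀ t, |deriv f t| ≤ L)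
    {φ : Plane → ℝ} (hφ : IsTest U φ) :
    Tendsto (fun n => ∫ x, moll n (fun y => φ y * deriv f (moll n u y)) x * s x ∂μ) atTop
      (𝓝 (- ∫ x, f (u x) * pderiv j φ x)) := by
  have h1 := (tendsto_integral_mul_pderiv_moll hu hf hL hφ j).neg
  refine h1.congr' ?_
  filter_upwards [eventually_isTest_moll hφ.compact.isCompact hU hφ.support] with n hn
  rw [hs _ (hn _ ?_ ?_), neg_neg]
  · exact (hφ.smooth.continuous.mul (hf.continuous_deriv_one.comp
      (continuous_moll n hu.locallyIntegrable))).locallyIntegrable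
  · exact tsupport_mul_subset_left

/-- The chain rule for weakly differentiable functions. -/
lemma integral_comp_mul_pderiv {U : Set Plane} (hU : IsOpen U) {u s : Plane → ℝ}
    (hu : Integrable u) (hsi : Integrable s) {j : Fin 2}
    (hs : ∀ φ, IsTest U φ → ∫ x, u x * pderiv j φ x = - ∫ x, φ x * s x)
    {f : ℝ → ℝ} (hf : ContDiff ℝ 1 f) {L : ℝ} (hL : ∀ t, |deriv f t| ≤ L)
    {φ : Plane → ℝ} (hφ : IsTest U φ) :
    ∫ x, f (u x) * pderiv j φ x = - ∫ x, φ x * (deriv f (u x) * s x) := by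
  have h1 := tendsto_integral_moll_mul_measure hU hu hs hf hL hφ
  obtain ⟨C, hC0, hC⟩ := exists_bound hφ.smooth.continuous hφ.compact
  have h2 : Tendsto (fun n => ∫ x, moll n (fun y => φ y * deriv f (moll n u y)) x * s x) atTop
      (𝓝 (∫ x, φ x * deriv f (u x) * s x)) := by
    refine tendsto_integral_of_dominated_convergence (fun x => C * L * |s x|) (fun n => ?_)
      (hsi.abs.const_mul _) (fun n => Eventually.of_forall fun x => ?_) ?_
    · refine (continuous_moll n ?_).aestronglyMeasurable.mul hsi.1
      exact (hφ.smooth.continuous.mul (hf.continuous_deriv_one.comp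
        (continuous_moll n hu.locallyIntegrable))).locallyIntegrable
    · rw [norm_mul, Real.norm_eq_abs, Real.norm_eq_abs]
      gcongr
      refine abs_moll_le n (fun y => ?_) x
      rw [abs_mul]
      gcongr
      · exact hC y
      · exact hL _
    -- Almost every point is a Lebesgue point, with approximate limit `u x`.
    · filter_upwards [ae_tendsto_average hu] with x hx
      exact (tendsto_moll_mul_comp_moll hu hx hφ.smooth.continuous hφ.compact
        hf.continuous_deriv_one).mul_const _
  have := tendsto_nhds_unique h1 h2
  simp_rw [← mul_assoc]
  linarith

/-! ### Test functions -/

/-- The value one is attained on a neighbourhood of `K`, so that the support of `1 - χ` stays away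
from `K`. -/
lemma exists_cutoff {K O : Set Plane} (hK : IsCompact K) (hO : IsOpen O) (hKO : K ⊆ O) :
    ∃ χ : Plane → ℝ, IsTest O χ ∧ (∀ x, 0 ≤ χ x ∧ χ x ≤ 1) ∧ ∀ᶠ x in 𝓝ˢ K, χ x = 1 := by
  obtain ⟨K', hK', hKK', hK'O⟩ := exists_compact_between hK hO hKO
  obtain ⟨f, h1, h0, hf⟩ := exists_contMDiffMap_one_nhds_of_subset_interior
    (modelWithCornersSelf ℝ Plane) (n := (⊤ : ℕ∞)) hK.isClosed hKK'
  have hs : tsupport f ⊆ K' := closure_minimal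
    (fun x hx => by by_contra hc; exact hx (h0 x hc)) hK'.isClosed
  exact ⟨f, ⟨f.contMDiff.contDiff, hK'.of_isClosed_subset (isClosed_tsupport _) hs,
    hs.trans hK'O⟩, hf, h1⟩

lemma IsTest.const_mul {D : Set Plane} {φ : Plane → ℝ} (h : IsTest D φ) (c : ℝ) :
    IsTest D fun x => c * φ x :=
  ⟨contDiff_const.mul h.smooth, h.compact.mul_left, tsupport_mul_subset_right.trans h.support⟩

lemma IsTest.mul_left {D : Set Plane} {φ g : Plane → ℝ} (h : IsTest D φ) (hg : ContDiff ℝ ∞ g) :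
    IsTest D fun x => g x * φ x :=
  ⟨hg.mul h.smooth, h.compact.mul_left, tsupport_mul_subset_right.trans h.support⟩

lemma IsTest.differentiable {D : Set Plane} {φ : Plane → ℝ} (h : IsTest D φ) :
    Differentiable ℝ φ := h.smooth.differentiable (by simp)

lemma pderiv_const_mul (j : Fin 2) {φ : Plane → ℝ} (h : Differentiable ℝ φ) (c : ℝ) (x : Plane) :
    pderiv j (fun x => c * φ x) x = c * pderiv j φ x := by
  simp only [pderiv]; rw [fderiv_const_mul (h x)]; simp

lemma pderiv_add (j : Fin 2) {φ ψ : Plane → ℝ} (h : Differentiable ℝ φ) (h' : Differentiable ℝ ψ)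
    (x : Plane) : pderiv j (fun x => φ x + ψ x) x = pderiv j φ x + pderiv j ψ x := by
  simp only [pderiv]; rw [fderiv_fun_add (h x) (h' x)]; simp

lemma IsTest.integrable_mul_pderiv {D : Set Plane} {φ u : Plane → ℝ} (h : IsTest D φ)
    (hu : Integrable u) (j : Fin 2) : Integrable fun x => u x * pderiv j φ x := by
  obtain ⟨C, -, hC⟩ := exists_bound (h.continuous_pderiv j) (h.hasCompactSupport_pderiv j)
  exact integrable_mul_bdd hu (h.continuous_pderiv j) hC

/-! ### Bounds on the total variation -/

/-- The components of the distributional gradient of `v` on `U` have total variation at most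
`M`. -/
def VarBound (U : Set Plane) (v : Plane → ℝ) (M : ℝ) : Prop :=
  ∀ φ, IsTest U φ → (∀ x, |φ x| ≤ 1) → ∀ j, |∫ x, v x * pderiv j φ x| ≤ M

lemma isTest_zero (U : Set Plane) : IsTest U fun _ => 0 :=
  ⟨contDiff_const, HasCompactSupport.zero, by simp [tsupport]⟩

lemma VarBound.nonneg {U : Set Plane} {v : Plane → ℝ} {M : ℝ} (h : VarBound U v M) : 0 ≤ M :=
  (abs_nonneg _).trans (h _ (isTest_zero U) (by simp) 0)

lemma VarBound.le_mul {U : Set Plane} {v : Plane → ℝ} {M : ℝ} (h : VarBound U v M)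
    {φ : Plane → ℝ} (hφ : IsTest U φ) {c : ℝ} (hc : 0 < c) (hb : ∀ x, |φ x| ≤ c) (j : Fin 2) :
    |∫ x, v x * pderiv j φ x| ≤ M * c := by
  have h1 := h _ (hφ.const_mul c⁻¹) (fun x => by
    rw [abs_mul, abs_of_pos (inv_pos.2 hc), inv_mul_le_iff₀ hc, mul_one]; exact hb x) j
  simp_rw [pderiv_const_mul j hφ.differentiable, mul_left_comm _ c⁻¹] at h1
  rwa [integral_const_mul, abs_mul, abs_of_pos (inv_pos.2 hc), inv_mul_le_iff₀ hc, mul_comm] at h1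

/-- The derivative of `f ∘ v` is a limit of derivatives of `v` tested with mollifications of `φ
f'(moll n v)`. These are admissible and bounded by one, so the constant does not deteriorate. -/
lemma VarBound.comp {U : Set Plane} (hU : IsOpen U) {v : Plane → ℝ} (hv : Integrable v) {M : ℝ}
    (h : VarBound U v M) {f : ℝ → ℝ} (hf : ContDiff ℝ 1 f) (hL : ∀ t, |deriv f t| ≤ 1) :
    VarBound U (fun x => f (v x)) M := by
  intro φ hφ hb j
  refine le_of_tendsto (tendsto_integral_mul_pderiv_moll hv hf hL hφ j).abs ?_
  filter_upwards [eventually_isTest_moll hφ.compact.isCompact hU hφ.support] with n hn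
  refine h _ (hn _ ?_ tsupport_mul_subset_left) (fun x => abs_moll_le n (fun y => ?_) x) j
  · exact (hφ.smooth.continuous.mul (hf.continuous_deriv_one.comp
      (continuous_moll n hv.locallyIntegrable))).locallyIntegrable
  · rw [abs_mul]
    exact mul_le_one₀ (hb y) (abs_nonneg _) (hL _)

/-- The absolute value is the limit of the smooth functions `√(t² + rad n ²)`, whose slopes are at
most one. Passing to `|v|` allows the mass estimates to be proved for nonnegative functions only. -/
lemma VarBound.abs {U : Set Plane} (hU : IsOpen U) {v : Plane → ℝ} (hv : Integrable v) {M : ℝ}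
    (h : VarBound U v M) : VarBound U (fun x => |v x|) M := by
  intro φ hφ hb j
  set f : ℕ → ℝ → ℝ := fun n t => √(t ^ 2 + rad n ^ 2) with hf
  have hpos : ∀ n t, 0 < t ^ 2 + rad n ^ 2 := fun n t => by have := rad_pos n; positivity
  have hfs : ∀ n, ContDiff ℝ 1 (f n) := fun n =>
    ((contDiff_id.pow 2).add contDiff_const).sqrt fun t => (hpos n t).ne'
  have hfd : ∀ n t, |deriv (f n) t| ≤ 1 := fun n t => by
    have h1 : HasDerivAt (f n) _ t :=
      (((hasDerivAt_id t).pow 2).add_const (rad n ^ 2)).sqrt (hpos n t).ne'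
    rw [h1.deriv, abs_div, div_le_one (by have := hpos n t; positivity)]
    simp only [id, Nat.cast_ofNat, mul_one, Nat.add_one_sub_one, pow_one]
    rw [abs_mul, abs_mul, abs_two, abs_of_nonneg (Real.sqrt_nonneg _)]
    gcongr
    exact Real.abs_le_sqrt (le_add_of_nonneg_right (sq_nonneg _))
  have hlim : Tendsto (fun n => ∫ x, f n (v x) * pderiv j φ x) atTop
      (𝓝 (∫ x, |v x| * pderiv j φ x)) := by
    obtain ⟨C, hC0, hC⟩ := exists_bound (hφ.continuous_pderiv j) (hφ.hasCompactSupport_pderiv j)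
    have hd : Integrable (pderiv j φ) :=
      (hφ.continuous_pderiv j).integrable_of_hasCompactSupport (hφ.hasCompactSupport_pderiv j)
    refine tendsto_integral_of_dominated_convergence
      (fun x => C * |v x| + |pderiv j φ x|) (fun n => ?_)
      ((hv.abs.const_mul C).add hd.abs)
      (fun n => Eventually.of_forall fun x => ?_) (Eventually.of_forall fun x => ?_)
    · exact ((hfs n).continuous.comp_aestronglyMeasurable hv.1).mul hd.1
    · have hle : f n (v x) ≤ |v x| + 1 := by
        refine Real.sqrt_le_iff.2 ⟨by positivity, ?_⟩
        have h1 : rad n ≤ 1 := by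
          rw [rad, div_le_one (by positivity)]
          linarith [Nat.cast_nonneg (α := ℝ) n]
        nlinarith [rad_pos n, sq_abs (v x), abs_nonneg (v x)]
      rw [norm_mul, Real.norm_eq_abs, Real.norm_eq_abs, abs_of_nonneg (Real.sqrt_nonneg _)]
      calc f n (v x) * |pderiv j φ x| ≤ (|v x| + 1) * |pderiv j φ x| := by gcongr
        _ = |v x| * |pderiv j φ x| + |pderiv j φ x| := by ring
        _ ≤ |v x| * C + |pderiv j φ x| := by gcongr; exact hC x
        _ = _ := by ring
    · refine Tendsto.mul_const _ ?_
      have h1 : Tendsto (fun n => √(v x ^ 2 + rad n ^ 2)) atTop (𝓝 √(v x ^ 2 + 0 ^ 2)) :=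
        ((tendsto_rad.pow 2).const_add _).sqrt
      simpa [Real.sqrt_sq_eq_abs] using h1
  exact le_of_tendsto hlim.abs (Eventually.of_forall fun n =>
    h.comp hU hv (hfs n) (hfd n) φ hφ hb j)

/-! ### Duality for the `L¹` norm -/

/-- The ideal test function is the sign of `w`; mollified and multiplied by `χ` it becomes
admissible, and dominated convergence recovers `|w|`. -/
lemma integral_test_mul_abs_le {O : Set Plane} {w : Plane → ℝ} (hw : Integrable w) {c : ℝ}
    (h : ∀ g, IsTest O g → (∀ x, |g x| ≤ 1) → ∫ x, w x * g x ≤ c) {χ : Plane → ℝ}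
    (hχ : IsTest O χ) (hχ1 : ∀ x, 0 ≤ χ x ∧ χ x ≤ 1) : ∫ x, |w x| * χ x ≤ c := by
  set sg : ℝ → ℝ := fun t => if 0 ≤ t then 1 else -1 with hsg
  have hsm : Measurable sg := Measurable.ite measurableSet_Ici measurable_const measurable_const
  have hs1 : ∀ t, |sg t| ≤ 1 := fun t => by simp only [hsg]; split_ifs <;> simp
  have hst : ∀ t, t * sg t = |t| := fun t => by
    simp only [hsg]; split_ifs with ht
    · simp [abs_of_nonneg ht]
    · simp [abs_of_neg (not_le.1 ht)]
  set s : Plane → ℝ := fun x => sg (w x)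
  have hsl : LocallyIntegrable s :=
    (locallyIntegrable_const (1:ℝ)).mono (hsm.comp_aemeasurable hw.1.aemeasurable).aestronglyMeasurable
      (Eventually.of_forall fun x => by simpa using hs1 (w x))
  have hlim : Tendsto (fun n => ∫ x, w x * (moll n s x * χ x)) atTop (𝓝 (∫ x, w x * (s x * χ x))) := by
    refine tendsto_integral_of_dominated_convergence (fun x => |w x|) (fun n => ?_) hw.abs
      (fun n => Eventually.of_forall fun x => ?_) ?_
    · exact hw.1.mul ((continuous_moll n hsl).mul hχ.smooth.continuous).aestronglyMeasurable
    · rw [norm_mul, norm_mul, Real.norm_eq_abs, Real.norm_eq_abs, Real.norm_eq_abs,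
        abs_of_nonneg (hχ1 x).1]
      refine mul_le_of_le_one_right (abs_nonneg _) (mul_le_one₀ ?_ (hχ1 x).1 (hχ1 x).2)
      exact abs_moll_le n (fun y => hs1 _) x
    · filter_upwards [ae_tendsto_moll hsl] with x hx
      exact (hx.mul_const _).const_mul _
  have heq : ∫ x, |w x| * χ x = ∫ x, w x * (s x * χ x) := by
    refine integral_congr_ae (Eventually.of_forall fun x => ?_)
    simp only
    rw [← mul_assoc, hst]
  rw [heq]
  refine le_of_tendsto hlim (Eventually.of_forall fun n =>
    h _ (hχ.mul_left (contDiff_moll n hsl)) fun x => ?_)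
  rw [abs_mul, abs_of_nonneg (hχ1 x).1]
  exact mul_le_one₀ (abs_moll_le n (fun y => hs1 _) x) (hχ1 x).1 (hχ1 x).2

/-- Inner regularity of the finite measure `|w| dx` reduces the open set to its compact subsets,
each of which has a cutoff. -/
lemma lintegral_enorm_le_of_isTest {O : Set Plane} (hO : IsOpen O) {w : Plane → ℝ}
    (hw : Integrable w) {c : ℝ}
    (h : ∀ g, IsTest O g → (∀ x, |g x| ≤ 1) → ∫ x, w x * g x ≤ c) :
    ∫⁻ x in O, ‖w x‖ₑ ≤ ENNReal.ofReal c := by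
  set ν : Measure Plane := volume.withDensity fun x => ‖w x‖ₑ
  have : IsFiniteMeasure ν := isFiniteMeasure_withDensity hw.hasFiniteIntegral.ne
  rw [← withDensity_apply _ hO.measurableSet, hO.measurableSet.measure_eq_iSup_isCompact]
  refine iSup₂_le fun K hKO => iSup_le fun hK => ?_
  obtain ⟨χ, hχ, hχ1, hχK⟩ := exists_cutoff hK hO hKO
  have h1 := integral_test_mul_abs_le hw h hχ hχ1
  rw [withDensity_apply _ hK.isClosed.measurableSet]
  refine le_trans ?_ (ENNReal.ofReal_le_ofReal h1)
  rw [ofReal_integral_eq_lintegral_ofReal, ← lintegral_indicator hK.isClosed.measurableSet]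
  · refine lintegral_mono fun x => ?_
    by_cases hx : x ∈ K
    · rw [Set.indicator_of_mem hx, subset_of_mem_nhdsSet hχK hx, mul_one,
        Real.enorm_eq_ofReal_abs]
    · rw [Set.indicator_of_notMem hx]; exact bot_le
  · obtain ⟨C, -, hC⟩ := exists_bound hχ.smooth.continuous hχ.compact
    exact integrable_mul_bdd hw.abs hχ.smooth.continuous hC
  · exact Eventually.of_forall fun x => mul_nonneg (abs_nonneg _) (hχ1 x).1

/-! ### Radial test fields -/

/-- In the plane the field `X(x) = (x - y) a(|x - y|²)` has divergence `2 (a + t a')` with `t = |x -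
y|²`. Both components are bounded by `c`, and halving the divergence cancels the factor two. Using
the squared distance keeps `X` smooth at `y`. -/
lemma abs_integral_radial_le {U : Set Plane} {v : Plane → ℝ} (hv : Integrable v) {M : ℝ}
    (h : VarBound U v M) (y : Plane) {a : ℝ → ℝ} (ha : ContDiff ℝ ∞ a)
    (hθ : IsTest U fun x => a (‖x - y‖ ^ 2)) {c : ℝ} (hc : 0 < c)
    (hb : ∀ x, |a (‖x - y‖ ^ 2)| * ‖x - y‖ ≤ c) :
    Integrable (fun x => v x * (a (‖x - y‖ ^ 2) + ‖x - y‖ ^ 2 * deriv a (‖x - y‖ ^ 2))) ∧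
    |∫ x, v x * (a (‖x - y‖ ^ 2) + ‖x - y‖ ^ 2 * deriv a (‖x - y‖ ^ 2))| ≤ M * c := by
  set X : Fin 2 → Plane → ℝ := fun j x => (x - y) j * a (‖x - y‖ ^ 2) with hX
  have hcoord : ∀ j : Fin 2, ContDiff ℝ ∞ fun x : Plane => (x - y) j := fun j => by fun_prop
  have hXt : ∀ j, IsTest U (X j) := fun j => hθ.mul_left (hcoord j)
  have hXb : ∀ j x, |X j x| ≤ c := fun j x => by
    rw [hX, abs_mul, mul_comm]
    refine le_trans ?_ (hb x)
    gcongr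
    exact PiLp.norm_apply_le (x - y) j
  have hder : ∀ j x, pderiv j (X j) x = a (‖x - y‖ ^ 2)
      + 2 * ((x - y) j) ^ 2 * deriv a (‖x - y‖ ^ 2) := fun j x => by
    have h1 : HasFDerivAt (fun x : Plane => (x - y) j)
        (EuclideanSpace.proj j : Plane →L[ℝ] ℝ) x := by
      have := ((EuclideanSpace.proj j : Plane →L[ℝ] ℝ).hasFDerivAt (x := x - y)).comp x
        ((hasFDerivAt_id x).sub_const y)
      exact this
    have h2 : HasFDerivAt (fun x : Plane => ‖x - y‖ ^ 2) _ x :=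
      ((hasFDerivAt_id x).sub_const y).norm_sq
    have h3 := (ha.differentiable (by simp) (‖x - y‖ ^ 2)).hasDerivAt.comp_hasFDerivAt x h2
    have h4 := (h1.mul h3).fderiv
    rw [pderiv, show X j = (fun x : Plane => (x - y) j) * (a ∘ fun x : Plane => ‖x - y‖ ^ 2) from rfl,
      h4]
    simp [EuclideanSpace.inner_single_right]
    ring
  have hsum : ∀ x, a (‖x - y‖ ^ 2) + ‖x - y‖ ^ 2 * deriv a (‖x - y‖ ^ 2)
      = (pderiv 0 (X 0) x + pderiv 1 (X 1) x) / 2 := fun x => by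
    rw [hder, hder]
    have : ‖x - y‖ ^ 2 = (x - y) 0 ^ 2 + (x - y) 1 ^ 2 := by
      rw [EuclideanSpace.norm_sq_eq, Fin.sum_univ_two]; simp
    rw [show ∀ A D p q : ℝ, (A + 2 * p * D + (A + 2 * q * D)) / 2 = A + (p + q) * D by
      intros; ring, ← this]
  have hi := fun j => (hXt j).integrable_mul_pderiv hv j
  refine ⟨(((hi 0).add (hi 1)).div_const 2).congr (Eventually.of_forall fun x => ?_), ?_⟩
  · simp only [hsum x, Pi.add_apply]; ring
  have e : ∫ x, v x * (a (‖x - y‖ ^ 2) + ‖x - y‖ ^ 2 * deriv a (‖x - y‖ ^ 2))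
      = ((∫ x, v x * pderiv 0 (X 0) x) + ∫ x, v x * pderiv 1 (X 1) x) / 2 := by
    rw [← integral_add (hi 0) (hi 1),
      ← integral_div]
    refine integral_congr_ae (Eventually.of_forall fun x => ?_)
    simp only [hsum x]; ring
  rw [e, abs_div, abs_two, div_le_iff₀ two_pos]
  refine (abs_add_le _ _).trans ?_
  linarith [h.le_mul (hXt 0) hc (hXb 0) 0, h.le_mul (hXt 1) hc (hXb 1) 1]

/-! ### Local Poincaré inequalities -/

/-- This turns a pointwise lower bound on the divergence `G` of a test field into a comparison of
the masses of `v` on two sets. -/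
lemma setIntegral_le_of_indicator_le {v G : Plane → ℝ} (hv : Integrable v) (hv0 : ∀ x, 0 ≤ v x)
    (hG : Integrable fun x => v x * G x) {c : ℝ} (hc : ∫ x, v x * G x ≤ c) {A B : Set Plane}
    (hA : MeasurableSet A) (hB : MeasurableSet B) {α β : ℝ}
    (h : ∀ x, α * A.indicator 1 x - β * B.indicator 1 x ≤ G x) :
    α * ∫ x in A, v x ≤ β * (∫ x in B, v x) + c := by
  have h1 : ∫ x, (α * A.indicator v x - β * B.indicator v x) ≤ ∫ x, v x * G x := by
    refine integral_mono (((hv.indicator hA).const_mul _).sub ((hv.indicator hB).const_mul _)) hG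
      fun x => ?_
    refine le_trans (le_of_eq ?_) (mul_le_mul_of_nonneg_left (h x) (hv0 x))
    by_cases hxA : x ∈ A <;> by_cases hxB : x ∈ B <;> simp [hxA, hxB] <;> ring
  rw [integral_sub ((hv.indicator hA).const_mul _) ((hv.indicator hB).const_mul _),
    integral_const_mul, integral_const_mul, integral_indicator hA, integral_indicator hB] at h1
  linarith

/-- A cutoff profile which is `1` on `(-∞, t₁]` and `0` on `[t₂, ∞)`. -/
def profile (t₁ t₂ t : ℝ) : ℝ := 1 - Real.smoothTransition ((t - t₁) / (t₂ - t₁))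

lemma contDiff_profile (t₁ t₂ : ℝ) : ContDiff ℝ ∞ (profile t₁ t₂) :=
  contDiff_const.sub (Real.smoothTransition.contDiff.comp
    ((contDiff_id.sub contDiff_const).div_const _))

lemma profile_nonneg (t₁ t₂ t : ℝ) : 0 ≤ profile t₁ t₂ t :=
  sub_nonneg.2 (Real.smoothTransition.le_one _)

lemma profile_le_one (t₁ t₂ t : ℝ) : profile t₁ t₂ t ≤ 1 :=
  sub_le_self _ (Real.smoothTransition.nonneg _)

lemma profile_eq_one {t₁ t₂ t : ℝ} (h : t₁ < t₂) (ht : t ≤ t₁) : profile t₁ t₂ t = 1 := by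
  rw [profile, Real.smoothTransition.zero_of_nonpos, sub_zero]
  exact div_nonpos_of_nonpos_of_nonneg (by linarith) (by linarith)

lemma profile_eq_zero {t₁ t₂ t : ℝ} (h : t₁ < t₂) (ht : t₂ ≤ t) : profile t₁ t₂ t = 0 := by
  rw [profile, Real.smoothTransition.one_of_one_le, sub_self]
  rw [le_div_iff₀ (by linarith)]; linarith

lemma deriv_profile_nonpos {t₁ t₂ : ℝ} (h : t₁ < t₂) (t : ℝ) : deriv (profile t₁ t₂) t ≤ 0 := by
  have : Antitone (profile t₁ t₂) := fun a b hab => sub_le_sub_left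
    (Real.smoothTransition.monotone (by gcongr)) _
  exact this.deriv_nonpos

lemma hasDerivAt_profile (t₁ t₂ t : ℝ) :
    HasDerivAt (profile t₁ t₂) (deriv (profile t₁ t₂) t) t :=
  ((contDiff_profile t₁ t₂).differentiable (by simp) t).hasDerivAt

lemma deriv_profile_eq_zero {t₁ t₂ t : ℝ} (h : t₁ < t₂) (ht : t < t₁ ∨ t₂ < t) :
    deriv (profile t₁ t₂) t = 0 := by
  rcases ht with ht | ht
  · have : profile t₁ t₂ =ᶠ[𝓝 t] fun _ => 1 := by
      filter_upwards [gt_mem_nhds ht] with s hs using profile_eq_one h hs.le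
    rw [this.deriv_eq, deriv_const]
  · have : profile t₁ t₂ =ᶠ[𝓝 t] fun _ => 0 := by
      filter_upwards [lt_mem_nhds ht] with s hs using profile_eq_zero h hs.le
    rw [this.deriv_eq, deriv_const]

lemma isTest_radial {U : Set Plane} (y : Plane) {a : ℝ → ℝ} (ha : ContDiff ℝ ∞ a)
    {K : Set Plane} (hK : IsCompact K) (hKU : K ⊆ U) (h : ∀ x, x ∉ K → a (‖x - y‖ ^ 2) = 0) :
    IsTest U fun x => a (‖x - y‖ ^ 2) := by
  have hs : tsupport (fun x => a (‖x - y‖ ^ 2)) ⊆ K :=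
    closure_minimal (fun x hx => by by_contra hc; exact hx (h x hc)) hK.isClosed
  exact ⟨ha.comp ((contDiff_id.sub contDiff_const).norm_sq ℝ),
    hK.of_isClosed_subset (isClosed_tsupport _) hs, hs.trans hKU⟩

/-- The mass of a function on a ball is controlled by the mass on a smaller concentric ball and
the total variation. -/
lemma exists_closedBall_bound {U : Set Plane} {y : Plane} {r R' R : ℝ} (hr : 0 < r) (hrR : r < R')
    (hR : R' < R) (hU : Metric.closedBall y R ⊆ U) :
    ∃ C, ∀ (v : Plane → ℝ) (M : ℝ), Integrable v → (∀ x, 0 ≤ v x) → VarBound U v M →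
      ∫ x in Metric.closedBall y R', v x ≤ C * ((∫ x in Metric.closedBall y r, v x) + M) := by
  have hlt : R' ^ 2 < R ^ 2 := by nlinarith
  -- The profile is `a = exp(-K t) ζ`, for which `-(a + t a') = exp(-K t) (ζ (K t - 1) - t ζ')`.
  -- With `K = 2 / r²` one has `K t - 1 ≥ 1` outside the small ball, so this is at least `κ` on the
  -- rest of the ball of radius `R'`, while inside the small ball it is at least `-1 = κ - (1 + κ)`.
  set K : ℝ := 2 / r ^ 2 with hK
  have hK0 : 0 < K := by positivity
  set ζ := profile (R' ^ 2) (R ^ 2) with hζ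
  set a : ℝ → ℝ := fun t => Real.exp (-(K * t)) * ζ t with ha
  set κ := Real.exp (-(K * R' ^ 2)) with hκ
  have hκ0 : 0 < κ := Real.exp_pos _
  have hκ1 : κ ≤ 1 := Real.exp_le_one_iff.2 (by have := sq_nonneg R'; nlinarith)
  have has : ContDiff ℝ ∞ a :=
    (Real.contDiff_exp.comp (contDiff_const.mul contDiff_id).neg).mul (contDiff_profile _ _)
  have hda : ∀ t, deriv a t = Real.exp (-(K * t)) * (-K * ζ t + deriv ζ t) := fun t => by
    have h1 : HasDerivAt (fun t => Real.exp (-(K * t))) (Real.exp (-(K * t)) * -(K * 1)) t :=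
      ((hasDerivAt_id t).const_mul K).neg.exp
    exact (h1.mul (hasDerivAt_profile _ _ t)).deriv.trans (by ring)
  have hR0 : 0 < R := by linarith
  have htest : IsTest U fun x => a (‖x - y‖ ^ 2) := by
    refine isTest_radial y has (isCompact_closedBall y R) hU fun x hx => ?_
    rw [Metric.mem_closedBall, dist_eq_norm, not_le] at hx
    simp only [ha, hζ]
    rw [profile_eq_zero hlt (by gcongr), mul_zero]
  have hb : ∀ x, |a (‖x - y‖ ^ 2)| * ‖x - y‖ ≤ R := fun x => by
    by_cases hx : ‖x - y‖ ≤ R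
    · have h1 : |a (‖x - y‖ ^ 2)| ≤ 1 := by
        rw [ha, abs_mul, Real.abs_exp, abs_of_nonneg (profile_nonneg _ _ _)]
        exact mul_le_one₀ (Real.exp_le_one_iff.2 (by
          have := mul_nonneg hK0.le (sq_nonneg ‖x - y‖); linarith))
          (profile_nonneg _ _ _) (profile_le_one _ _ _)
      calc _ ≤ 1 * ‖x - y‖ := by gcongr
        _ ≤ R := by linarith
    · simp only [ha, hζ]
      rw [profile_eq_zero hlt (by gcongr; exact (not_le.1 hx).le), mul_zero, abs_zero, zero_mul]
      exact hR0.le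
  refine ⟨(2 + R) / κ, fun v M hv hv0 hM => ?_⟩
  obtain ⟨hint, hle⟩ := abs_integral_radial_le hv hM y has htest hR0 hb
  have key := setIntegral_le_of_indicator_le (A := Metric.closedBall y R')
    (B := Metric.closedBall y r) (α := κ) (β := 1 + κ) (c := M * R)
    (G := fun x => -(a (‖x - y‖ ^ 2) + ‖x - y‖ ^ 2 * deriv a (‖x - y‖ ^ 2))) hv hv0
    (hint.neg.congr (Eventually.of_forall fun x => by simp only [Pi.neg_apply]; ring))
    (by simp_rw [mul_neg]; rw [integral_neg]; exact (neg_le_abs _).trans hle)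
    Metric.isClosed_closedBall.measurableSet Metric.isClosed_closedBall.measurableSet ?_
  · have h0 : 0 ≤ ∫ x in Metric.closedBall y r, v x := integral_nonneg hv0
    have hM0 := hM.nonneg
    rw [div_mul_eq_mul_div, le_div_iff₀ hκ0]
    nlinarith
  · intro x
    rw [hda]
    set t := ‖x - y‖ ^ 2 with ht
    have ht0 : 0 ≤ t := sq_nonneg _
    set e := Real.exp (-(K * t)) with he
    have he0 : 0 < e := Real.exp_pos _
    have he1 : e ≤ 1 := Real.exp_le_one_iff.2 (by have := mul_nonneg hK0.le ht0; linarith)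
    have hζ0 : 0 ≤ ζ t := profile_nonneg _ _ _
    have hζ1 : ζ t ≤ 1 := profile_le_one _ _ _
    have hζ' : deriv ζ t ≤ 0 := deriv_profile_nonpos hlt t
    have hG : -(a t + t * (e * (-K * ζ t + deriv ζ t))) = e * (ζ t * (K * t - 1) - t * deriv ζ t) := by
      simp only [ha, ← he]; ring
    rw [hG]
    have hneg : 0 ≤ -(t * deriv ζ t) := by have := mul_nonneg ht0 (neg_nonneg.2 hζ'); linarith
    by_cases hxr : ‖x - y‖ ≤ r
    · have m1 : x ∈ Metric.closedBall y r := by rwa [Metric.mem_closedBall, dist_eq_norm]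
      have m2 : x ∈ Metric.closedBall y R' := Metric.closedBall_subset_closedBall hrR.le m1
      simp only [Set.indicator_of_mem m1, Set.indicator_of_mem m2, Pi.one_apply]
      have h1 : -1 ≤ ζ t * (K * t - 1) := by
        have := mul_nonneg hζ0 (mul_nonneg hK0.le ht0); linarith
      nlinarith
    · have m1 : x ∉ Metric.closedBall y r := by rwa [Metric.mem_closedBall, dist_eq_norm]
      have hKt : 2 ≤ K * t := by
        rw [hK, ht, div_mul_eq_mul_div, le_div_iff₀ (by positivity)]
        have : r ^ 2 ≤ ‖x - y‖ ^ 2 := by gcongr; exact (not_le.1 hxr).le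
        linarith
      have h1 : ζ t ≤ ζ t * (K * t - 1) - t * deriv ζ t := by nlinarith
      have h2 : e * ζ t ≤ e * (ζ t * (K * t - 1) - t * deriv ζ t) := by gcongr
      refine le_trans ?_ h2
      rw [Set.indicator_of_notMem m1, mul_zero, sub_zero]
      by_cases m2 : x ∈ Metric.closedBall y R'
      · rw [Metric.mem_closedBall, dist_eq_norm] at m2
        have h3 : t ≤ R' ^ 2 := by rw [ht]; gcongr
        rw [Set.indicator_of_mem (by rwa [Metric.mem_closedBall, dist_eq_norm]), Pi.one_apply,
          hζ, profile_eq_one hlt h3, mul_one, mul_one, hκ, he]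
        gcongr
      · rw [Set.indicator_of_notMem m2, mul_zero]; positivity

/-- The mass of a function in thin annuli around a disc is small, uniformly in terms of the total
variation and of the mass in a fixed surrounding ring. -/
lemma exists_annulus_bound {U : Set Plane} {P : Plane} {δ t₁ t₂ : ℝ} (hδ : 0 < δ)
    (h₁ : δ ^ 2 < t₁) (h₂ : t₁ < t₂) (hU : {x | δ ^ 2 < ‖x - P‖ ^ 2 ∧ ‖x - P‖ ^ 2 ≤ t₂} ⊆ U) :
    ∃ C, 0 ≤ C ∧ ∀ η, 0 < η → δ ^ 2 + η ≤ t₁ → ∀ (v : Plane → ℝ) (M : ℝ), Integrable v →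
      (∀ x, 0 ≤ v x) → VarBound U v M →
      ∫ x in {x | δ ^ 2 < ‖x - P‖ ^ 2 ∧ ‖x - P‖ ^ 2 < δ ^ 2 + η}, v x ≤
        C * η * ((∫ x in {x | t₁ ≤ ‖x - P‖ ^ 2 ∧ ‖x - P‖ ^ 2 ≤ t₂}, v x) + M) := by
  set ζ := profile t₁ t₂ with hζ
  obtain ⟨Z, hZ⟩ := (isCompact_Icc (a := t₁) (b := t₂)).exists_bound_of_continuousOn
    (f := deriv ζ) ((contDiff_profile t₁ t₂).continuous_deriv (by simp)).continuousOn
  have hZ0 : 0 ≤ Z := (norm_nonneg _).trans (hZ t₁ ⟨le_rfl, h₂.le⟩)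
  have ht₂ : 0 < t₂ := by nlinarith
  have hδ2 : 0 < δ ^ 2 := by positivity
  have hcn : Continuous fun x : Plane => ‖x - P‖ ^ 2 := by fun_prop
  refine ⟨(t₂ * Z + √t₂) * Real.exp 1 / δ ^ 2, by positivity, fun η hη hηt v M hv hv0 hM => ?_⟩
  have hM0 := hM.nonneg
  have hring0 : 0 ≤ ∫ x in {x | t₁ ≤ ‖x - P‖ ^ 2 ∧ ‖x - P‖ ^ 2 ≤ t₂}, v x := integral_nonneg hv0
  have hringm : MeasurableSet {x : Plane | t₁ ≤ ‖x - P‖ ^ 2 ∧ ‖x - P‖ ^ 2 ≤ t₂} :=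
    ((isClosed_le continuous_const hcn).inter (isClosed_le hcn continuous_const)).measurableSet
  -- the estimate away from the boundary of the disc
  have main : ∀ κ, 0 < κ →
      δ ^ 2 * Real.exp (-1) * ∫ x in {x | δ ^ 2 + 2 * κ < ‖x - P‖ ^ 2 ∧ ‖x - P‖ ^ 2 < δ ^ 2 + η}, v x
      ≤ (η * t₂ * Z) * (∫ x in {x | t₁ ≤ ‖x - P‖ ^ 2 ∧ ‖x - P‖ ^ 2 ≤ t₂}, v x)
        + M * (η * √t₂) := by
    intro κ hκ
    set s : ℝ → ℝ := fun t => 1 - profile (δ ^ 2 + κ) (δ ^ 2 + 2 * κ) t with hs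
    have hκκ : δ ^ 2 + κ < δ ^ 2 + 2 * κ := by linarith
    -- The factor `p` is at most `η`, yet its slope is at least `exp(-1)` throughout the annulus.
    -- The field therefore has size `O(η)` but divergence bounded below there, which gives mass
    -- `O(η)`.
    set p : ℝ → ℝ := fun t => η * (1 - Real.exp (-((t - δ ^ 2) / η))) with hp
    set a : ℝ → ℝ := fun t => s t * p t * ζ t with ha
    have has : ContDiff ℝ ∞ a :=
      ((contDiff_const.sub (contDiff_profile _ _)).mul (contDiff_const.mul (contDiff_const.sub
        (Real.contDiff_exp.comp (((contDiff_id.sub contDiff_const).div_const _)).neg)))).mul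
        (contDiff_profile _ _)
    have hs0 : ∀ t, 0 ≤ s t := fun t => sub_nonneg.2 (profile_le_one _ _ _)
    have hs1 : ∀ t, s t ≤ 1 := fun t => sub_le_self _ (profile_nonneg _ _ _)
    have hs' : ∀ t, HasDerivAt s (-deriv (profile (δ ^ 2 + κ) (δ ^ 2 + 2 * κ)) t) t := fun t =>
      (hasDerivAt_profile _ _ t).const_sub 1
    have hp' : ∀ t, HasDerivAt p (Real.exp (-((t - δ ^ 2) / η))) t := fun t => by
      have h1 : HasDerivAt p _ t :=
        ((((((hasDerivAt_id t).sub_const (δ ^ 2)).div_const η).neg).exp).const_sub 1).const_mul η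
      convert h1 using 1
      simp only [id]
      field_simp
      rfl
    have hda : ∀ t, deriv a t = (-deriv (profile (δ ^ 2 + κ) (δ ^ 2 + 2 * κ)) t * p t
        + s t * Real.exp (-((t - δ ^ 2) / η))) * ζ t + s t * p t * deriv ζ t := fun t =>
      (((hs' t).mul (hp' t)).mul (hasDerivAt_profile _ _ t)).deriv
    have hsz : ∀ t, t ≤ δ ^ 2 + κ → s t = 0 := fun t ht => by
      simp only [hs]; rw [profile_eq_one hκκ ht, sub_self]
    have hp0 : ∀ t, δ ^ 2 ≤ t → 0 ≤ p t ∧ p t ≤ η := fun t ht => by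
      have h1 : Real.exp (-((t - δ ^ 2) / η)) ≤ 1 := Real.exp_le_one_iff.2
        (neg_nonpos.2 (div_nonneg (by linarith) hη.le))
      have h2 := Real.exp_pos (-((t - δ ^ 2) / η))
      constructor <;> simp only [hp] <;> nlinarith
    have habs : ∀ t, 0 ≤ a t ∧ a t ≤ η := fun t => by
      by_cases ht : t ≤ δ ^ 2 + κ
      · simp [ha, hsz t ht, hη.le]
      · obtain ⟨q0, q1⟩ := hp0 t (by linarith)
        have z0 := profile_nonneg t₁ t₂ t
        have z1 := profile_le_one t₁ t₂ t
        refine ⟨mul_nonneg (mul_nonneg (hs0 t) q0) z0, ?_⟩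
        calc s t * p t * ζ t ≤ 1 * η * 1 := by
              gcongr
              · exact hs1 t
          _ = η := by ring
    have htest : IsTest U fun x => a (‖x - P‖ ^ 2) := by
      refine isTest_radial P has
        (K := {x | δ ^ 2 + κ ≤ ‖x - P‖ ^ 2 ∧ ‖x - P‖ ^ 2 ≤ t₂}) ?_ ?_ fun x hx => ?_
      · refine (isCompact_closedBall P (√t₂)).of_isClosed_subset
          ((isClosed_le continuous_const hcn).inter (isClosed_le hcn continuous_const))
          fun x hx => ?_
        rw [Metric.mem_closedBall, dist_eq_norm]
        exact Real.le_sqrt_of_sq_le hx.2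
      · exact fun x hx => hU ⟨by linarith [hx.1], hx.2⟩
      · by_cases h : δ ^ 2 + κ ≤ ‖x - P‖ ^ 2
        · have h2 : t₂ ≤ ‖x - P‖ ^ 2 := by
            by_contra hc; exact hx ⟨h, (not_le.1 hc).le⟩
          simp only [ha, hζ]; rw [profile_eq_zero h₂ h2, mul_zero]
        · simp only [ha]; rw [hsz _ (not_le.1 h).le, zero_mul, zero_mul]
    have hb : ∀ x, |a (‖x - P‖ ^ 2)| * ‖x - P‖ ≤ η * √t₂ := fun x => by
      by_cases hx : ‖x - P‖ ^ 2 ≤ t₂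
      · rw [abs_of_nonneg (habs _).1]
        gcongr
        · exact (habs _).2
        · exact Real.le_sqrt_of_sq_le hx
      · simp only [ha, hζ]
        rw [profile_eq_zero h₂ (not_le.1 hx).le, mul_zero, abs_zero, zero_mul]
        positivity
    obtain ⟨hint, hle⟩ := abs_integral_radial_le hv hM P has htest (by positivity) hb
    have hAm : MeasurableSet {x | δ ^ 2 + 2 * κ < ‖x - P‖ ^ 2 ∧ ‖x - P‖ ^ 2 < δ ^ 2 + η} :=
      ((isOpen_lt continuous_const hcn).inter (isOpen_lt hcn continuous_const)).measurableSet
    refine setIntegral_le_of_indicator_le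
      (A := {x | δ ^ 2 + 2 * κ < ‖x - P‖ ^ 2 ∧ ‖x - P‖ ^ 2 < δ ^ 2 + η})
      hv hv0 hint ((le_abs_self _).trans hle) hAm
      hringm fun x => ?_
    rw [hda]
    set t := ‖x - P‖ ^ 2 with ht
    by_cases ht0 : t ≤ δ ^ 2
    · have e1 : deriv (profile (δ ^ 2 + κ) (δ ^ 2 + 2 * κ)) t = 0 :=
        deriv_profile_eq_zero hκκ (Or.inl (by linarith))
      have e2 : s t = 0 := hsz t (by linarith)
      rw [Set.indicator_of_notMem (by simp only [Set.mem_ofPred_eq, ← ht]; intro h; linarith [h.1]),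
        Set.indicator_of_notMem (by simp only [Set.mem_ofPred_eq, ← ht]; intro h; linarith [h.1]), e1, e2]
      simp [ha, e2]
    · rw [not_le] at ht0
      obtain ⟨q0, q1⟩ := hp0 t ht0.le
      have z0 : 0 ≤ ζ t := profile_nonneg t₁ t₂ t
      have d0 := deriv_profile_nonpos hκκ t
      have a0 := (habs t).1
      have e0 := Real.exp_pos (-((t - δ ^ 2) / η))
      -- The inner cutoff `s` is increasing, so its large slope contributes with the favourable
      -- sign. Thus the bound does not depend on `κ`, which can tend to zero; only the outer cutoff
      -- `ζ` has to be paid for, in the ring.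
      have T1 : 0 ≤ -deriv (profile (δ ^ 2 + κ) (δ ^ 2 + 2 * κ)) t * p t :=
        mul_nonneg (neg_nonneg.2 d0) q0
      have T2 : 0 ≤ s t * Real.exp (-((t - δ ^ 2) / η)) := mul_nonneg (hs0 t) e0.le
      by_cases hr : t₁ ≤ t ∧ t ≤ t₂
      · rw [Set.indicator_of_notMem (by simp only [Set.mem_ofPred_eq, ← ht]; intro h; linarith [h.2]),
          Set.indicator_of_mem (by simpa only [Set.mem_ofPred_eq, ← ht] using hr)]
        have hz := hZ t hr
        rw [Real.norm_eq_abs, abs_le] at hz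
        have T3 : -(η * Z) ≤ s t * p t * deriv ζ t := by
          have : s t * p t ≤ η := by
            calc s t * p t ≤ 1 * η := by
                  gcongr
                  exact hs1 t
              _ = η := one_mul η
          have h0 : 0 ≤ s t * p t := mul_nonneg (hs0 t) q0
          nlinarith
        have T4 : -(η * Z) ≤ (-deriv (profile (δ ^ 2 + κ) (δ ^ 2 + 2 * κ)) t * p t
            + s t * Real.exp (-((t - δ ^ 2) / η))) * ζ t + s t * p t * deriv ζ t := by
          have := mul_nonneg (add_nonneg T1 T2) z0
          linarith
        have T5 := mul_le_mul_of_nonneg_left T4 (show 0 ≤ t by linarith)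
        have T6 : t * (η * Z) ≤ t₂ * (η * Z) := by gcongr; exact hr.2
        simp only [Pi.one_apply]
        linarith
      · have hd : deriv ζ t = 0 := by
          refine deriv_profile_eq_zero h₂ ?_
          by_contra hc
          push Not at hc
          exact hr hc
        rw [Set.indicator_of_notMem (s := {x | t₁ ≤ ‖x - P‖ ^ 2 ∧ ‖x - P‖ ^ 2 ≤ t₂})
          (by simpa only [Set.mem_ofPred_eq, ← ht] using hr), hd, mul_zero, mul_zero, sub_zero, add_zero]
        by_cases hA : δ ^ 2 + 2 * κ < t ∧ t < δ ^ 2 + η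
        · rw [Set.indicator_of_mem (by simpa only [Set.mem_ofPred_eq, ← ht] using hA), Pi.one_apply, mul_one]
          have e1 : s t = 1 := by
            simp only [hs]; rw [profile_eq_zero hκκ hA.1.le, sub_zero]
          have e2 : ζ t = 1 := profile_eq_one h₂ (by linarith [hA.2])
          have e3 : Real.exp (-1) ≤ Real.exp (-((t - δ ^ 2) / η)) := by
            gcongr
            rw [div_le_one hη]; linarith [hA.2]
          rw [e1, e2, mul_one, one_mul]
          have : δ ^ 2 * Real.exp (-1) ≤ t * Real.exp (-((t - δ ^ 2) / η)) := by gcongr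
          have := mul_nonneg (show 0 ≤ t by linarith) T1
          linarith
        · rw [Set.indicator_of_notMem (by simpa only [Set.mem_ofPred_eq, ← ht] using hA), mul_zero]
          have := mul_nonneg (show 0 ≤ t by linarith) (mul_nonneg (add_nonneg T1 T2) z0)
          linarith
  -- exhaustion of the annulus
  have hlim : Tendsto (fun n => ∫ x in {x | δ ^ 2 + 2 * rad n < ‖x - P‖ ^ 2 ∧
      ‖x - P‖ ^ 2 < δ ^ 2 + η}, v x) atTop
      (𝓝 (∫ x in {x | δ ^ 2 < ‖x - P‖ ^ 2 ∧ ‖x - P‖ ^ 2 < δ ^ 2 + η}, v x)) := by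
    have hU' : {x | δ ^ 2 < ‖x - P‖ ^ 2 ∧ ‖x - P‖ ^ 2 < δ ^ 2 + η} =
        ⋃ n, {x | δ ^ 2 + 2 * rad n < ‖x - P‖ ^ 2 ∧ ‖x - P‖ ^ 2 < δ ^ 2 + η} := by
      ext x
      simp only [Set.mem_iUnion, Set.mem_ofPred_eq, exists_and_right]
      refine and_congr_left fun _ => ⟨fun h => ?_, fun ⟨n, hn⟩ => by linarith [rad_pos n]⟩
      have h2 : Tendsto (fun n => δ ^ 2 + 2 * rad n) atTop (𝓝 (δ ^ 2 + 2 * 0)) :=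
        (tendsto_rad.const_mul 2).const_add _
      exact (h2.eventually (gt_mem_nhds (by linarith))).exists
    rw [hU']
    refine tendsto_setIntegral_of_monotone (fun n => ((isOpen_lt continuous_const hcn).inter
      (isOpen_lt hcn continuous_const)).measurableSet) (fun m n hmn x hx => ⟨?_, hx.2⟩)
      hv.integrableOn
    have : rad n ≤ rad m := by
      unfold rad; gcongr
    linarith [hx.1]
  have hfin := le_of_tendsto (hlim.const_mul (δ ^ 2 * Real.exp (-1)))
    (Eventually.of_forall fun n => main (rad n) (rad_pos n))
  rw [Real.exp_neg] at hfin
  have h3 : (δ ^ 2 * (Real.exp 1)⁻¹) * ∫ x in {x | δ ^ 2 < ‖x - P‖ ^ 2 ∧ ‖x - P‖ ^ 2 < δ ^ 2 + η}, v x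
      ≤ (t₂ * Z + √t₂) * η * ((∫ x in {x | t₁ ≤ ‖x - P‖ ^ 2 ∧ ‖x - P‖ ^ 2 ≤ t₂}, v x) + M) := by
    refine hfin.trans ?_
    have q1 : 0 ≤ t₂ * Z * η * M := by positivity
    have q2 : 0 ≤ √t₂ * η * ∫ x in {x | t₁ ≤ ‖x - P‖ ^ 2 ∧ ‖x - P‖ ^ 2 ≤ t₂}, v x := by positivity
    linarith
  have he := Real.exp_pos 1
  calc ∫ x in {x | δ ^ 2 < ‖x - P‖ ^ 2 ∧ ‖x - P‖ ^ 2 < δ ^ 2 + η}, v x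
      = (Real.exp 1 / δ ^ 2) * ((δ ^ 2 * (Real.exp 1)⁻¹) *
        ∫ x in {x | δ ^ 2 < ‖x - P‖ ^ 2 ∧ ‖x - P‖ ^ 2 < δ ^ 2 + η}, v x) := by
        field_simp
    _ ≤ (Real.exp 1 / δ ^ 2) * ((t₂ * Z + √t₂) * η *
        ((∫ x in {x | t₁ ≤ ‖x - P‖ ^ 2 ∧ ‖x - P‖ ^ 2 ≤ t₂}, v x) + M)) := by gcongr
    _ = _ := by ring

/-! ### The perforated plane -/

lemma mem_compl_holes {A : Set Plane} {δ : ℝ} {x : Plane} :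
    x ∈ (holes A δ)ᶜ ↔ ∀ p ∈ A, δ < dist x p := by
  simp [holes, Metric.mem_closedBall]

lemma isClosed_holes (A : Finset Plane) (δ : ℝ) : IsClosed (holes (A : Set Plane) δ) :=
  A.finite_toSet.isClosed_biUnion fun _ _ => Metric.isClosed_closedBall

/-- Finitely many strict inequalities persist when all discs are enlarged slightly. -/
lemma exists_gap {A : Finset Plane} {δ : ℝ} (hsep : ∀ p ∈ A, ∀ q ∈ A, p ≠ q → 2 * δ < dist p q) :
    ∃ η, 0 < η ∧ ∀ p ∈ A, ∀ q ∈ A, p ≠ q → 2 * (δ + η) < dist p q := by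
  have h : ∀ᶠ η : ℝ in 𝓝 0, ∀ p ∈ A, ∀ q ∈ A, p ≠ q → 2 * (δ + η) < dist p q := by
    refine (Finset.eventually_all A).2 fun p hp => (Finset.eventually_all A).2 fun q hq => ?_
    by_cases hpq : p = q
    · exact Eventually.of_forall fun _ h => absurd hpq h
    · have h2 : Tendsto (fun η : ℝ => 2 * (δ + η)) (𝓝 0) (𝓝 (2 * (δ + 0))) := by
        exact Continuous.tendsto (by fun_prop) 0
      filter_upwards [h2.eventually (gt_mem_nhds (by
        rw [add_zero]; exact hsep p hp q hq hpq))] with η hη _ using hη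
  obtain ⟨η, h1, h2⟩ := ((h.filter_mono nhdsWithin_le_nhds).and
    (self_mem_nhdsWithin (s := Set.Ioi (0:ℝ)))).exists
  exact ⟨η, h2, h1⟩

/-- Polar coordinates present the annulus as a continuous image of a circle times an interval. -/
lemma isPreconnected_annulus (p : Plane) {a b : ℝ} (ha : 0 < a) :
    IsPreconnected {x : Plane | a < dist x p ∧ dist x p < b} := by
  have hs : IsPreconnected (Metric.sphere (0 : Plane) 1) :=
    isPreconnected_sphere (by rw [← Module.finrank_eq_rank, finrank_euclideanSpace_fin]; norm_num)
      0 1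
  have h := (hs.prod (isPreconnected_Ioo (a := a) (b := b))).image
    (fun q : Plane × ℝ => p + q.2 • q.1) (by fun_prop)
  convert h using 1
  ext x
  constructor
  · rintro ⟨h1, h2⟩
    have h0 : 0 < ‖x - p‖ := by rw [← dist_eq_norm]; linarith
    refine ⟨(‖x - p‖⁻¹ • (x - p), ‖x - p‖), ⟨?_, ?_⟩, ?_⟩
    · simp [norm_smul, h0.ne']
    · rw [← dist_eq_norm]; exact ⟨h1, h2⟩
    · simp [smul_smul, h0.ne']
  · rintro ⟨⟨u, r⟩, ⟨hu, hr⟩, rfl⟩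
    have hu' : ‖u‖ = 1 := by simpa using hu
    have hr' : a < r ∧ r < b := hr
    simp only [Set.mem_ofPred_eq, dist_self_add_left, norm_smul, hu', mul_one, Real.norm_eq_abs,
      abs_of_pos (ha.trans hr'.1)]
    exact hr'

/-- The complement of finitely many separated discs is connected. -/
lemma compl_holes_subset_of_clopen {A : Finset Plane} {δ : ℝ} (hδ : 0 < δ)
    (hsep : ∀ p ∈ A, ∀ q ∈ A, p ≠ q → 2 * δ < dist p q) {G : Set Plane} (hG : IsOpen G)
    (hGU : G ⊆ (holes (A : Set Plane) δ)ᶜ) (hB : IsOpen ((holes (A : Set Plane) δ)ᶜ \ G))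
    (hne : G.Nonempty) : (holes (A : Set Plane) δ)ᶜ ⊆ G := by
  obtain ⟨η, hη, hgap⟩ := exists_gap hsep
  set U := (holes (A : Set Plane) δ)ᶜ with hU
  set ann : Plane → Set Plane := fun p => {x | δ < dist x p ∧ dist x p < δ + η} with hann
  have hannU : ∀ p ∈ A, ann p ⊆ U := fun p hp x hx => by
    rw [hU, mem_compl_holes]
    intro q hq
    by_cases hpq : p = q
    · exact hpq ▸ hx.1
    · have h1 := hgap p hp q hq hpq
      have h2 := dist_triangle_left p q x
      have h3 := hx.2
      linarith
  have hdich : ∀ p ∈ A, ann p ⊆ G ∨ ann p ⊆ U \ G := fun p hp =>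
    IsPreconnected.subset_or_subset hG hB Set.disjoint_sdiff_right
      (fun x hx => by
        by_cases h : x ∈ G
        · exact Or.inl h
        · exact Or.inr ⟨hannU p hp hx, h⟩) (isPreconnected_annulus p hδ)
  -- Each annulus is connected, so it lies on one side of the partition. Filling every hole on the
  -- side of its annulus gives a partition of the whole plane into two open sets, one of which must
  -- be empty.
  set G' := G ∪ ⋃ p ∈ {p | p ∈ A ∧ ann p ⊆ G}, Metric.ball p (δ + η) with hG'
  set B' := (U \ G) ∪ ⋃ p ∈ {p | p ∈ A ∧ ¬ ann p ⊆ G}, Metric.ball p (δ + η) with hB'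
  have hball : ∀ p x, x ∈ U → p ∈ A → x ∈ Metric.ball p (δ + η) → x ∈ ann p :=
    fun p x hx hp hxp => ⟨mem_compl_holes.1 hx p hp, hxp⟩
  have hdisj : Disjoint G' B' := by
    rw [Set.disjoint_left]
    rintro x (hx | hx) (hy | hy)
    · exact hy.2 hx
    · simp only [Set.mem_iUnion, exists_prop, Set.mem_ofPred_eq] at hy
      obtain ⟨p, ⟨hp, hpG⟩, hxp⟩ := hy
      exact ((hdich p hp).resolve_left hpG (hball p x (hGU hx) hp hxp)).2 hx
    · simp only [Set.mem_iUnion, exists_prop, Set.mem_ofPred_eq] at hx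
      obtain ⟨p, ⟨hp, hpG⟩, hxp⟩ := hx
      exact hy.2 (hpG (hball p x hy.1 hp hxp))
    · simp only [Set.mem_iUnion, exists_prop, Set.mem_ofPred_eq] at hx hy
      obtain ⟨p, ⟨hp, hpG⟩, hxp⟩ := hx
      obtain ⟨q, ⟨hq, hqG⟩, hxq⟩ := hy
      have hpq : p ≠ q := fun h => hqG (h ▸ hpG)
      have h1 := hgap p hp q hq hpq
      have h2 := dist_triangle_left p q x
      rw [Metric.mem_ball] at hxp hxq
      linarith
  have hcov : (Set.univ : Set Plane) ⊆ G' ∪ B' := fun x _ => by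
    by_cases hxU : x ∈ U
    · by_cases hxG : x ∈ G
      · exact Or.inl (Or.inl hxG)
      · exact Or.inr (Or.inl ⟨hxU, hxG⟩)
    · rw [hU, mem_compl_holes] at hxU
      push Not at hxU
      obtain ⟨p, hp, hxp⟩ := hxU
      have hxb : x ∈ Metric.ball p (δ + η) := by rw [Metric.mem_ball]; linarith
      by_cases hpG : ann p ⊆ G
      · exact Or.inl (Or.inr (Set.mem_biUnion (show p ∈ {p | p ∈ A ∧ ann p ⊆ G} from ⟨hp, hpG⟩)
          hxb))
      · exact Or.inr (Or.inr (Set.mem_biUnion (show p ∈ {p | p ∈ A ∧ ¬ ann p ⊆ G} from ⟨hp, hpG⟩)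
          hxb))
  have hopen : IsOpen G' := hG.union (isOpen_biUnion fun _ _ => Metric.isOpen_ball)
  have hopen' : IsOpen B' := hB.union (isOpen_biUnion fun _ _ => Metric.isOpen_ball)
  rcases IsPreconnected.subset_or_subset hopen hopen' hdisj hcov isPreconnected_univ with h | h
  · intro x hx
    by_contra hxG
    exact Set.disjoint_left.1 hdisj (h trivial) (Or.inl ⟨hx, hxG⟩)
  · obtain ⟨x, hx⟩ := hne
    exact absurd (h (Set.mem_univ x)) (Set.disjoint_left.1 hdisj (Or.inl hx))

/-! ### Uniform bounds in `L¹` -/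

/-- A uniform bound on some ball propagates to all compact subsets of the perforated plane. -/
lemma exists_bound_of_isCompact {A : Finset Plane} {δ : ℝ} (hδ : 0 < δ)
    (hsep : ∀ p ∈ A, ∀ q ∈ A, p ≠ q → 2 * δ < dist p q) {v : ℕ → Plane → ℝ} {M : ℝ}
    (hv : ∀ k, Integrable (v k)) (hv0 : ∀ k x, 0 ≤ v k x)
    (hM : ∀ k, VarBound (holes (A : Set Plane) δ)ᶜ (v k) M)
    {x₀ : Plane} (hx₀ : x₀ ∈ (holes (A : Set Plane) δ)ᶜ) {r₀ C₀ : ℝ} (hr₀ : 0 < r₀)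
    (hC₀ : ∀ k, ∫ x in Metric.closedBall x₀ r₀, v k x ≤ C₀) {K : Set Plane} (hK : IsCompact K)
    (hKU : K ⊆ (holes (A : Set Plane) δ)ᶜ) : ∃ C, ∀ k, ∫ x in K, v k x ≤ C := by
  set U := (holes (A : Set Plane) δ)ᶜ with hU
  have hUo : IsOpen U := (isClosed_holes A δ).isOpen_compl
  have hmono : ∀ {s t : Set Plane} (k : ℕ), s ⊆ t → ∫ x in s, v k x ≤ ∫ x in t, v k x :=
    fun k hst => setIntegral_mono_set (hv k).integrableOn
      (Eventually.of_forall (hv0 k)) (LE.le.eventuallyLE hst)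
  -- The points that have a ball with uniformly bounded mass form a relatively clopen set: openness
  -- is immediate, and closedness is the comparison of concentric balls.
  set G := {x | x ∈ U ∧ ∃ r, 0 < r ∧ ∃ C, ∀ k, ∫ x in Metric.closedBall x r, v k x ≤ C} with hG
  have hGo : IsOpen G := by
    rw [Metric.isOpen_iff]
    rintro x ⟨hxU, r, hr, C, hC⟩
    obtain ⟨s, hs, hsU⟩ := Metric.isOpen_iff.1 hUo x hxU
    refine ⟨min s (r / 2), by positivity, fun y hy => ⟨hsU ?_, r / 2, by positivity, C, fun k => ?_⟩⟩
    · exact Metric.ball_subset_ball (min_le_left _ _) hy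
    · refine (hmono k (Metric.closedBall_subset_closedBall' ?_)).trans (hC k)
      have := (Metric.mem_ball.1 hy).trans_le (min_le_right _ _)
      linarith
  have hBo : IsOpen (U \ G) := by
    rw [Metric.isOpen_iff]
    rintro x ⟨hxU, hxG⟩
    obtain ⟨s, hs, hsU⟩ := Metric.isOpen_iff.1 hUo x hxU
    refine ⟨s / 4, by positivity, fun y hy => ⟨hsU (Metric.ball_subset_ball (by linarith) hy),
      fun hyG => hxG ⟨hxU, ?_⟩⟩⟩
    obtain ⟨-, r, hr, C, hC⟩ := hyG
    have hd := Metric.mem_ball.1 hy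
    -- As `y` is within `s / 4` of `x`, the ball of radius `5 s / 8` around `y` stays in the ball of
    -- radius `s` around `x`, and the ball of radius `s / 2` around `y` still contains the one of
    -- radius `s / 8` around `x`.
    obtain ⟨C', hC'⟩ := exists_closedBall_bound (U := U) (y := y) (r := min r (s / 8))
      (R' := s / 2) (R := s / 2 + s / 8) (by positivity)
      ((min_le_right _ _).trans_lt (by linarith)) (by linarith) (fun z hz => hsU (by
        rw [Metric.mem_ball]
        have h1 := dist_triangle z y x
        rw [Metric.mem_closedBall] at hz
        linarith))
    refine ⟨s / 8, by positivity, max C' 0 * (C + M), fun k => ?_⟩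
    have hsub : Metric.closedBall x (s / 8) ⊆ Metric.closedBall y (s / 2) :=
      Metric.closedBall_subset_closedBall' (by rw [dist_comm]; linarith)
    have hM0 := (hM k).nonneg
    have h0 : 0 ≤ ∫ x in Metric.closedBall y (min r (s / 8)), v k x := integral_nonneg (hv0 k)
    calc _ ≤ _ := hmono k hsub
      _ ≤ C' * ((∫ x in Metric.closedBall y (min r (s / 8)), v k x) + M) :=
        hC' (v k) M (hv k) (hv0 k) (hM k)
      _ ≤ max C' 0 * ((∫ x in Metric.closedBall y (min r (s / 8)), v k x) + M) := by
        gcongr; exact le_max_left _ _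
      _ ≤ max C' 0 * (C + M) := by
        gcongr
        exact (hmono k (Metric.closedBall_subset_closedBall (min_le_left _ _))).trans (hC k)
  have hUG : U ⊆ G := compl_holes_subset_of_clopen hδ hsep hGo (fun x hx => hx.1) hBo
    ⟨x₀, hx₀, r₀, hr₀, C₀, hC₀⟩
  refine hK.induction_on (p := fun s => ∃ C, ∀ k, ∫ x in s, v k x ≤ C) ⟨0, by simp⟩
    (fun s t hst ⟨C, hC⟩ => ⟨C, fun k => (hmono k hst).trans (hC k)⟩)
    (fun s t ⟨C, hC⟩ ⟨C', hC'⟩ => ⟨C + C', fun k => ?_⟩) fun x hx => ?_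
  · have h1 : ∫ x in s ∪ t, v k x ≤ (∫ x in s, v k x) + ∫ x in t, v k x := by
      rw [← integral_add_measure (hv k).integrableOn (hv k).integrableOn]
      exact integral_mono_measure (Measure.restrict_union_le _ _) (Eventually.of_forall (hv0 k))
        ((hv k).integrableOn.integrable.add_measure (hv k).integrableOn)
    linarith [hC k, hC' k]
  · obtain ⟨-, r, hr, C, hC⟩ := hUG (hKU hx)
    exact ⟨_, mem_nhdsWithin_of_mem_nhds (Metric.closedBall_mem_nhds x hr), C, hC⟩

/-- The part of the plane at a positive distance from the holes. -/
def core (A : Finset Plane) (δ η : ℝ) : Set Plane :=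
  {x | ∀ p ∈ A, δ ^ 2 + η ≤ ‖x - p‖ ^ 2}

lemma isClosed_core (A : Finset Plane) (δ η : ℝ) : IsClosed (core A δ η) := by
  have : core A δ η = ⋂ p ∈ A, {x | δ ^ 2 + η ≤ ‖x - p‖ ^ 2} := by ext; simp [core]
  rw [this]
  exact isClosed_biInter fun p _ => isClosed_le continuous_const (by fun_prop)

lemma core_subset {A : Finset Plane} {δ η : ℝ} (hη : 0 < η) :
    core A δ η ⊆ (holes (A : Set Plane) δ)ᶜ := fun x hx => by
  rw [mem_compl_holes]
  intro p hp
  have h1 := hx p hp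
  rw [dist_eq_norm]
  exact lt_of_pow_lt_pow_left₀ 2 (norm_nonneg _) (by linarith)

/-- Uniform smallness of the mass near the holes. -/
lemma exists_core_bound {A : Finset Plane} {δ : ℝ} (hδ : 0 < δ)
    (hsep : ∀ p ∈ A, ∀ q ∈ A, p ≠ q → 2 * δ < dist p q) {v : ℕ → Plane → ℝ} {M : ℝ}
    (hv : ∀ k, Integrable (v k)) (hv0 : ∀ k x, 0 ≤ v k x)
    (hM : ∀ k, VarBound (holes (A : Set Plane) δ)ᶜ (v k) M)
    (hvh : ∀ k, ∀ x ∈ holes (A : Set Plane) δ, v k x = 0)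
    (hloc : ∀ K, IsCompact K → K ⊆ (holes (A : Set Plane) δ)ᶜ → ∃ C, ∀ k, ∫ x in K, v k x ≤ C)
    {ε : ℝ} (hε : 0 < ε) :
    ∃ η, 0 < η ∧ ∀ k, ∫ x in (core A δ η)ᶜ, v k x ≤ ε := by
  obtain ⟨g, hg, hgap⟩ := exists_gap hsep
  set t₁ := (δ + g / 2) ^ 2 with ht₁
  set t₂ := (δ + g) ^ 2 with ht₂
  have h₁ : δ ^ 2 < t₁ := by rw [ht₁]; nlinarith
  have h₂ : t₁ < t₂ := by rw [ht₁, ht₂]; nlinarith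
  have hring : ∀ p ∈ A, {x | δ ^ 2 < ‖x - p‖ ^ 2 ∧ ‖x - p‖ ^ 2 ≤ t₂} ⊆
      (holes (A : Set Plane) δ)ᶜ := fun p hp x hx => by
    rw [mem_compl_holes]
    intro q hq
    have hd1 : δ < dist x p := by
      rw [dist_eq_norm]; exact lt_of_pow_lt_pow_left₀ 2 (norm_nonneg _) hx.1
    have hd2 : dist x p ≤ δ + g := by
      rw [dist_eq_norm]; exact le_of_sq_le_sq hx.2 (by positivity)
    by_cases hpq : p = q
    · exact hpq ▸ hd1
    · have h1 := hgap p hp q hq hpq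
      have h2 := dist_triangle_left p q x
      linarith
  have hcn : ∀ p : Plane, Continuous fun x : Plane => ‖x - p‖ ^ 2 := fun p => by fun_prop
  -- uniform bounds near each hole
  have hp : ∀ p ∈ A, ∃ C, 0 ≤ C ∧ ∀ η, 0 < η → δ ^ 2 + η ≤ t₁ → ∀ k,
      ∫ x in {x | δ ^ 2 < ‖x - p‖ ^ 2 ∧ ‖x - p‖ ^ 2 < δ ^ 2 + η}, v k x ≤ C * η := by
    intro p hp
    obtain ⟨C, hC0, hC⟩ := exists_annulus_bound (U := (holes (A : Set Plane) δ)ᶜ) (P := p) hδ h₁ h₂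
      (hring p hp)
    have hKc : IsCompact {x : Plane | t₁ ≤ ‖x - p‖ ^ 2 ∧ ‖x - p‖ ^ 2 ≤ t₂} := by
      refine (isCompact_closedBall p (√t₂)).of_isClosed_subset
          ((isClosed_le continuous_const (hcn p)).inter (isClosed_le (hcn p) continuous_const))
          fun x hx => ?_
      rw [Metric.mem_closedBall, dist_eq_norm]
      exact Real.le_sqrt_of_sq_le hx.2
    obtain ⟨C', hC'⟩ := hloc _ hKc (fun x hx => hring p hp ⟨h₁.trans_le hx.1, hx.2⟩)
    refine ⟨C * max (C' + M) 0, by positivity, fun η hη hη1 k => ?_⟩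
    refine (hC η hη hη1 (v k) M (hv k) (hv0 k) (hM k)).trans ?_
    calc _ ≤ C * η * (C' + M) := by gcongr; exact hC' k
      _ ≤ C * η * max (C' + M) 0 := by gcongr; exact le_max_left _ _
      _ = _ := by ring
  choose! C hC0 hC using hp
  set S := ∑ p ∈ A, C p with hS
  have hS0 : 0 ≤ S := Finset.sum_nonneg hC0
  refine ⟨min (t₁ - δ ^ 2) (ε / (S + 1)), lt_min (by linarith) (by positivity), fun k => ?_⟩
  set η := min (t₁ - δ ^ 2) (ε / (S + 1)) with hη
  have hη0 : 0 < η := lt_min (by linarith) (by positivity)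
  have hηt : δ ^ 2 + η ≤ t₁ := by linarith [min_le_left (t₁ - δ ^ 2) (ε / (S + 1))]
  have hm : ∀ p, MeasurableSet {x : Plane | δ ^ 2 < ‖x - p‖ ^ 2 ∧ ‖x - p‖ ^ 2 < δ ^ 2 + η} := fun p =>
    ((isOpen_lt continuous_const (hcn p)).inter (isOpen_lt (hcn p) continuous_const)).measurableSet
  calc ∫ x in (core A δ η)ᶜ, v k x
      = ∫ x, (core A δ η)ᶜ.indicator (v k) x :=
        (integral_indicator (isClosed_core A δ η).measurableSet.compl).symm
    -- Outside the core a point lies either in a hole, where `v k` vanishes, or in one of the thin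
    -- annuli.
    _ ≤ ∫ x, ∑ p ∈ A,
          {x | δ ^ 2 < ‖x - p‖ ^ 2 ∧ ‖x - p‖ ^ 2 < δ ^ 2 + η}.indicator (v k) x := by
        refine integral_mono ((hv k).indicator (isClosed_core A δ η).measurableSet.compl)
          (integrable_finsetSum _ fun p _ => (hv k).indicator (hm p)) fun x => ?_
        have hnn : ∀ p ∈ A, 0 ≤
            {x | δ ^ 2 < ‖x - p‖ ^ 2 ∧ ‖x - p‖ ^ 2 < δ ^ 2 + η}.indicator (v k) x :=
          fun p _ => Set.indicator_nonneg (fun y _ => hv0 k y) x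
        by_cases hx : x ∈ (core A δ η)ᶜ ∧ x ∉ holes (A : Set Plane) δ
        · have hx1 : ¬ ∀ p ∈ A, δ ^ 2 + η ≤ ‖x - p‖ ^ 2 := hx.1
          push Not at hx1
          obtain ⟨p, hp, hxp⟩ := hx1
          have h2 := mem_compl_holes.1 hx.2 p hp
          refine le_trans (le_of_eq ?_) (Finset.single_le_sum hnn hp)
          rw [Set.indicator_of_mem hx.1, Set.indicator_of_mem]
          refine ⟨?_, hxp⟩
          rw [← dist_eq_norm]; gcongr
        · refine le_trans (le_of_eq ?_) (Finset.sum_nonneg hnn)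
          by_cases h1 : x ∈ (core A δ η)ᶜ
          · rw [Set.indicator_of_mem h1]
            refine hvh k x ?_
            by_contra h2; exact hx ⟨h1, h2⟩
          · rw [Set.indicator_of_notMem h1]
    _ = ∑ p ∈ A, ∫ x in {x | δ ^ 2 < ‖x - p‖ ^ 2 ∧ ‖x - p‖ ^ 2 < δ ^ 2 + η}, v k x := by
        rw [integral_finsetSum _ fun p _ => (hv k).indicator (hm p)]
        exact Finset.sum_congr rfl fun p _ => integral_indicator (hm p)
    _ ≤ ∑ p ∈ A, C p * η := Finset.sum_le_sum fun p hp => hC p hp η hη0 hηt k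
    _ = S * η := by rw [hS, Finset.sum_mul]
    _ ≤ S * (ε / (S + 1)) := by gcongr; exact min_le_right _ _
    _ ≤ ε := by
        rw [mul_div_assoc', div_le_iff₀ (by positivity)]; nlinarith

/-! ### Mollification and total variation -/

lemma IsTest.comp_sub {O U : Set Plane} {g : Plane → ℝ} (hg : IsTest O g) (z : Plane)
    (hO : ∀ x ∈ O, x + z ∈ U) : IsTest U fun x => g (x - z) := by
  have hc : Continuous fun x : Plane => x - z := continuous_id.sub continuous_const
  have hs : tsupport (fun x => g (x - z)) ⊆ (fun x => x - z) ⁻¹' tsupport g :=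
    closure_minimal (fun x hx => subset_tsupport g hx) ((isClosed_tsupport g).preimage hc)
  refine ⟨hg.smooth.comp (contDiff_id.sub contDiff_const), ?_, fun x hx => ?_⟩
  · exact hg.compact.comp_homeomorph (Homeomorph.subRight z)
  · simpa using hO _ (hg.support (hs hx))

lemma pderiv_comp_sub (j : Fin 2) (g : Plane → ℝ) (z x : Plane) :
    pderiv j (fun x => g (x - z)) x = pderiv j g (x - z) := by
  simp only [pderiv, fderiv_comp_sub]

lemma fderiv_eq_pderiv (g : Plane → ℝ) (x z : Plane) :
    fderiv ℝ g x z = z 0 * pderiv 0 g x + z 1 * pderiv 1 g x := by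
  have hz : z = z 0 • EuclideanSpace.single 0 (1:ℝ) + z 1 • EuclideanSpace.single 1 (1:ℝ) := by
    ext i; fin_cases i <;> simp
  conv_lhs => rw [hz, map_add, map_smul, map_smul]
  rfl

/-- Translates of a test function differ, in the dual sense, by the total variation. -/
lemma VarBound.abs_integral_translate_le {U O : Set Plane} {v : Plane → ℝ} (hv : Integrable v)
    {M : ℝ} (h : VarBound U v M) {z : Plane}
    (hz : ∀ t ∈ Set.Icc (0:ℝ) 1, ∀ x ∈ O, x + t • z ∈ U) {g : Plane → ℝ} (hg : IsTest O g)
    (hg1 : ∀ x, |g x| ≤ 1) : |∫ x, v x * (g (x - z) - g x)| ≤ 2 * M * ‖z‖ := by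
  obtain ⟨C₀, -, hC₀⟩ := exists_bound (hg.continuous_pderiv 0) (hg.hasCompactSupport_pderiv 0)
  obtain ⟨C₁, -, hC₁⟩ := exists_bound (hg.continuous_pderiv 1) (hg.hasCompactSupport_pderiv 1)
  -- The mean value inequality along the translation. The slope of `F` is a derivative of `v` tested
  -- with a translate of `g`, at most `M` for each of the two coordinates; hence the factor `2`.
  set F : ℝ → ℝ := fun t => ∫ x, v x * g (x - t • z) with hF
  have hcoord : ∀ j : Fin 2, |z j| ≤ ‖z‖ := fun j => PiLp.norm_apply_le z j
  have hint : ∀ t : ℝ, Integrable fun x => v x * g (x - t • z) := fun t =>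
    integrable_mul_bdd hv (hg.smooth.continuous.comp (continuous_id.sub continuous_const))
      fun x => hg1 _
  have hintd : ∀ (t : ℝ) (j : Fin 2), Integrable fun x => v x * pderiv j g (x - t • z) := by
    intro t j
    obtain ⟨C, -, hC⟩ := exists_bound (hg.continuous_pderiv j) (hg.hasCompactSupport_pderiv j)
    exact integrable_mul_bdd hv ((hg.continuous_pderiv j).comp
      (continuous_id.sub continuous_const)) fun x => hC _
  have hder : ∀ t : ℝ, HasDerivAt F (∫ x, v x * -(z 0 * pderiv 0 g (x - t • z)
      + z 1 * pderiv 1 g (x - t • z))) t := by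
    intro t
    refine (hasDerivAt_integral_of_dominated_loc_of_deriv_le (s := Set.univ)
      (F' := fun t x => v x * -(z 0 * pderiv 0 g (x - t • z) + z 1 * pderiv 1 g (x - t • z)))
      (bound := fun x => |v x| * (‖z‖ * C₀ + ‖z‖ * C₁)) univ_mem
      (Eventually.of_forall fun t => (hint t).1) (hint t) ?_ ?_ (hv.abs.mul_const _) ?_).2
    · refine hv.1.mul (Continuous.aestronglyMeasurable ?_)
      have h0 := (hg.continuous_pderiv 0).comp (continuous_id.sub (continuous_const (y := t • z)))
      have h1 := (hg.continuous_pderiv 1).comp (continuous_id.sub (continuous_const (y := t • z)))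
      exact ((continuous_const.mul h0).add (continuous_const.mul h1)).neg
    · refine Eventually.of_forall fun x t _ => ?_
      rw [norm_mul, norm_neg, Real.norm_eq_abs, Real.norm_eq_abs]
      gcongr
      refine (abs_add_le _ _).trans ?_
      rw [abs_mul, abs_mul]
      gcongr
      · exact hcoord 0
      · exact hC₀ _
      · exact hcoord 1
      · exact hC₁ _
    · refine Eventually.of_forall fun x t _ => ?_
      have h1 : HasDerivAt (fun t : ℝ => x - t • z) (-((1:ℝ) • z)) t :=
        ((hasDerivAt_id t).smul_const z).const_sub x
      have h2 := (hg.differentiable (x - t • z)).hasFDerivAt.comp_hasDerivAt t h1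
      have h3 := h2.const_mul (v x)
      rw [map_neg, one_smul, fderiv_eq_pderiv] at h3
      exact h3
  have hbound : ∀ t ∈ Set.Icc (0:ℝ) 1, ‖∫ x, v x * -(z 0 * pderiv 0 g (x - t • z)
      + z 1 * pderiv 1 g (x - t • z))‖ ≤ 2 * M * ‖z‖ := by
    intro t ht
    have htest := hg.comp_sub (t • z) (hz t ht)
    have hj : ∀ j, |∫ x, v x * pderiv j g (x - t • z)| ≤ M := fun j => by
      have := h _ htest (fun x => hg1 _) j
      simpa only [pderiv_comp_sub] using this
    have e : ∫ x, v x * -(z 0 * pderiv 0 g (x - t • z) + z 1 * pderiv 1 g (x - t • z))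
        = -(z 0 * (∫ x, v x * pderiv 0 g (x - t • z)) + z 1 * ∫ x, v x * pderiv 1 g (x - t • z)) := by
      rw [← integral_const_mul, ← integral_const_mul, ← integral_add ((hintd t 0).const_mul _)
        ((hintd t 1).const_mul _), ← integral_neg]
      refine integral_congr_ae (Eventually.of_forall fun x => ?_)
      simp only; ring
    rw [e, norm_neg, Real.norm_eq_abs]
    refine (abs_add_le _ _).trans ?_
    rw [abs_mul, abs_mul]
    calc _ ≤ ‖z‖ * M + ‖z‖ * M := by
          gcongr
          · exact hcoord 0
          · exact hj 0
          · exact hcoord 1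
          · exact hj 1
      _ = 2 * M * ‖z‖ := by ring
  have hmv := (convex_Icc (0:ℝ) 1).norm_image_sub_le_of_norm_hasDerivWithin_le
    (fun t _ => (hder t).hasDerivWithinAt) hbound (Set.left_mem_Icc.2 zero_le_one)
    (Set.right_mem_Icc.2 zero_le_one)
  have e : F 1 - F 0 = ∫ x, v x * (g (x - z) - g x) := by
    have h1 := hint 1
    have h0 := hint 0
    simp only [hF, one_smul, zero_smul, sub_zero] at h1 h0 ⊢
    rw [← integral_sub h1 h0]
    refine integral_congr_ae (Eventually.of_forall fun x => ?_)
    simp only; ring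
  rw [e, Real.norm_eq_abs] at hmv
  simpa using hmv

/-- The rate of convergence of mollifications in `L¹`. -/
lemma VarBound.lintegral_moll_sub_le {U O : Set Plane} (hO : IsOpen O) {v : Plane → ℝ}
    (hv : Integrable v) {M : ℝ} (h : VarBound U v M) {n : ℕ}
    (hOU : ∀ x ∈ O, ∀ z, ‖z‖ ≤ rad n → x + z ∈ U) :
    ∫⁻ x in O, ‖moll n v x - v x‖ₑ ≤ ENNReal.ofReal (2 * M * rad n) := by
  have hM0 := h.nonneg
  refine lintegral_enorm_le_of_isTest hO ((integrable_moll n hv).sub hv) fun g hg hg1 => ?_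
  have hgi : Integrable g := hg.smooth.continuous.integrable_of_hasCompactSupport hg.compact
  have hgm : ∀ x, moll n g x - g x = ∫ z, (g (x - z) - g x) * ker n z := fun x => by
    rw [moll_sub_const n hgi, ← integral_sub_left_eq_self _ volume x]
    simp
  -- The mollifier is moved to `g`, so that the error becomes a weighted mean of translation errors
  -- with `‖z‖ < rad n`.
  have e : ∫ x, (moll n v x - v x) * g x = ∫ z, (∫ x, v x * (g (x - z) - g x)) * ker n z := by
    have h1 : ∫ x, (moll n v x - v x) * g x = ∫ x, v x * (moll n g x - g x) := by
      have c1 : Integrable fun x => g x * moll n v x :=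
        (integrable_mul_bdd (integrable_moll n hv) hg.smooth.continuous hg1).congr
          (Eventually.of_forall fun x => mul_comm _ _)
      have c2 : Integrable fun x => v x * g x := integrable_mul_bdd hv hg.smooth.continuous hg1
      have c3 : Integrable fun x => v x * moll n g x :=
        integrable_mul_bdd hv (continuous_moll n hgi.locallyIntegrable) fun x => abs_moll_le n hg1 x
      have e1 := integral_sub c1 c2
      have e2 := integral_sub c3 c2
      rw [integral_mul_moll_comm n hv hgi] at e1
      rw [← e1] at e2
      simp_rw [mul_sub, e2, sub_mul]
      refine integral_congr_ae (Eventually.of_forall fun x => ?_)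
      simp only; ring
    rw [h1]
    simp_rw [hgm, ← integral_const_mul, ← integral_mul_const]
    rw [integral_integral_swap]
    · simp_rw [mul_assoc]
    · have c1 := (hv.mul_prod (integrable_ker n)).mul_bdd (c := 2)
        (g := fun p : Plane × Plane => g (p.1 - p.2) - g p.1)
        ((hg.smooth.continuous.comp (continuous_fst.sub continuous_snd)).sub
          (hg.smooth.continuous.comp continuous_fst)).aestronglyMeasurable
        (Eventually.of_forall fun p => by
          have h1 := abs_sub (g (p.1 - p.2)) (g p.1)
          rw [Real.norm_eq_abs]
          linarith [hg1 (p.1 - p.2), hg1 p.1])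
      refine c1.congr (Eventually.of_forall fun p => ?_)
      simp only [Function.uncurry]; ring
  rw [show ∫ x, (moll n v - v) x * g x = ∫ x, (moll n v x - v x) * g x from rfl, e]
  refine (le_abs_self _).trans ?_
  rw [← Real.norm_eq_abs]
  calc _ ≤ ∫ z, (2 * M * rad n) * ker n z := by
        refine norm_integral_le_of_norm_le ((integrable_ker n).const_mul _)
          (Eventually.of_forall fun z => ?_)
        rw [norm_mul, Real.norm_eq_abs, Real.norm_eq_abs, abs_of_nonneg (ker_nonneg n z)]
        by_cases hz : rad n ≤ ‖z‖
        · rw [ker_eq_zero hz]; simp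
        · refine mul_le_mul_of_nonneg_right ?_ (ker_nonneg n z)
          refine (h.abs_integral_translate_le hv (O := O) (fun t ht x hx => hOU x hx _ ?_)
            hg hg1).trans (by gcongr; exact (not_le.1 hz).le)
          rw [norm_smul, Real.norm_eq_abs, abs_of_nonneg ht.1]
          nlinarith [norm_nonneg z, ht.2, not_le.1 hz]
    _ = _ := by rw [integral_const_mul, integral_ker, mul_one]

/-! ### Compactness -/

/-- Mollifications of a bounded sequence in `L¹` are uniformly close to finitely many of them. -/
lemma exists_finite_net_moll (n : ℕ) {v : ℕ → Plane → ℝ} (hv : ∀ k, Integrable (v k)) {C : ℝ}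
    (hC : ∀ k, ∫ x, |v k x| ≤ C) {ε : ℝ} (hε : 0 < ε) (R : ℝ) :
    ∃ I : Finset ℕ, ∀ k, ∃ l ∈ I, ∀ x ∈ Metric.closedBall (0 : Plane) R,
      |moll n (v k) x - moll n (v l) x| < ε := by
  set B := Metric.closedBall (0 : Plane) R
  have : CompactSpace B := isCompact_iff_compactSpace.1 (isCompact_closedBall _ _)
  have hcont : ∀ k, Continuous (moll n (v k)) := fun k => continuous_moll n (hv k).locallyIntegrable
  set G : ℕ → BoundedContinuousFunction B ℝ := fun k =>
    BoundedContinuousFunction.mkOfCompact ⟨fun x => moll n (v k) x, (hcont k).comp continuous_subtype_val⟩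
    with hG
  obtain ⟨L, hL0, hL⟩ := exists_bound (continuous_ker n) (hasCompactSupport_ker n)
  have hsup : ∀ k x, |moll n (v k) x| ≤ C * L := fun k x => by
    rw [moll, ← Real.norm_eq_abs]
    calc _ ≤ ∫ y, |v k y| * L := by
          refine norm_integral_le_of_norm_le ((hv k).abs.mul_const _)
            (Eventually.of_forall fun y => ?_)
          rw [norm_mul, Real.norm_eq_abs, Real.norm_eq_abs]
          gcongr; exact hL _
      _ ≤ C * L := by rw [integral_mul_const]; gcongr; exact hC k
  have hC0 : 0 ≤ C := (integral_nonneg fun x => abs_nonneg _).trans (hC 0)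
  have huc : UniformContinuous (ker n) :=
    (hasCompactSupport_ker n).uniformContinuous_of_continuous (continuous_ker n)
  -- For fixed `n`, the modulus of continuity of `moll n (v k)` is that of the kernel times the
  -- uniform `L¹` bound, so it is the same for all `k`.
  have heq : ∀ e, 0 < e → ∃ d, 0 < d ∧ ∀ k x y, dist x y < d →
      |moll n (v k) x - moll n (v k) y| < e := by
    intro e he
    obtain ⟨d, hd, hdk⟩ := Metric.uniformContinuous_iff.1 huc (e / (C + 1)) (by positivity)
    refine ⟨d, hd, fun k x y hxy => ?_⟩
    rw [moll, moll, ← integral_sub (integrable_mul_ker (hv k) n x) (integrable_mul_ker (hv k) n y),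
      ← Real.norm_eq_abs]
    calc _ ≤ ∫ w, |v k w| * (e / (C + 1)) := by
          refine norm_integral_le_of_norm_le ((hv k).abs.mul_const _)
            (Eventually.of_forall fun w => ?_)
          rw [← mul_sub, norm_mul, Real.norm_eq_abs]
          gcongr
          have := hdk (a := x - w) (b := y - w) (by simpa using hxy)
          rw [dist_eq_norm] at this
          exact this.le
      _ ≤ C * (e / (C + 1)) := by rw [integral_mul_const]; gcongr; exact hC k
      _ < e := by rw [mul_div_assoc', div_lt_iff₀ (by positivity)]; nlinarith
  have hcomp : IsCompact (closure (Set.range G)) := by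
    refine BoundedContinuousFunction.arzela_ascoli (Metric.closedBall (0:ℝ) (C * L))
      (isCompact_closedBall _ _) _ ?_ ?_
    · rintro _ x ⟨k, rfl⟩
      rw [mem_closedBall_zero_iff]
      exact hsup k x
    · intro x₀
      rw [Metric.equicontinuousAt_iff]
      intro e he
      obtain ⟨d, hd, hdk⟩ := heq e he
      refine ⟨d, hd, fun x hx ⟨f, hf⟩ => ?_⟩
      obtain ⟨k, rfl⟩ := hf
      rw [Real.dist_eq]
      refine hdk k _ _ ?_
      rw [dist_comm]; exact hx
  obtain ⟨T, hTsub, hTfin, hT⟩ := Metric.finite_approx_of_totallyBounded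
    (hcomp.totallyBounded.subset subset_closure) ε hε
  have hTsub' : ∀ f ∈ T, ∃ k, G k = f := fun f hf => hTsub hf
  choose! idx hidx using hTsub'
  refine ⟨(hTfin.image idx).toFinset, fun k => ?_⟩
  obtain ⟨f, hf, hkf⟩ := Set.mem_iUnion₂.1 (hT ⟨k, rfl⟩)
  refine ⟨idx f, by simpa using ⟨f, hf, rfl⟩, fun x hx => ?_⟩
  rw [Metric.mem_ball, ← hidx f hf] at hkf
  exact (BoundedContinuousFunction.dist_coe_le_dist (f := G k) (g := G (idx f)) ⟨x, hx⟩).trans_lt hkf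

lemma norm_toL1_eq_integral {f : Plane → ℝ} (hf : Integrable f) :
    ‖hf.toL1 f‖ = ∫ x, |f x| := by
  rw [L1.norm_eq_integral_norm]
  refine integral_congr_ae ?_
  filter_upwards [hf.coeFn_toL1] with x hx
  rw [hx, Real.norm_eq_abs]

/-- A bounded sequence of functions with uniformly bounded total variation in the perforated plane,
which vanish outside the perforated disc, is precompact in `L¹`. -/
theorem exists_subseq_tendsto_of_varBound {A : Finset Plane} {δ : ℝ} (hδ : 0 < δ) (hδ1 : δ < 1)
    (hA : ∀ p ∈ A, ‖p‖ ≤ 1)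
    (hsep : ∀ p ∈ A, ∀ q ∈ A, p ≠ q → 2 * δ < dist p q) {v : ℕ → Plane → ℝ} {M : ℝ}
    (hv : ∀ k, Integrable (v k)) (hM : ∀ k, VarBound (holes (A : Set Plane) δ)ᶜ (v k) M)
    (hz : ∀ k, ∀ x ∉ OmDelta (A : Set Plane) δ, v k x = 0) :
    ∃ v₀ : Plane → ℝ, Integrable v₀ ∧ ∃ ρ : ℕ → ℕ, StrictMono ρ ∧
      Tendsto (fun k => ∫ x, |v (ρ k) x - v₀ x|) atTop (𝓝 0) := by
  set U := (holes (A : Set Plane) δ)ᶜ with hU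
  have hUo : IsOpen U := (isClosed_holes A δ).isOpen_compl
  have hMa : ∀ k, VarBound U (fun x => |v k x|) M := fun k => (hM k).abs hUo (hv k)
  have hvh : ∀ k, ∀ x ∈ holes (A : Set Plane) δ, |v k x| = 0 := fun k x hx => by
    rw [hz k x fun h => h.2 hx, abs_zero]
  have hfar : ∀ x : Plane, 10 ≤ ‖x‖ → ∀ k, v k x = 0 := fun x hx k =>
    hz k x fun h => by
      have := mem_ball_zero_iff.1 h.1
      linarith
  -- A starting point for the propagation of bounds: the unit ball around it lies outside `Ω` and
  -- the holes, so all `v k` vanish there and `C₀ = 0` works.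
  set x₀ : Plane := EuclideanSpace.single 0 20 with hx₀
  have hx₀n : ‖x₀‖ = 20 := by simp [hx₀]
  have hloc : ∀ K, IsCompact K → K ⊆ U → ∃ C, ∀ k, ∫ x in K, |v k x| ≤ C := fun K hK hKU =>
    exists_bound_of_isCompact hδ hsep (fun k => (hv k).abs) (fun k x => abs_nonneg _) hMa
      (x₀ := x₀) (mem_compl_holes.2 fun p hp => by
        have h1 := norm_sub_norm_le x₀ p
        have h2 := hA p hp
        rw [dist_eq_norm]; linarith) one_pos (C₀ := 0) (fun k => by
        refine le_of_eq (setIntegral_eq_zero_of_forall_eq_zero fun x hx => ?_)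
        rw [hfar x _ k, abs_zero]
        have h1 := norm_sub_norm_le x₀ x
        rw [Metric.mem_closedBall, dist_comm, dist_eq_norm] at hx
        linarith) hK hKU
  have hcore := fun {ε : ℝ} (hε : 0 < ε) => exists_core_bound hδ hsep (fun k => (hv k).abs)
    (fun k x => abs_nonneg _) hMa hvh hloc hε
  -- a uniform `L¹` bound
  obtain ⟨C, hC⟩ : ∃ C, ∀ k, ∫ x, |v k x| ≤ C := by
    obtain ⟨η, hη, hb⟩ := hcore one_pos
    obtain ⟨C, hC⟩ := hloc (core A δ η ∩ Metric.closedBall 0 10)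
      ((isCompact_closedBall _ _).inter_left (isClosed_core A δ η))
      (Set.inter_subset_left.trans (core_subset hη))
    refine ⟨C + 1, fun k => ?_⟩
    rw [← integral_add_compl (isClosed_core A δ η).measurableSet (hv k).abs]
    refine add_le_add (le_trans (le_of_eq ?_) (hC k)) (hb k)
    refine setIntegral_eq_of_subset_of_forall_sdiff_eq_zero (isClosed_core A δ η).measurableSet
      Set.inter_subset_left fun x hx => ?_
    rw [hfar x _ k, abs_zero]
    by_contra hlt
    exact hx.2 ⟨hx.1, by rw [mem_closedBall_zero_iff]; linarith⟩
  have hC0 : 0 ≤ C := (integral_nonneg fun x => abs_nonneg _).trans (hC 0)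
  -- finite nets
  have hnet : ∀ ε : ℝ, 0 < ε → ∃ I : Finset ℕ, ∀ k, ∃ l ∈ I, ∫ x, |v k x - v l x| < ε := by
    intro ε hε
    obtain ⟨η, hη, hb⟩ := hcore (show 0 < ε / 8 by positivity)
    -- An open set of finite area containing the part of the core inside `Ω`, still at positive
    -- distance from the holes; the number `r` below is a margin for that distance.
    set O : Set Plane := {x | ∀ p ∈ A, δ ^ 2 + η / 2 < ‖x - p‖ ^ 2} ∩ Metric.ball 0 11 with hO
    have hOo : IsOpen O := by
      have : {x : Plane | ∀ p ∈ A, δ ^ 2 + η / 2 < ‖x - p‖ ^ 2}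
          = ⋂ p ∈ A, {x | δ ^ 2 + η / 2 < ‖x - p‖ ^ 2} := by ext; simp
      rw [hO, this]
      exact (isOpen_biInter_finset fun p _ => isOpen_lt continuous_const (by fun_prop)).inter
        Metric.isOpen_ball
    set r := √(δ ^ 2 + η / 2) - δ with hr
    have hr0 : 0 < r := by
      rw [hr, sub_pos]; exact Real.lt_sqrt_of_sq_lt (by linarith)
    have hM0 := (hM 0).nonneg
    obtain ⟨n, hn1, hn2⟩ := ((tendsto_rad.eventually (gt_mem_nhds hr0)).and
      (tendsto_rad.eventually (gt_mem_nhds (show 0 < ε / 8 / (2 * M + 1) by positivity)))).exists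
    have hOU : ∀ x ∈ O, ∀ z, ‖z‖ ≤ rad n → x + z ∈ U := fun x hx z hz => by
      rw [hU, mem_compl_holes]
      intro p hp
      have h1 : √(δ ^ 2 + η / 2) < ‖x - p‖ := by
        rw [← Real.sqrt_sq (norm_nonneg (x - p))]
        exact Real.sqrt_lt_sqrt (by positivity) (hx.1 p hp)
      have h2 : ‖x - p‖ ≤ ‖x + z - p‖ + ‖z‖ := by
        calc ‖x - p‖ = ‖(x + z - p) - z‖ := by congr 1; abel
          _ ≤ _ := norm_sub_le _ _
      rw [dist_eq_norm]; linarith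
    have hmoll : ∀ k, ∫ x in O, |moll n (v k) x - v k x| ≤ ε / 8 := fun k => by
      have h1 := (hM k).lintegral_moll_sub_le hOo (hv k) hOU
      have hi : Integrable fun x => moll n (v k) x - v k x := (integrable_moll n (hv k)).sub (hv k)
      rw [show (fun x => |moll n (v k) x - v k x|) = fun x => ‖moll n (v k) x - v k x‖ from rfl,
        integral_norm_eq_lintegral_enorm hi.1.restrict]
      refine ENNReal.toReal_le_of_le_ofReal (by positivity) (h1.trans (ENNReal.ofReal_le_ofReal ?_))
      have h2 := (lt_div_iff₀ (by positivity)).1 hn2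
      nlinarith [rad_pos n]
    set V := volume.real O with hV
    have hOfin : volume O ≠ ⊤ :=
      ((measure_mono Set.inter_subset_right).trans_lt measure_ball_lt_top).ne
    obtain ⟨I, hI⟩ := exists_finite_net_moll n hv hC (show 0 < ε / 8 / (V + 1) by positivity) 11
    refine ⟨I, fun k => ?_⟩
    obtain ⟨l, hl, hkl⟩ := hI k
    refine ⟨l, hl, ?_⟩
    have hcm := (isClosed_core A δ η).measurableSet.compl
    have i1 : ∀ k, Integrable (O.indicator fun x => |moll n (v k) x - v k x|) := fun k =>
      (((integrable_moll n (hv k)).sub (hv k)).abs).indicator hOo.measurableSet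
    have i2 : ∀ k, Integrable ((core A δ η)ᶜ.indicator fun x => |v k x|) := fun k =>
      (hv k).abs.indicator hcm
    have i3 : Integrable (O.indicator fun _ => ε / 8 / (V + 1)) :=
      (integrable_indicator_iff hOo.measurableSet).2 (integrableOn_const hOfin)
    -- Five errors of size at most `ε / 8`: two from mollification on `O`, two from the masses near
    -- the holes, and one from the net of mollified functions.
    have hle : ∫ x, |v k x - v l x| ≤ ∫ x, ((O.indicator (fun x => |moll n (v k) x - v k x|) x
        + O.indicator (fun x => |moll n (v l) x - v l x|) x)
        + ((core A δ η)ᶜ.indicator (fun x => |v k x|) x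
        + (core A δ η)ᶜ.indicator (fun x => |v l x|) x)
        + O.indicator (fun _ => ε / 8 / (V + 1)) x) := by
      refine integral_mono ((hv k).sub (hv l)).abs
        ((((i1 k).add (i1 l)).add ((i2 k).add (i2 l))).add i3) fun x => ?_
      have n1 : ∀ k, 0 ≤ O.indicator (fun x => |moll n (v k) x - v k x|) x := fun k =>
        Set.indicator_nonneg (fun _ _ => abs_nonneg _) _
      have n2 : ∀ k, 0 ≤ (core A δ η)ᶜ.indicator (fun x => |v k x|) x := fun k =>
        Set.indicator_nonneg (fun _ _ => abs_nonneg _) _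
      have n3 : 0 ≤ O.indicator (fun _ => ε / 8 / (V + 1)) x :=
        Set.indicator_nonneg (fun _ _ => by positivity) _
      have n1k := n1 k
      have n1l := n1 l
      have n2k := n2 k
      have n2l := n2 l
      by_cases hx : 10 ≤ ‖x‖
      · have e0 : |v k x - v l x| = 0 := by rw [hfar x hx, hfar x hx]; simp
        linarith
      · by_cases hxc : x ∈ core A δ η
        · have hxO : x ∈ O := by
            refine ⟨fun p hp => by linarith [hxc p hp], ?_⟩
            rw [mem_ball_zero_iff]; linarith
          have h3 := hkl x (by rw [mem_closedBall_zero_iff]; linarith)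
          simp only [Set.indicator_of_mem hxO]
          have t1 := abs_sub_comm (moll n (v k) x) (v k x)
          have t2 := abs_sub_le (v k x) (moll n (v k) x) (v l x)
          have t3 := abs_sub_le (moll n (v k) x) (moll n (v l) x) (v l x)
          linarith
        · have hxc' : x ∈ (core A δ η)ᶜ := hxc
          rw [Set.indicator_of_mem hxc', Set.indicator_of_mem hxc']
          have := abs_sub (v k x) (v l x)
          linarith
    refine hle.trans_lt ?_
    have a1 := integral_add (((i1 k).add (i1 l)).add ((i2 k).add (i2 l))) i3
    have a2 := integral_add ((i1 k).add (i1 l)) ((i2 k).add (i2 l))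
    have a3 := integral_add (i1 k) (i1 l)
    have a4 := integral_add (i2 k) (i2 l)
    simp only [Pi.add_apply] at a1 a2 a3 a4
    rw [a1, a2, a3, a4]
    simp only [integral_indicator hOo.measurableSet, integral_indicator hcm]
    have hlast : ∫ x in O, ε / 8 / (V + 1) ≤ ε / 8 := by
      rw [setIntegral_const, smul_eq_mul, ← hV, mul_div_assoc', div_le_iff₀ (by positivity)]
      nlinarith [measureReal_nonneg (μ := volume) (s := O)]
    linarith [hmoll k, hmoll l, hb k, hb l]
  -- conclusion by completeness of `L¹`
  set F : ℕ → (Plane →₁[volume] ℝ) := fun k => (hv k).toL1 (v k) with hF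
  have hdist : ∀ k l, dist (F k) (F l) = ∫ x, |v k x - v l x| := fun k l => by
    rw [dist_eq_norm, hF, ← Integrable.toL1_sub, norm_toL1_eq_integral]
    rfl
  have htb : TotallyBounded (Set.range F) := by
    rw [Metric.totallyBounded_iff]
    intro ε hε
    obtain ⟨I, hI⟩ := hnet ε hε
    refine ⟨F '' I, I.finite_toSet.image F, ?_⟩
    rintro _ ⟨k, rfl⟩
    obtain ⟨l, hl, hkl⟩ := hI k
    exact Set.mem_iUnion₂.2 ⟨F l, ⟨l, hl, rfl⟩, by rw [Metric.mem_ball, hdist]; exact hkl⟩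
  have hcomp : IsCompact (closure (Set.range F)) :=
    htb.closure.isCompact_of_isClosed isClosed_closure
  obtain ⟨f, -, ρ, hρ, hlim⟩ := hcomp.tendsto_subseq (x := F) fun k => subset_closure ⟨k, rfl⟩
  refine ⟨f, L1.integrable_coeFn f, ρ, hρ, ?_⟩
  rw [tendsto_iff_dist_tendsto_zero] at hlim
  refine hlim.congr fun k => ?_
  have hfe : f = (L1.integrable_coeFn f).toL1 f := (Integrable.toL1_coeFn f _).symm
  rw [Function.comp, dist_eq_norm]
  conv_lhs => rw [hfe, hF]
  rw [← Integrable.toL1_sub, norm_toL1_eq_integral]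
  rfl

/-! ### Gradient measures -/

/-- Weak limits, along an ultrafilter, of a bounded sequence of densities. -/
lemma exists_weak_limit (𝒰 : Ultrafilter ℕ) {q : ℕ → Plane → ℝ} {M R : ℝ}
    (hq : ∀ k, Integrable (q k)) (hq0 : ∀ k x, 0 ≤ q k x) (hM : ∀ k, ∫ x, q k x ≤ M)
    (hR : ∀ k, ∀ x ∉ Metric.closedBall (0 : Plane) R, q k x = 0) :
    ∃ ν : Measure Plane, IsFiniteMeasure ν ∧ ∀ f : Plane → ℝ, Continuous f → HasCompactSupport f →
      Tendsto (fun k => ∫ x, f x * q k x) 𝒰 (𝓝 (∫ x, f x ∂ν)) := by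
  set m : ℕ → Measure Plane := fun k => volume.withDensity fun x => ENNReal.ofReal (q k x) with hm
  have hmass : ∀ k, m k Set.univ = ENNReal.ofReal (∫ x, q k x) := fun k => by
    rw [hm, withDensity_apply _ MeasurableSet.univ, Measure.restrict_univ,
      ofReal_integral_eq_lintegral_ofReal (hq k) (Eventually.of_forall (hq0 k))]
  have hfin : ∀ k, IsFiniteMeasure (m k) := fun k => ⟨by rw [hmass]; exact ENNReal.ofReal_lt_top⟩
  set F : ℕ → FiniteMeasure Plane := fun k => ⟨m k, hfin k⟩ with hF
  -- Measures of bounded mass on a fixed compact set form a weakly compact family, so the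
  -- ultrafilter converges without extracting a subsequence.
  have hcomp := isCompact_setOfPred_finiteMeasure_le_of_isCompact (E := Plane) (M.toNNReal)
    (isCompact_closedBall (0 : Plane) R)
  have hmem : ∀ k, F k ∈ {μ : FiniteMeasure Plane |
      μ.mass ≤ M.toNNReal ∧ μ (Metric.closedBall (0 : Plane) R)ᶜ = 0} := fun k => by
    refine ⟨?_, ?_⟩
    · rw [← ENNReal.coe_le_coe, FiniteMeasure.ennreal_mass]
      exact (hmass k).le.trans (ENNReal.ofReal_le_ofReal (hM k))
    · rw [FiniteMeasure.null_iff_toMeasure_null]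
      change m k _ = 0
      rw [hm, withDensity_apply _ Metric.isClosed_closedBall.measurableSet.compl]
      refine setLIntegral_eq_zero Metric.isClosed_closedBall.measurableSet.compl fun x hx => ?_
      simp [hR k x hx]
  obtain ⟨ν, -, hν⟩ := hcomp.ultrafilter_le_nhds' (𝒰.map F)
    (Ultrafilter.mem_map.2 (Filter.Eventually.of_forall hmem))
  have hν' : Tendsto F 𝒰 (𝓝 ν) := hν
  rw [FiniteMeasure.tendsto_iff_forall_integral_tendsto] at hν'
  refine ⟨ν, inferInstance, fun f hf hc => ?_⟩
  obtain ⟨C, -, hC⟩ := exists_bound hf hc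
  have := hν' (BoundedContinuousFunction.ofNormedAddCommGroup f hf C hC)
  refine this.congr fun k => ?_
  change ∫ x, f x ∂(m k) = _
  rw [hm, integral_withDensity_eq_integral_toReal_smul₀ (hq k).1.aemeasurable.ennreal_ofReal
    (Eventually.of_forall fun x => ENNReal.ofReal_lt_top)]
  refine integral_congr_ae (Eventually.of_forall fun x => ?_)
  simp only [smul_eq_mul]
  rw [ENNReal.toReal_ofReal (hq0 k x), mul_comm]

/-- The polar decomposition of a distributional gradient given by differences of finite
measures. -/
lemma exists_isGradientMeasure {D : Set Plane} (hD : MeasurableSet D) {u : Plane → ℝ}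
    {α β : Fin 2 → Measure Plane} [∀ j, IsFiniteMeasure (α j)] [∀ j, IsFiniteMeasure (β j)]
    (h : ∀ φ, IsTest D φ → ∀ j, ∫ x in D, u x * pderiv j φ x =
      -((∫ x, φ x ∂(α j)) - ∫ x, φ x ∂(β j))) :
    ∃ (μ : Measure Plane) (σ : Plane → Plane), IsGradientMeasure D u μ σ := by
  -- A common dominating measure: all components become densities with respect to `Λ`, and the polar
  -- decomposition can be formed pointwise.
  set Λ : Measure Plane := ((α 0 + β 0) + (α 1 + β 1)).restrict D with hΛ
  have hΛf : IsFiniteMeasure Λ := by rw [hΛ]; infer_instance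
  have hac : ∀ j, (α j).restrict D ≪ Λ ∧ (β j).restrict D ≪ Λ := by
    intro j
    fin_cases j
    · exact ⟨((Measure.le_add_right (Measure.le_add_right le_rfl)).absolutelyContinuous).restrict D,
        ((Measure.le_add_right (Measure.le_add_left le_rfl)).absolutelyContinuous).restrict D⟩
    · exact ⟨((Measure.le_add_left (Measure.le_add_right le_rfl)).absolutelyContinuous).restrict D,
        ((Measure.le_add_left (Measure.le_add_left le_rfl)).absolutelyContinuous).restrict D⟩
  set g : Fin 2 → Plane → ℝ := fun j x =>
    (((α j).restrict D).rnDeriv Λ x).toReal - (((β j).restrict D).rnDeriv Λ x).toReal with hg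
  have hgm : ∀ j, Measurable (g j) := fun j =>
    (Measure.measurable_rnDeriv _ _).ennreal_toReal.sub (Measure.measurable_rnDeriv _ _).ennreal_toReal
  have hgi : ∀ j, Integrable (g j) Λ := fun j =>
    Measure.integrable_toReal_rnDeriv.sub Measure.integrable_toReal_rnDeriv
  set G : Plane → Plane := fun x => g 0 x • EuclideanSpace.single 0 1 + g 1 x • EuclideanSpace.single 1 1
    with hG
  have hGj : ∀ x j, G x j = g j x := fun x j => by fin_cases j <;> simp [hG]
  have hGm : Measurable G := ((hgm 0).smul_const _).add ((hgm 1).smul_const _)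
  have hGi : Integrable G Λ := ((hgi 0).smul_const _).add ((hgi 1).smul_const _)
  -- The value where `G` vanishes is an arbitrary unit vector; `‖G‖ Λ` does not charge that set.
  set σ : Plane → Plane := fun x => if G x = 0 then EuclideanSpace.single 0 1 else ‖G x‖⁻¹ • G x
    with hσ
  have hσG : ∀ x j, ‖G x‖ * σ x j = g j x := fun x j => by
    rw [← hGj]
    by_cases hx : G x = 0
    · simp [hx]
    · simp only [hσ, if_neg hx, PiLp.smul_apply, smul_eq_mul]
      rw [← mul_assoc, mul_inv_cancel₀ (norm_ne_zero_iff.2 hx), one_mul]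
  refine ⟨Λ.withDensity fun x => (‖G x‖₊ : ℝ≥0∞), σ, ?_, ?_, ?_, ?_, ?_⟩
  · exact isFiniteMeasure_withDensity hGi.hasFiniteIntegral.ne
  · refine withDensity_absolutelyContinuous _ _ ?_
    rw [hΛ, Measure.restrict_apply hD.compl, Set.compl_inter_self, measure_empty]
  · exact Measurable.ite (hGm (measurableSet_singleton 0)) measurable_const
      (hGm.norm.inv.smul hGm)
  · refine Eventually.of_forall fun x => ?_
    by_cases hx : G x = 0
    · simp [hσ, hx]
    · simp [hσ, hx, norm_smul]
  · intro φ hφ j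
    rw [h φ hφ j, integral_withDensity_eq_integral_smul hGm.nnnorm]
    congr 1
    have h0 : ∀ x ∉ D, φ x = 0 := fun x hx => image_eq_zero_of_notMem_tsupport
      fun hc => hx (hφ.support hc)
    have hL1 : ((α j).restrict D).HaveLebesgueDecomposition Λ :=
      Measure.haveLebesgueDecomposition_of_sigmaFinite _ _
    have hL2 : ((β j).restrict D).HaveLebesgueDecomposition Λ :=
      Measure.haveLebesgueDecomposition_of_sigmaFinite _ _
    rw [← setIntegral_eq_integral_of_forall_compl_eq_zero h0,
      ← setIntegral_eq_integral_of_forall_compl_eq_zero (μ := β j) h0,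
      ← integral_rnDeriv_smul (hac j).1, ← integral_rnDeriv_smul (hac j).2]
    obtain ⟨C, -, hC⟩ := exists_bound hφ.smooth.continuous hφ.compact
    rw [← integral_sub]
    · refine integral_congr_ae (Eventually.of_forall fun x => ?_)
      simp only [NNReal.smul_def, coe_nnnorm, smul_eq_mul]
      rw [mul_left_comm, hσG, hg]
      ring
    · exact (Measure.integrable_toReal_rnDeriv.mul_bdd (c := C)
        hφ.smooth.continuous.aestronglyMeasurable (Eventually.of_forall hC))
    · exact (Measure.integrable_toReal_rnDeriv.mul_bdd (c := C)
        hφ.smooth.continuous.aestronglyMeasurable (Eventually.of_forall hC))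

/-! ### Integer valued functions of bounded variation -/

lemma integral_indicator_mul_pderiv {D : Set Plane} (hD : MeasurableSet D) (u : Plane → ℝ) (j : Fin 2)
    (φ : Plane → ℝ) :
    ∫ x, D.indicator u x * pderiv j φ x = ∫ x in D, u x * pderiv j φ x := by
  rw [← MeasureTheory.integral_indicator hD]
  refine integral_congr_ae (Eventually.of_forall fun x => ?_)
  by_cases hx : x ∈ D <;> simp [hx]

/-- The gradient of an integer valued function does not charge the points of approximate
continuity. -/
lemma measure_diff_approxDiscontinuitySet {D : Set Plane} (hD : IsOpen D)
    (hDR : D ⊆ Metric.ball 0 10) {u : Plane → ℝ} (hu : IntegrableOn u D)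
    (hint : ∀ᵐ x ∂(volume.restrict D), ∃ k : ℤ, u x = k) {μ : Measure Plane} {σ : Plane → Plane}
    (hμ : IsGradientMeasure D u μ σ) : μ (D \ approxDiscontinuitySet u) = 0 := by
  have := hμ.finite
  set w := D.indicator u with hw
  have hwi : Integrable w := (integrable_indicator_iff hD.measurableSet).2 hu
  have hs : ∀ j, ∀ φ, IsTest D φ → ∫ x, w x * pderiv j φ x = - ∫ x, φ x * σ x j ∂μ :=
    fun j φ hφ => by
      rw [integral_indicator_mul_pderiv hD.measurableSet]; exact hμ.byParts φ hφ j
  -- This function fixes every integer and has derivative zero there, so `f ∘ u = u` almost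
  -- everywhere although the chain rule factor vanishes at integer values.
  set f : ℝ → ℝ := fun t => t - Real.sin (2 * Real.pi * t) / (2 * Real.pi) with hf
  have hfd : ∀ t, HasDerivAt f (1 - Real.cos (2 * Real.pi * t)) t := fun t => by
    have h1 : HasDerivAt f _ t := (hasDerivAt_id t).sub
      ((((hasDerivAt_id t).const_mul (2 * Real.pi)).sin).div_const (2 * Real.pi))
    convert h1 using 1
    have := Real.pi_pos
    simp only [id]
    field_simp
  have hfd' : deriv f = fun t => 1 - Real.cos (2 * Real.pi * t) := funext fun t => (hfd t).deriv
  have hfs : ContDiff ℝ 1 f := contDiff_id.sub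
    ((Real.contDiff_sin.comp (contDiff_const.mul contDiff_id)).div_const _)
  have hf2 : ∀ t, |deriv f t| ≤ 2 := fun t => by
    rw [hfd', abs_le]
    constructor <;> linarith [Real.neg_one_le_cos (2 * Real.pi * t), Real.cos_le_one (2 * Real.pi * t)]
  have hf0 : ∀ t, 0 ≤ deriv f t := fun t => by
    rw [hfd']; linarith [Real.cos_le_one (2 * Real.pi * t)]
  have hfk : ∀ k : ℤ, f k = k ∧ deriv f k = 0 := fun k => by
    have e : 2 * Real.pi * (k : ℝ) = k * (2 * Real.pi) := by ring
    constructor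
    · simp only [hf]
      rw [e, Real.sin_periodic.int_mul_eq k |>.trans Real.sin_zero |> fun h => h]
      simp
    · rw [hfd']
      simp only
      rw [e, Real.cos_int_mul_two_pi, sub_self]
  have hfw : ∀ᵐ x, f (w x) = w x := by
    have h1 := (ae_restrict_iff' hD.measurableSet).1 hint
    filter_upwards [h1] with x hx
    by_cases hxD : x ∈ D
    · obtain ⟨k, hk⟩ := hx hxD
      rw [hw, Set.indicator_of_mem hxD, hk]
      exact (hfk k).1
    · rw [hw, Set.indicator_of_notMem hxD]; simpa using (hfk 0).1
  -- A cutoff equal to one on `D`, which makes the set `G` below independent of the test function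
  -- `φ`.
  obtain ⟨χ, hχ, hχ1, hχK⟩ := exists_cutoff (isCompact_closedBall (0 : Plane) 10) isOpen_univ
    (Set.subset_univ _)
  have hχD : ∀ x ∈ D, χ x = 1 := fun x hx =>
    subset_of_mem_nhdsSet hχK (Metric.ball_subset_closedBall (hDR hx))
  have hcm : ∀ n, Continuous (moll n w) := fun n => continuous_moll n hwi.locallyIntegrable
  have hcd := hfs.continuous_deriv_one
  -- A measurable set on which the mollified chain rule factor disappears; it replaces `D \
  -- approxDiscontinuitySet u`, whose measurability is then not needed.
  set G := {x | Tendsto (fun n => moll n (fun y => χ y * deriv f (moll n w y)) x) atTop (𝓝 0)}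
    with hG
  have hgc : ∀ n, Continuous (fun y => χ y * deriv f (moll n w y)) := fun n =>
    hχ.smooth.continuous.mul (hcd.comp (hcm n))
  have hGm : MeasurableSet G := measurableSet_tendsto _ fun n =>
    (continuous_moll n (hgc n).locallyIntegrable).measurable
  -- the points of approximate continuity belong to `G`
  have hsub : D \ approxDiscontinuitySet u ⊆ G := by
    rintro x ⟨hxD, hx⟩
    obtain ⟨z, hz⟩ := not_not.1 hx
    obtain ⟨r, hr, hrD⟩ := Metric.isOpen_iff.1 hD x hxD
    have hpos : Tendsto (fun n => 2 * rad n) atTop (𝓝[>] 0) := by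
      refine tendsto_nhdsWithin_iff.2 ⟨by simpa using tendsto_rad.const_mul 2,
        Eventually.of_forall fun n => ?_⟩
      have := rad_pos n
      simp only [Set.mem_Ioi]; positivity
    have hsmall : ∀ᶠ n in atTop, 2 * rad n < r := by
      have : Tendsto (fun n => 2 * rad n) atTop (𝓝 0) := by simpa using tendsto_rad.const_mul 2
      exact this.eventually (gt_mem_nhds hr)
    have hlim := hz.comp hpos
    have hae : ∀ ρ, 0 < ρ → Metric.ball x ρ =ᵐ[volume] Metric.closedBall x ρ := fun ρ hρ => by
      rw [← Metric.ball_union_sphere]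
      refine (union_ae_eq_left_of_ae_eq_empty (ae_eq_empty.2 ?_)).symm
      exact Measure.addHaar_sphere_of_ne_zero _ _ hρ.ne'
    have hlim' : Tendsto (fun n => ⨍ y in Metric.closedBall x (2 * rad n), |w y - z|) atTop
        (𝓝 0) := by
      refine hlim.congr' ?_
      filter_upwards [hsmall] with n hn
      have hρ : 0 < 2 * rad n := by have := rad_pos n; positivity
      simp only [Function.comp]
      rw [← setAverage_congr (hae _ hρ)]
      refine setAverage_congr_fun Metric.isOpen_ball.measurableSet (Eventually.of_forall ?_)
      intro y hy
      rw [hw, Set.indicator_of_mem (hrD (Metric.ball_subset_ball hn.le hy))]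
    -- the approximate limit is an integer
    have hzint : deriv f z = 0 := by
      by_contra hne
      have hzk : ∀ k : ℤ, z ≠ k := fun k hk => hne (hk ▸ (hfk k).2)
      have hd : 0 < |z - round z| := abs_pos.2 (sub_ne_zero.2 (hzk _))
      refine hd.not_ge (ge_of_tendsto hlim ?_)
      filter_upwards [hsmall] with n hn
      have hρ : 0 < 2 * rad n := by have := rad_pos n; positivity
      have hv0 : volume (Metric.ball x (2 * rad n)) ≠ 0 := (Metric.measure_ball_pos _ _ hρ).ne'
      have hvt : volume (Metric.ball x (2 * rad n)) ≠ ⊤ := measure_ball_lt_top.ne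
      have hsubD : Metric.ball x (2 * rad n) ⊆ D := (Metric.ball_subset_ball hn.le).trans hrD
      simp only [Function.comp]
      calc |z - round z| = ⨍ y in Metric.ball x (2 * rad n), |z - round z| :=
            (setAverage_const hv0 hvt _).symm
        _ ≤ ⨍ y in Metric.ball x (2 * rad n), |u y - z| := by
            rw [setAverage_eq, setAverage_eq]
            refine smul_le_smul_of_nonneg_left ?_ (by positivity)
            refine integral_mono_ae (integrableOn_const hvt)
              (((hu.mono_set hsubD).sub (integrableOn_const hvt)).abs) ?_
            filter_upwards [ae_restrict_of_ae_restrict_of_subset hsubD hint] with y hy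
            obtain ⟨k, hk⟩ := hy
            rw [hk, abs_sub_comm (k : ℝ) z]
            exact round_le z k
    have := tendsto_moll_mul_comp_moll hwi hlim' hχ.smooth.continuous hχ.compact hcd
    rw [hzint, mul_zero] at this
    exact this
  -- the main estimate
  have main : ∀ j φ, IsTest D φ → |∫ x, φ x * σ x j ∂μ| ≤ 2 * ∫ x in Gᶜ, |φ x| ∂μ := by
    intro j φ hφ
    obtain ⟨C, hC0, hC⟩ := exists_bound hφ.smooth.continuous hφ.compact
    have hlim := tendsto_integral_moll_mul_measure hD hwi (hs j) hfs hf2 hφ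
    have e1 : - ∫ x, f (w x) * pderiv j φ x = ∫ x, φ x * σ x j ∂μ := by
      rw [← neg_eq_iff_eq_neg.2 (hs j φ hφ)]
      congr 1
      refine integral_congr_ae ?_
      filter_upwards [hfw] with x hx
      rw [hx]
    rw [e1] at hlim
    set h : ℕ → Plane → ℝ := fun n => moll n (fun y => φ y * deriv f (moll n w y)) with hh
    have hhc : ∀ n, Continuous (fun y => φ y * deriv f (moll n w y)) := fun n =>
      hφ.smooth.continuous.mul (hcd.comp (hcm n))
    have hhm : ∀ n, Continuous (h n) := fun n => continuous_moll n (hhc n).locallyIntegrable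
    have hb : ∀ n x, |h n x| ≤ C * 2 := fun n x => abs_moll_le n (fun y => by
      rw [abs_mul]
      gcongr
      · exact hC y
      · exact hf2 _) x
    have hφc : Continuous (fun x => |φ x|) := hφ.smooth.continuous.abs
    have hφi : Integrable (fun x => |φ x|) :=
      (hφ.smooth.continuous.integrable_of_hasCompactSupport hφ.compact).abs
    have hmono : ∀ n x, ∀ a b : Plane → ℝ, Integrable a → Integrable b → (∀ y, |a y| ≤ b y) →
        |moll n a x| ≤ moll n b x := by
      intro n x a b ha hb hab
      rw [moll, moll, ← Real.norm_eq_abs]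
      refine norm_integral_le_of_norm_le (integrable_mul_ker hb n x) (Eventually.of_forall fun y => ?_)
      rw [norm_mul, Real.norm_eq_abs, Real.norm_eq_abs, abs_of_nonneg (ker_nonneg n _)]
      exact mul_le_mul_of_nonneg_right (hab y) (ker_nonneg n _)
    have hhi : ∀ n, Integrable (fun y => φ y * deriv f (moll n w y)) := fun n =>
      (hhc n).integrable_of_hasCompactSupport hφ.compact.mul_right
    have hgi : ∀ n, Integrable (fun y => χ y * deriv f (moll n w y)) := fun n =>
      (hgc n).integrable_of_hasCompactSupport hχ.compact.mul_right
    have b1 : ∀ n x, |h n x| ≤ C * moll n (fun y => χ y * deriv f (moll n w y)) x := fun n x => by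
      have h1 := hmono n x _ _ (hhi n) ((hgi n).const_mul C) fun y => by
        by_cases hy : y ∈ D
        · rw [hχD y hy, abs_mul, abs_of_nonneg (hf0 _), one_mul]
          exact mul_le_mul_of_nonneg_right (hC y) (hf0 _)
        · have : φ y = 0 := image_eq_zero_of_notMem_tsupport fun hc => hy (hφ.support hc)
          rw [this, zero_mul, abs_zero]
          exact mul_nonneg hC0.le (mul_nonneg (hχ1 y).1 (hf0 _))
      refine h1.trans (le_of_eq ?_)
      simp only [moll]
      rw [← integral_const_mul]
      refine integral_congr_ae (Eventually.of_forall fun y => ?_)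
      simp only; ring
    have b2 : ∀ n x, |h n x| ≤ 2 * moll n (fun y => |φ y|) x := fun n x => by
      have h1 := hmono n x _ _ (hhi n) (hφi.const_mul 2) fun y => by
        rw [abs_mul, mul_comm]
        exact mul_le_mul_of_nonneg_right (hf2 _) (abs_nonneg _)
      refine h1.trans (le_of_eq ?_)
      simp only [moll]
      rw [← integral_const_mul]
      refine integral_congr_ae (Eventually.of_forall fun y => ?_)
      simp only; ring
    have hint_h : ∀ n, Integrable (fun x => |h n x|) μ := fun n =>
      (Integrable.of_bound (hhm n).aestronglyMeasurable (C * 2)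
        (Eventually.of_forall fun x => hb n x)).abs
    -- On `G` the approximating densities tend to zero; on the complement only the crude bound `|f'|
    -- ≤ 2` is used, whence the factor `2` in the estimate.
    have l1 : Tendsto (fun n => ∫ x in G, |h n x| ∂μ) atTop (𝓝 (∫ x in G, (0:ℝ) ∂μ)) := by
      refine tendsto_integral_of_dominated_convergence (fun _ => C * 2)
        (fun n => (hhm n).abs.aestronglyMeasurable) (integrable_const _)
        (fun n => Eventually.of_forall fun x => by
          rw [Real.norm_eq_abs, abs_abs]; exact hb n x) ?_
      refine (ae_restrict_iff' hGm).2 (Eventually.of_forall fun x hx => ?_)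
      have h2 : Tendsto (fun n => moll n (fun y => χ y * deriv f (moll n w y)) x) atTop (𝓝 0) := hx
      have h3 := h2.const_mul C
      rw [mul_zero] at h3
      exact squeeze_zero (fun n => abs_nonneg _) (fun n => b1 n x) h3
    have l2 : Tendsto (fun n => ∫ x in Gᶜ, 2 * moll n (fun y => |φ y|) x ∂μ) atTop
        (𝓝 (∫ x in Gᶜ, 2 * |φ x| ∂μ)) := by
      refine tendsto_integral_of_dominated_convergence (fun _ => 2 * C)
        (fun n => (continuous_const.mul (continuous_moll n hφi.locallyIntegrable)).aestronglyMeasurable)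
        (integrable_const _) (fun n => Eventually.of_forall fun x => ?_)
        (Eventually.of_forall fun x => ?_)
      · rw [norm_mul, Real.norm_eq_abs, Real.norm_eq_abs, abs_two]
        gcongr
        exact abs_moll_le n (fun y => by rw [abs_abs]; exact hC y) x
      · refine Tendsto.const_mul 2 ?_
        rw [Metric.tendsto_atTop']
        intro ε hε
        obtain ⟨η, hη, hηε⟩ := Metric.continuousAt_iff.1 (hφc.continuousAt (x := x))
          (ε / 2) (half_pos hε)
        obtain ⟨N, hN⟩ := (tendsto_rad.eventually (gt_mem_nhds hη)).exists_forall_of_atTop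
        refine ⟨N, fun n hn => ?_⟩
        rw [Real.dist_eq]
        exact (abs_moll_sub_le n hφi (ε := ε / 2) fun y hy =>
          (hηε (hy.trans (hN n hn.le))).le).trans_lt (half_lt_self hε)
    have l3 := l1.add l2
    rw [integral_zero, zero_add, integral_const_mul] at l3
    refine le_of_tendsto_of_tendsto hlim.abs l3 (Eventually.of_forall fun n => ?_)
    have hσb : ∀ᵐ x ∂μ, |σ x j| ≤ 1 := by
      filter_upwards [hμ.unit] with x hx
      have := PiLp.norm_apply_le (σ x) j
      rw [hx] at this
      exact this
    calc |∫ x, h n x * σ x j ∂μ| ≤ ∫ x, |h n x| ∂μ := by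
          rw [← Real.norm_eq_abs]
          refine norm_integral_le_of_norm_le (hint_h n) ?_
          filter_upwards [hσb] with x hx
          rw [norm_mul, Real.norm_eq_abs, Real.norm_eq_abs]
          exact mul_le_of_le_one_right (abs_nonneg _) hx
      _ = (∫ x in G, |h n x| ∂μ) + ∫ x in Gᶜ, |h n x| ∂μ :=
          (integral_add_compl hGm (hint_h n)).symm
      _ ≤ _ := by
          refine add_le_add le_rfl (integral_mono (hint_h n).integrableOn ?_ fun x => b2 n x)
          exact ((Integrable.of_bound (continuous_moll n hφi.locallyIntegrable).aestronglyMeasurable C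
            (Eventually.of_forall fun x => abs_moll_le n (fun y => by
              rw [abs_abs]; exact hC y) x)).const_mul 2)
  -- conclusion by density of test functions
  have hzero : ∀ j, ∫ x in G, (σ x j) ^ 2 ∂μ ≤ 0 := by
    intro j
    have hσm : Measurable fun x => σ x j := by
      have := hμ.measurable
      fun_prop
    have hσb : ∀ᵐ x ∂μ, |σ x j| ≤ 1 := by
      filter_upwards [hμ.unit] with x hx
      have := PiLp.norm_apply_le (σ x) j
      rw [hx] at this
      exact this
    have hσi : Integrable (fun x => σ x j) μ := Integrable.of_bound hσm.aestronglyMeasurable 1 hσb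
    -- Testing the estimate with `F` itself would give `∫_G σ_j² ≤ 0`, as `F` vanishes off `G`. A
    -- compactly supported approximation `g θ` with `L¹(μ)` error `ε / 3` costs `ε / 3` on the left
    -- and `2 ε / 3` on the right.
    set F := G.indicator fun x => σ x j with hF
    have hFi : Integrable F μ := hσi.indicator hGm
    refine le_of_forall_pos_le_add fun ε hε => ?_
    rw [zero_add]
    obtain ⟨K, hKD, hK, hKε⟩ := hD.measurableSet.exists_isCompact_sdiff_lt (μ := μ)
      (measure_lt_top μ D).ne (ε := ENNReal.ofReal (ε / 6)) (by simpa using by positivity)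
    obtain ⟨θ, hθ, hθ1, hθK⟩ := exists_cutoff hK hD hKD
    obtain ⟨g, hgc, hgs, hge⟩ := (memLp_one_iff_integrable.2 hFi).exist_eLpNorm_sub_le
      ENNReal.one_ne_top le_rfl (show 0 < ε / 6 by positivity)
    have hgi : Integrable g μ := hgs.continuous.integrable_of_hasCompactSupport hgc
    have htest : IsTest D fun x => g x * θ x := hθ.mul_left hgs
    have hti : Integrable (fun x => g x * θ x) μ :=
      htest.smooth.continuous.integrable_of_hasCompactSupport htest.compact
    have h1 : ∫ x, |F x - g x| ∂μ ≤ ε / 6 := by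
      rw [eLpNorm_one_eq_lintegral_enorm] at hge
      have := ENNReal.toReal_le_of_le_ofReal (by positivity) hge
      rwa [← integral_norm_eq_lintegral_enorm (hFi.sub hgi).1] at this
    have hKm := hK.isClosed.measurableSet
    have h2 : ∫ x, Kᶜ.indicator (fun _ => (1:ℝ)) x ∂μ ≤ ε / 6 := by
      rw [integral_indicator_const _ hKm.compl, smul_eq_mul, mul_one, measureReal_def]
      refine ENNReal.toReal_le_of_le_ofReal (by positivity) ?_
      have : μ Kᶜ ≤ μ (D \ K) + μ Dᶜ := (measure_mono (fun x hx => by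
        by_cases hxD : x ∈ D
        · exact Or.inl ⟨hxD, hx⟩
        · exact Or.inr hxD)).trans (measure_union_le _ _)
      rw [hμ.carried, add_zero] at this
      exact this.trans hKε.le
    have hFb : ∀ᵐ x ∂μ, |F x| ≤ 1 := by
      filter_upwards [hσb] with x hx
      by_cases hxG : x ∈ G
      · rw [hF, Set.indicator_of_mem hxG]; exact hx
      · rw [hF, Set.indicator_of_notMem hxG]; simp
    have h3 : ∫ x, |F x - g x * θ x| ∂μ ≤ ε / 3 := by
      have hi2 : Integrable (fun x => Kᶜ.indicator (fun _ => (1:ℝ)) x) μ :=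
        (integrable_const 1).indicator hKm.compl
      calc _ ≤ ∫ x, (|F x - g x| + Kᶜ.indicator (fun _ => (1:ℝ)) x) ∂μ := by
            refine integral_mono_ae (hFi.sub hti).abs ((hFi.sub hgi).abs.add hi2) ?_
            filter_upwards [hFb] with x hx
            obtain ⟨t0, t1⟩ := hθ1 x
            by_cases hxK : x ∈ K
            · rw [subset_of_mem_nhdsSet hθK hxK, mul_one]
              exact le_add_of_nonneg_right (Set.indicator_nonneg (fun _ _ => zero_le_one) _)
            · rw [Set.indicator_of_mem (show x ∈ Kᶜ from hxK)]
              calc |F x - g x * θ x| = |(F x - g x) * θ x + F x * (1 - θ x)| := by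
                    congr 1; ring
                _ ≤ |F x - g x| * θ x + |F x| * (1 - θ x) := by
                    refine (abs_add_le _ _).trans (le_of_eq ?_)
                    rw [abs_mul, abs_mul, abs_of_nonneg t0, abs_of_nonneg (sub_nonneg.2 t1)]
                _ ≤ |F x - g x| * 1 + 1 * 1 := by gcongr; linarith
                _ = _ := by ring
        _ = _ := integral_add (hFi.sub hgi).abs hi2
        _ ≤ ε / 3 := by linarith
    have h4 : ∫ x in Gᶜ, |g x * θ x| ∂μ ≤ ε / 3 := by
      calc _ = ∫ x in Gᶜ, |F x - g x * θ x| ∂μ := by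
            refine setIntegral_congr_fun hGm.compl fun x hx => ?_
            simp only [hF]
            rw [Set.indicator_of_notMem hx, zero_sub, abs_neg]
        _ ≤ ∫ x, |F x - g x * θ x| ∂μ :=
            setIntegral_le_integral (hFi.sub hti).abs (Eventually.of_forall fun x => abs_nonneg _)
        _ ≤ ε / 3 := h3
    have h5 := (le_abs_self _).trans (main j _ htest)
    have i1 : Integrable (fun x => g x * θ x * σ x j) μ := hti.mul_bdd hσm.aestronglyMeasurable hσb
    have i2 : Integrable (fun x => F x * σ x j) μ := hFi.mul_bdd hσm.aestronglyMeasurable hσb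
    have h6 : ∫ x in G, (σ x j) ^ 2 ∂μ = ∫ x, F x * σ x j ∂μ := by
      rw [← MeasureTheory.integral_indicator hGm]
      refine integral_congr_ae (Eventually.of_forall fun x => ?_)
      by_cases hx : x ∈ G <;> simp [hF, hx, sq]
    have h7 : (∫ x, F x * σ x j ∂μ) - ∫ x, g x * θ x * σ x j ∂μ ≤ ε / 3 := by
      rw [← integral_sub i2 i1]
      refine le_trans (integral_mono_ae (i2.sub i1) (hFi.sub hti).abs ?_) h3
      filter_upwards [hσb] with x hx
      rw [← sub_mul]
      refine (le_abs_self _).trans ?_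
      rw [abs_mul]
      exact mul_le_of_le_one_right (abs_nonneg _) hx
    rw [h6]
    linarith
  have hμG : μ G = 0 := by
    have hσm : ∀ j : Fin 2, Measurable fun x => σ x j := fun j => by
      have := hμ.measurable
      fun_prop
    have hσb : ∀ j : Fin 2, ∀ᵐ x ∂μ, |σ x j| ≤ 1 := fun j => by
      filter_upwards [hμ.unit] with x hx
      have := PiLp.norm_apply_le (σ x) j
      rw [hx] at this
      exact this
    have hsq : ∀ j : Fin 2, Integrable (fun x => σ x j ^ 2) μ := fun j =>
      Integrable.of_bound ((hσm j).pow_const 2).aestronglyMeasurable 1 (by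
        filter_upwards [hσb j] with x hx
        rw [norm_pow, Real.norm_eq_abs]
        exact pow_le_one₀ (abs_nonneg _) hx)
    have e : μ.real G = (∫ x in G, σ x 0 ^ 2 ∂μ) + ∫ x in G, σ x 1 ^ 2 ∂μ := by
      rw [← integral_add (hsq 0).integrableOn (hsq 1).integrableOn]
      have : ∫ x in G, (1:ℝ) ∂μ = μ.real G := by simp
      rw [← this]
      refine integral_congr_ae (ae_restrict_of_ae ?_)
      filter_upwards [hμ.unit] with x hx
      have h2 := EuclideanSpace.norm_sq_eq (σ x)
      rw [hx, Fin.sum_univ_two] at h2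
      simpa using h2
    have h0 : μ.real G ≤ 0 := by rw [e]; linarith [hzero 0, hzero 1]
    have h1 : μ.real G = 0 := le_antisymm h0 measureReal_nonneg
    exact (measureReal_eq_zero_iff (measure_ne_top μ G)).1 h1
  exact measure_mono_null hsub hμG

lemma memSBVInt_of_isGradientMeasure {D : Set Plane} (hD : IsOpen D) (hDR : D ⊆ Metric.ball 0 10)
    {u : Plane → ℝ} (hu : IntegrableOn u D)
    (hint : ∀ᵐ x ∂(volume.restrict D), ∃ k : ℤ, u x = k) {μ : Measure Plane} {σ : Plane → Plane}
    (hμ : IsGradientMeasure D u μ σ) : MemSBVInt D u := by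
  have := hμ.finite
  refine ⟨⟨hu, μ, σ, hμ, ?_⟩, hint⟩
  exact le_antisymm ((Measure.singularPart_le μ volume _).trans
    (measure_diff_approxDiscontinuitySet hD hDR hu hint hμ).le) bot_le

/-! ### The Gauss-Green formula on a half plane -/

/-- The clockwise rotation by a right angle. -/
def rot (p : Plane) : Plane := !₂[p 1, -p 0]

@[simp] lemma rot_apply_zero (p : Plane) : rot p 0 = p 1 := rfl

@[simp] lemma rot_apply_one (p : Plane) : rot p 1 = -p 0 := rfl

/-- The half plane to the right of the line through `a` with direction `τ`. -/
def halfPlane (a τ : Plane) : Set Plane :=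
  {x | 0 < (x 0 - a 0) * τ 1 - (x 1 - a 1) * τ 0}

lemma sq_add_sq_eq_one {τ : Plane} (hτ : ‖τ‖ = 1) : τ 0 ^ 2 + τ 1 ^ 2 = 1 := by
  have h := EuclideanSpace.norm_sq_eq τ
  rw [hτ, Fin.sum_univ_two] at h
  simpa using h.symm

lemma measurableSet_halfPlane (a τ : Plane) : MeasurableSet (halfPlane a τ) := by
  refine (isOpen_lt continuous_const ?_).measurableSet
  fun_prop

/-- The rotation that takes the standard basis to `(τ, rot τ)`. -/
def frame {τ : Plane} (hτ : ‖τ‖ = 1) : Plane ≃ₗᵢ[ℝ] Plane :=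
  LinearIsometry.toLinearIsometryEquiv
    { toFun := fun y => y 0 • τ + y 1 • rot τ
      map_add' := fun x y => by simp only [PiLp.add_apply]; module
      map_smul' := fun c x => by
        simp only [PiLp.smul_apply, smul_eq_mul, RingHom.id_apply]; module
      norm_map' := fun x => by
        have h1 := sq_add_sq_eq_one hτ
        rw [← sq_eq_sq₀ (norm_nonneg _) (norm_nonneg _), EuclideanSpace.norm_sq_eq,
          EuclideanSpace.norm_sq_eq, Fin.sum_univ_two, Fin.sum_univ_two]
        simp only [LinearMap.coe_mk, AddHom.coe_mk, PiLp.add_apply, PiLp.smul_apply, smul_eq_mul,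
          rot_apply_zero, rot_apply_one, Real.norm_eq_abs, sq_abs]
        linear_combination (x 0 ^ 2 + x 1 ^ 2) * h1 } rfl

lemma frame_apply {τ : Plane} (hτ : ‖τ‖ = 1) (y : Plane) :
    frame hτ y = y 0 • τ + y 1 • rot τ := by
  rw [frame, LinearIsometry.toLinearIsometryEquiv_apply]; rfl

/-- Orthonormal coordinates with origin `a` and first axis `τ`. -/
def coords (a τ : Plane) (z : ℝ × ℝ) : Plane := a + (z.1 • τ + z.2 • rot τ)

lemma coords_eq_comp (a : Plane) {τ : Plane} (hτ : ‖τ‖ = 1) :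
    coords a τ = (fun x => a + x) ∘ frame hτ ∘ (WithLp.toLp 2) ∘
      (MeasurableEquiv.finTwoArrow (α := ℝ)).symm := by
  funext z
  simp [coords, frame_apply, MeasurableEquiv.finTwoArrow]

lemma measurePreserving_coords (a : Plane) {τ : Plane} (hτ : ‖τ‖ = 1) :
    MeasurePreserving (coords a τ) := by
  rw [coords_eq_comp a hτ]
  exact (measurePreserving_add_left volume a).comp
    ((LinearIsometryEquiv.measurePreserving (frame hτ)).comp
      ((PiLp.volume_preserving_toLp (Fin 2)).comp (volume_preserving_finTwoArrow ℝ).symm))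

lemma measurableEmbedding_coords (a : Plane) {τ : Plane} (hτ : ‖τ‖ = 1) :
    MeasurableEmbedding (coords a τ) := by
  rw [coords_eq_comp a hτ]
  exact (measurableEmbedding_addLeft a).comp
    ((frame hτ).toHomeomorph.measurableEmbedding.comp
      ((MeasurableEquiv.toLp 2 (Fin 2 → ℝ)).measurableEmbedding.comp
        (MeasurableEquiv.finTwoArrow (α := ℝ)).symm.measurableEmbedding))

lemma coords_mem_halfPlane (a : Plane) {τ : Plane} (hτ : ‖τ‖ = 1) (z : ℝ × ℝ) :
    coords a τ z ∈ halfPlane a τ ↔ 0 < z.2 := by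
  have h1 := sq_add_sq_eq_one hτ
  have : (coords a τ z 0 - a 0) * τ 1 - (coords a τ z 1 - a 1) * τ 0 = z.2 := by
    simp only [coords, PiLp.add_apply, PiLp.smul_apply, smul_eq_mul, rot_apply_zero, rot_apply_one]
    linear_combination z.2 * h1
  rw [halfPlane, Set.mem_ofPred_eq, this]

/-- The derivative of the indicator function of a half plane. -/
lemma setIntegral_halfPlane_pderiv (a : Plane) {τ : Plane} (hτ : ‖τ‖ = 1) {φ : Plane → ℝ}
    (hφ : IsTest Set.univ φ) (j : Fin 2) :
    ∫ x in halfPlane a τ, pderiv j φ x = -(rot τ j * ∫ t : ℝ, φ (a + t • τ)) := by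
  have h1 := sq_add_sq_eq_one hτ
  have hfd : ∀ z : ℝ × ℝ, DifferentiableAt ℝ φ (coords a τ z) := fun z => hφ.differentiable _
  have hT1 : ∀ r : ℝ, Isometry fun t => coords a τ (t, r) := fun r => by
    refine Isometry.of_dist_eq fun s t => ?_
    simp [coords, dist_eq_norm, ← sub_smul, norm_smul, hτ]
  have hrot : ‖rot τ‖ = 1 := by
    rw [← sq_eq_sq₀ (norm_nonneg _) zero_le_one, EuclideanSpace.norm_sq_eq, Fin.sum_univ_two]
    simp only [rot_apply_zero, rot_apply_one, Real.norm_eq_abs, sq_abs]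
    linarith
  have hT2 : ∀ t : ℝ, Isometry fun r => coords a τ (t, r) := fun t => by
    refine Isometry.of_dist_eq fun r s => ?_
    simp [coords, dist_eq_norm, ← sub_smul, norm_smul, hrot]
  have hd1 : ∀ t r : ℝ, HasDerivAt (fun t => φ (coords a τ (t, r)))
      (fderiv ℝ φ (coords a τ (t, r)) τ) t := fun t r => by
    refine (hfd (t, r)).hasFDerivAt.comp_hasDerivAt t ?_
    have : HasDerivAt (fun t : ℝ => a + (t • τ + r • rot τ)) ((1:ℝ) • τ) t :=
      (((hasDerivAt_id t).smul_const τ).add_const _).const_add _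
    simpa [coords] using this
  have hd2 : ∀ t r : ℝ, HasDerivAt (fun r => φ (coords a τ (t, r)))
      (fderiv ℝ φ (coords a τ (t, r)) (rot τ)) r := fun t r => by
    refine (hfd (t, r)).hasFDerivAt.comp_hasDerivAt r ?_
    have : HasDerivAt (fun r : ℝ => a + (t • τ + r • rot τ)) ((1:ℝ) • rot τ) r :=
      (((hasDerivAt_id r).smul_const (rot τ)).const_add _).const_add _
    simpa [coords] using this
  -- Coordinate derivatives are split into a tangential and a normal part with respect to the
  -- boundary line.
  have hpd : ∀ x, pderiv j φ x = τ j * fderiv ℝ φ x τ + rot τ j * fderiv ℝ φ x (rot τ) := by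
    intro x
    rw [fderiv_eq_pderiv, fderiv_eq_pderiv]
    fin_cases j
    · simp only [Fin.zero_eta, rot_apply_zero, rot_apply_one]
      linear_combination (-pderiv 0 φ x) * h1
    · simp only [Fin.mk_one, rot_apply_zero, rot_apply_one]
      linear_combination (-pderiv 1 φ x) * h1
  have hI : ∀ v : Plane, Integrable fun x => fderiv ℝ φ x v := fun v =>
    ((hφ.smooth.continuous_fderiv (by simp)).clm_apply continuous_const).integrable_of_hasCompactSupport
      (hφ.compact.fderiv_apply (𝕜 := ℝ) v)
  have hmp := measurePreserving_coords a hτ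
  have hme := measurableEmbedding_coords a hτ
  have hIc : ∀ v : Plane, Integrable fun z => fderiv ℝ φ (coords a τ z) v := fun v =>
    (hmp.integrable_comp_emb hme).2 (hI v)
  have hpre : coords a τ ⁻¹' halfPlane a τ = Set.univ ×ˢ Set.Ioi 0 := by
    ext z; simp [coords_mem_halfPlane a hτ]
  have key : ∀ v, ∫ x in halfPlane a τ, fderiv ℝ φ x v =
      ∫ z in (Set.univ ×ˢ Set.Ioi 0 : Set (ℝ × ℝ)), fderiv ℝ φ (coords a τ z) v := fun v => by
    rw [← hpre]
    exact (hmp.setIntegral_preimage_emb hme (fun x => fderiv ℝ φ x v) _).symm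
  -- The tangential derivative integrates to zero on each line parallel to the boundary.
  have e1 : ∫ x in halfPlane a τ, fderiv ℝ φ x τ = 0 := by
    rw [key, Measure.volume_eq_prod, ← Measure.prod_restrict, integral_prod_symm]
    · have : ∀ r : ℝ, ∫ t in Set.univ, fderiv ℝ φ (coords a τ (t, r)) τ = 0 := fun r => by
        rw [Measure.restrict_univ]
        have hc : HasCompactSupport fun t => φ (coords a τ (t, r)) :=
          hφ.compact.comp_isClosedEmbedding (hT1 r).isClosedEmbedding
        refine integral_eq_zero_of_hasDerivAt_of_integrable (f := fun t => φ (coords a τ (t, r)))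
          (fun t => hd1 t r) ?_ ?_
        · refine (Continuous.integrable_of_hasCompactSupport ?_ ?_)
          · exact ((hφ.smooth.continuous_fderiv (by simp)).comp (hT1 r).continuous).clm_apply
              continuous_const
          · exact (hφ.compact.fderiv_apply (𝕜 := ℝ) τ).comp_isClosedEmbedding
              (hT1 r).isClosedEmbedding
        · exact (hφ.smooth.continuous.comp (hT1 r).continuous).integrable_of_hasCompactSupport hc
      simp_rw [this]
      simp
    · rw [Measure.prod_restrict, ← Measure.volume_eq_prod]
      exact (hIc τ).integrableOn
  -- On each normal half line, the fundamental theorem of calculus leaves only the boundary value.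
  have e2 : ∫ x in halfPlane a τ, fderiv ℝ φ x (rot τ) = -∫ t : ℝ, φ (a + t • τ) := by
    rw [key, Measure.volume_eq_prod, ← Measure.prod_restrict, integral_prod, ← integral_neg,
      Measure.restrict_univ]
    · refine integral_congr_ae (Eventually.of_forall fun t => ?_)
      have hc : HasCompactSupport fun r => φ (coords a τ (t, r)) :=
        hφ.compact.comp_isClosedEmbedding (hT2 t).isClosedEmbedding
      have hs : ContDiff ℝ 1 fun r => φ (coords a τ (t, r)) := by
        refine (hφ.smooth.of_le (by exact_mod_cast le_top)).comp ?_
        unfold coords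
        fun_prop
      have h2 := hc.integral_Ioi_deriv_eq hs 0
      simp_rw [(hd2 t _).deriv] at h2
      simp only
      rw [h2]
      simp [coords]
    · rw [Measure.prod_restrict, ← Measure.volume_eq_prod]
      exact (hIc (rot τ)).integrableOn
  simp_rw [hpd]
  rw [integral_add ((hI τ).const_mul _).integrableOn ((hI (rot τ)).const_mul _).integrableOn,
    integral_const_mul, integral_const_mul, e1, e2]
  ring

/-! ### Segments -/

/-- The unit vector that points from `a` to `b`. -/
def dir (a b : Plane) : Plane := ‖b - a‖⁻¹ • (b - a)

lemma norm_dir {a b : Plane} (hab : a ≠ b) : ‖dir a b‖ = 1 := by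
  have : ‖b - a‖ ≠ 0 := norm_ne_zero_iff.2 (sub_ne_zero.2 hab.symm)
  rw [dir, norm_smul, norm_inv, norm_norm, inv_mul_cancel₀ this]

lemma isometry_line (a : Plane) {τ : Plane} (hτ : ‖τ‖ = 1) : Isometry fun t : ℝ => a + t • τ := by
  refine Isometry.of_dist_eq fun s t => ?_
  simp [dist_eq_norm, ← sub_smul, norm_smul, hτ]

lemma segment_eq_image_line {a b : Plane} (hab : a ≠ b) :
    segment ℝ a b = (fun t : ℝ => a + t • dir a b) '' Set.Icc 0 ‖b - a‖ := by
  have hpos : 0 < ‖b - a‖ := norm_pos_iff.2 (sub_ne_zero.2 hab.symm)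
  rw [segment_eq_image']
  ext x
  constructor
  · rintro ⟨t, ⟨h0, h1⟩, rfl⟩
    refine ⟨t * ‖b - a‖, ⟨by positivity, mul_le_of_le_one_left hpos.le h1⟩, ?_⟩
    simp only [dir, smul_smul]
    rw [mul_assoc, mul_inv_cancel₀ hpos.ne', mul_one]
  · rintro ⟨t, ⟨h0, h1⟩, rfl⟩
    refine ⟨t * ‖b - a‖⁻¹, ⟨by positivity, ?_⟩, ?_⟩
    · rw [← div_eq_mul_inv]; exact (div_le_one hpos).2 h1
    · simp only [dir, smul_smul]

lemma isCompact_segment (a b : Plane) : IsCompact (segment ℝ a b) := by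
  rw [segment_eq_image']
  exact isCompact_Icc.image (by fun_prop)

/-- Integration with respect to the length measure of a segment. -/
lemma setIntegral_segment {a b : Plane} (hab : a ≠ b) (f : Plane → ℝ) :
    ∫ x in segment ℝ a b, f x ∂(μH[1]) = ∫ t in Set.Icc 0 ‖b - a‖, f (a + t • dir a b) := by
  have hι := isometry_line a (norm_dir hab)
  have hseg := segment_eq_image_line hab
  have hm := hι.map_hausdorffMeasure (d := 1) (Or.inl zero_le_one)
  rw [hausdorffMeasure_real] at hm
  have hsub : segment ℝ a b ⊆ Set.range fun t : ℝ => a + t • dir a b := by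
    rw [hseg]; exact Set.image_subset_range _ _
  have hr : (μH[1] : Measure Plane).restrict (segment ℝ a b) =
      (Measure.map (fun t : ℝ => a + t • dir a b) volume).restrict (segment ℝ a b) := by
    rw [hm, Measure.restrict_restrict_of_subset hsub]
  rw [hr, hι.isClosedEmbedding.measurableEmbedding.setIntegral_map, hseg,
    Set.preimage_image_eq _ hι.injective]

lemma hausdorffMeasure_segment_lt_top (a b : Plane) : μH[1] (segment ℝ a b) < ⊤ := by
  rcases eq_or_ne a b with rfl | hab
  · rw [segment_same]
    have := Measure.nullSingletonClass_hausdorff Plane (d := 1) one_pos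
    simp
  · rw [segment_eq_image_line hab,
      (isometry_line a (norm_dir hab)).hausdorffMeasure_image (Or.inl zero_le_one),
      hausdorffMeasure_real]
    simp

/-- The part of the line through `a` and `b` that lies outside of the segment, together with the
two terminal points. -/
def rays (a b : Plane) : Set Plane :=
  (fun t : ℝ => a + t • dir a b) '' (Set.Iic 0 ∪ Set.Ici ‖b - a‖)

lemma isClosed_rays {a b : Plane} (hab : a ≠ b) : IsClosed (rays a b) :=
  (isometry_line a (norm_dir hab)).isClosedEmbedding.isClosedMap _ (isClosed_Iic.union isClosed_Ici)

lemma mem_pair_of_mem_segment_of_mem_rays {a b : Plane} (hab : a ≠ b) {x : Plane}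
    (hs : x ∈ segment ℝ a b) (hr : x ∈ rays a b) : x = a ∨ x = b := by
  have hpos : 0 < ‖b - a‖ := norm_pos_iff.2 (sub_ne_zero.2 hab.symm)
  rw [segment_eq_image_line hab] at hs
  obtain ⟨t, ⟨h0, h1⟩, rfl⟩ := hs
  obtain ⟨t', ht', he⟩ := hr
  have : t' = t := (isometry_line a (norm_dir hab)).injective he
  subst this
  rcases ht' with ht' | ht'
  · left
    have : t' = 0 := le_antisymm ht' h0
    simp [this]
  · right
    have : t' = ‖b - a‖ := le_antisymm h1 ht'
    simp only [this, dir, smul_smul]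
    rw [mul_inv_cancel₀ hpos.ne', one_smul, add_sub_cancel]

/-- A half plane bounded by a line jumps along a segment of that line, up to the rest of the
line. -/
lemma setIntegral_halfPlane_pderiv_segment {a b : Plane} (hab : a ≠ b) {φ : Plane → ℝ}
    (hφ : IsTest (rays a b)ᶜ φ) (j : Fin 2) :
    ∫ x in halfPlane a (dir a b), pderiv j φ x =
      -(rot (dir a b) j * ∫ x in segment ℝ a b, φ x ∂(μH[1])) := by
  rw [setIntegral_halfPlane_pderiv a (norm_dir hab) (hφ.mono (Set.subset_univ _)),
    setIntegral_segment hab]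
  congr 2
  refine (setIntegral_eq_integral_of_forall_compl_eq_zero fun t ht => ?_).symm
  refine image_eq_zero_of_notMem_tsupport fun hc => hφ.support hc ⟨t, ?_, rfl⟩
  by_contra h
  simp only [Set.mem_union, Set.mem_Iic, Set.mem_Ici, not_or, not_le] at h
  exact ht ⟨h.1.le, h.2.le⟩

/-! ### The primitive of the square root of the potential -/

/-- The primitive of `√W` that vanishes at the origin. -/
def primitive (W : ℝ → ℝ) (t : ℝ) : ℝ := ∫ s in (0:ℝ)..t, √(W s)

lemma primitive_zero (W : ℝ → ℝ) : primitive W 0 = 0 := intervalIntegral.integral_same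

namespace IsPotential

lemma continuous_sqrt {W : ℝ → ℝ} (hW : IsPotential W) : Continuous fun t => √(W t) :=
  Real.continuous_sqrt.comp hW.smooth.continuous

lemma exists_le {W : ℝ → ℝ} (hW : IsPotential W) : ∃ L, ∀ t, W t ≤ L := by
  obtain ⟨L, hL⟩ := (hW.periodic.compact_of_continuous one_ne_zero hW.smooth.continuous).bddAbove
  exact ⟨L, fun t => hL ⟨t, rfl⟩⟩

lemma hasDerivAt_primitive {W : ℝ → ℝ} (hW : IsPotential W) (t : ℝ) : HasDerivAt (primitive W) (√(W t)) t :=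
  (hW.continuous_sqrt).integral_hasStrictDerivAt 0 t |>.hasDerivAt

lemma deriv_primitive {W : ℝ → ℝ} (hW : IsPotential W) : deriv (primitive W) = fun t => √(W t) :=
  funext fun t => (hW.hasDerivAt_primitive t).deriv

lemma contDiff_primitive {W : ℝ → ℝ} (hW : IsPotential W) : ContDiff ℝ 1 (primitive W) := by
  rw [contDiff_one_iff_deriv, hW.deriv_primitive]
  exact ⟨fun t => (hW.hasDerivAt_primitive t).differentiableAt, hW.continuous_sqrt⟩

lemma exists_abs_deriv_primitive_le {W : ℝ → ℝ} (hW : IsPotential W) : ∃ L, ∀ t, |deriv (primitive W) t| ≤ L := by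
  obtain ⟨L, hL⟩ := hW.exists_le
  refine ⟨√L, fun t => ?_⟩
  rw [hW.deriv_primitive, abs_of_nonneg (Real.sqrt_nonneg _)]
  exact Real.sqrt_le_sqrt (hL t)

lemma primitive_sub {W : ℝ → ℝ} (hW : IsPotential W) (s t : ℝ) : primitive W t - primitive W s = ∫ x in s..t, √(W x) :=
  intervalIntegral.integral_interval_sub_left (hW.continuous_sqrt.intervalIntegrable _ _)
    (hW.continuous_sqrt.intervalIntegrable _ _)

/-- Periodicity of `√W`. This is why a unit jump of `u` becomes a jump of constant height of the
primitive, whatever the values of `u`. -/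
lemma primitive_add_one {W : ℝ → ℝ} (hW : IsPotential W) (t : ℝ) : primitive W (t + 1) = primitive W t + primitive W 1 := by
  have hper : Function.Periodic (fun t => √(W t)) 1 := fun t => by
    simp only [hW.periodic t]
  have h := hper.intervalIntegral_add_eq t 0
  rw [zero_add, ← hW.primitive_sub] at h
  rw [← sub_eq_iff_eq_add', h]; rfl

lemma primitive_add_nat {W : ℝ → ℝ} (hW : IsPotential W) (t : ℝ) (k : ℕ) :
    primitive W (t + k) = primitive W t + k * primitive W 1 := by
  induction k with
  | zero => simp
  | succ k ih => push_cast; rw [← add_assoc, hW.primitive_add_one, ih]; ring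

lemma primitive_int {W : ℝ → ℝ} (hW : IsPotential W) (k : ℤ) : primitive W k = k * primitive W 1 := by
  obtain ⟨n, rfl | rfl⟩ := k.eq_nat_or_neg
  · simpa [primitive_zero] using hW.primitive_add_nat 0 n
  · have := hW.primitive_add_nat (-n) n
    rw [neg_add_cancel, primitive_zero] at this
    push_cast
    linarith

/-- The integrand vanishes only at integers, and every nondegenerate interval contains an irrational
number. -/
lemma strictMono_primitive {W : ℝ → ℝ} (hW : IsPotential W) : StrictMono (primitive W) := by
  intro s t hst
  rw [← sub_pos, hW.primitive_sub]
  obtain ⟨r, hr, hsr, hrt⟩ := exists_irrational_btwn hst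
  refine intervalIntegral.integral_pos hst hW.continuous_sqrt.continuousOn
    (fun x _ => Real.sqrt_nonneg _) ⟨r, ⟨hsr.le, hrt.le⟩, Real.sqrt_pos.2 ?_⟩
  refine lt_of_le_of_ne (hW.nonneg r) fun h => ?_
  obtain ⟨k, hk⟩ := (hW.zero_iff r).1 h.symm
  exact hr ⟨k, by simp [hk]⟩

lemma primitive_one_pos {W : ℝ → ℝ} (hW : IsPotential W) : 0 < primitive W 1 := by
  have := hW.strictMono_primitive zero_lt_one
  rwa [primitive_zero] at this

/-- The inverse of the primitive has a linear modulus of continuity at each positive scale. -/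
lemma exists_abs_sub_le {W : ℝ → ℝ} (hW : IsPotential W) {η : ℝ} (hη : 0 < η) :
    ∃ C, 0 ≤ C ∧ ∀ s t, |s - t| ≤ η + C * |primitive W s - primitive W t| := by
  -- The increment over a step of length `η` is continuous, periodic and positive, so it has a
  -- positive minimum `g s₀`. The number of full steps between two points is then at most the
  -- increment of the primitive divided by `g s₀`; the incomplete step accounts for the additive
  -- `η`.
  set g : ℝ → ℝ := fun s => primitive W (s + η) - primitive W s with hg
  have hc := hW.contDiff_primitive.continuous
  have hgc : Continuous g := (hc.comp (continuous_id.add continuous_const)).sub hc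
  have hgp : Function.Periodic g 1 := fun s => by
    simp only [hg]
    rw [add_right_comm, hW.primitive_add_one, hW.primitive_add_one]; ring
  obtain ⟨s₀, -, hs₀⟩ := isCompact_Icc.exists_isMinOn (Set.nonempty_Icc.2 zero_le_one)
    (hgc.continuousOn (s := Set.Icc 0 1))
  have hmin : ∀ s, g s₀ ≤ g s := fun s => by
    obtain ⟨s', hs', he⟩ := hgp.exists_mem_Ico₀ one_pos s
    rw [he]
    exact hs₀ ⟨hs'.1, hs'.2.le⟩
  have hm : 0 < g s₀ := sub_pos.2 (hW.strictMono_primitive (lt_add_of_pos_right _ hη))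
  have hk : ∀ (k : ℕ) s, k * g s₀ ≤ primitive W (s + k * η) - primitive W s := fun k s => by
    induction k with
    | zero => simp
    | succ k ih =>
      have := hmin (s + k * η)
      simp only [hg] at this ih ⊢
      push_cast
      rw [show s + (k + 1 : ℝ) * η = s + k * η + η by ring]
      linarith
  have main : ∀ s t, s ≤ t → t - s ≤ η + η / g s₀ * (primitive W t - primitive W s) := by
    intro s t hst
    have h0 : 0 ≤ (t - s) / η := div_nonneg (sub_nonneg.2 hst) hη.le
    have h1 := Nat.floor_le h0
    have h2 := (Nat.lt_floor_add_one ((t - s) / η)).le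
    rw [le_div_iff₀ hη] at h1
    rw [div_le_iff₀ hη] at h2
    have h3 := hk ⌊(t - s) / η⌋₊ s
    have h4 := hW.strictMono_primitive.monotone
      (show s + ⌊(t - s) / η⌋₊ * η ≤ t by linarith)
    have h5 : (⌊(t - s) / η⌋₊ : ℝ) ≤ (primitive W t - primitive W s) / g s₀ := by
      rw [le_div_iff₀ hm]; linarith
    have h6 := mul_le_mul_of_nonneg_right h5 hη.le
    rw [show η / g s₀ * (primitive W t - primitive W s) =
      (primitive W t - primitive W s) / g s₀ * η by ring]
    linarith
  refine ⟨η / g s₀, by positivity, fun s t => ?_⟩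
  rcases le_total s t with h | h
  · rw [abs_sub_comm, abs_of_nonneg (sub_nonneg.2 h), abs_sub_comm,
      abs_of_nonneg (sub_nonneg.2 (hW.strictMono_primitive.monotone h))]
    exact main s t h
  · rw [abs_of_nonneg (sub_nonneg.2 h),
      abs_of_nonneg (sub_nonneg.2 (hW.strictMono_primitive.monotone h))]
    exact main t s h

lemma exists_continuous_rightInverse {W : ℝ → ℝ} (hW : IsPotential W) :
    ∃ g : ℝ → ℝ, Continuous g ∧ ∀ y, primitive W (g y) = y := by
  have hs : Function.Surjective (primitive W) := fun y => by
    have h1 := hW.primitive_one_pos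
    obtain ⟨k, hk⟩ := exists_nat_ge (|y| / primitive W 1)
    rw [div_le_iff₀ h1] at hk
    refine mem_range_of_exists_le_of_exists_ge hW.contDiff_primitive.continuous
      ⟨((-k : ℤ) : ℝ), ?_⟩ ⟨((k : ℤ) : ℝ), ?_⟩
    · rw [hW.primitive_int]; push_cast; linarith [neg_abs_le y]
    · rw [hW.primitive_int]; push_cast; linarith [le_abs_self y]
  let e := hW.strictMono_primitive.orderIsoOfSurjective _ hs
  exact ⟨e.symm, e.symm.continuous, fun y => e.apply_symm_apply y⟩

end IsPotential

/-! ### Weak gradients off the jump set and near the jump set -/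

lemma volume_Om_lt_top : volume Om < ⊤ := measure_ball_lt_top

lemma measurableSet_Om : MeasurableSet Om := measurableSet_ball

lemma isFiniteMeasure_restrict {D : Set Plane} (hD : D ⊆ Om) :
    IsFiniteMeasure (volume.restrict D) :=
  ⟨by rw [Measure.restrict_apply_univ]; exact (measure_mono hD).trans_lt volume_Om_lt_top⟩

lemma IsTest.eq_zero {D : Set Plane} {φ : Plane → ℝ} (h : IsTest D φ) {x : Plane} (hx : x ∉ D) :
    φ x = 0 := image_eq_zero_of_notMem_tsupport fun hc => hx (h.support hc)

lemma IsTest.pderiv_eq_zero {D : Set Plane} {φ : Plane → ℝ} (h : IsTest D φ) (j : Fin 2)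
    {x : Plane} (hx : x ∉ D) : pderiv j φ x = 0 :=
  image_eq_zero_of_notMem_tsupport fun hc => hx (h.support (tsupport_pderiv_subset j φ hc))

lemma segmentMeasure_eq {a b : Plane} (φ : Plane → ℝ) :
    segmentMeasure a b φ = (∫ x in segment ℝ a b, φ x ∂(μH[1])) • dir a b :=
  integral_smul_const _ _

namespace IsRotDensity

variable {D : Set Plane} {a b : Plane} {u : Plane → ℝ} {p : Plane → Plane}

lemma integrableOn (hD : D ⊆ Om) (hp : IsRotDensity D a b u p) : IntegrableOn p D :=
  have := isFiniteMeasure_restrict hD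
  hp.1.integrable one_le_two

lemma integrableOn_rot (hD : D ⊆ Om) (hp : IsRotDensity D a b u p) (j : Fin 2) :
    IntegrableOn (fun x => rot (p x) j) D := by
  have h := hp.integrableOn hD
  fin_cases j
  · exact (EuclideanSpace.proj (𝕜 := ℝ) (1 : Fin 2)).integrable_comp h
  · exact ((EuclideanSpace.proj (𝕜 := ℝ) (0 : Fin 2)).integrable_comp h).neg

/-- The distributional gradient of `u` is `rot p` plus the prescribed jump. -/
lemma integral_pderiv (hD : D ⊆ Om) (hp : IsRotDensity D a b u p) {φ : Plane → ℝ}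
    (hφ : IsTest D φ) (j : Fin 2) :
    ∫ x in D, u x * pderiv j φ x = -(∫ x in D, φ x * rot (p x) j)
      - rot (dir a b) j * ∫ x in segment ℝ a b, φ x ∂(μH[1]) := by
  obtain ⟨C, -, hC⟩ := exists_bound hφ.smooth.continuous hφ.compact
  have hi : Integrable (fun x => φ x • p x) (volume.restrict D) :=
    (hp.integrableOn hD).bdd_smul C hφ.smooth.continuous.aestronglyMeasurable
      (Eventually.of_forall hC)
  have h := hp.2 φ hφ
  rw [segmentMeasure_eq] at h
  have hc : ∀ i : Fin 2, (∫ x in D, φ x • p x) i = ∫ x in D, φ x * p x i := fun i => by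
    have := (EuclideanSpace.proj (𝕜 := ℝ) i).integral_comp_comm hi
    simpa using this.symm
  fin_cases j
  · have h1 := congrArg (fun z : Plane => z 1) h
    simp only [rotGrad, PiLp.sub_apply, PiLp.smul_apply, hc, smul_eq_mul] at h1
    simp at h1 ⊢
    linarith
  · have h1 := congrArg (fun z : Plane => z 0) h
    simp only [rotGrad, PiLp.sub_apply, PiLp.smul_apply, hc, smul_eq_mul] at h1
    simp [integral_neg] at h1 ⊢
    linarith

end IsRotDensity

/-- Off the prescribed jump, and up to `∂Ω`, the gradient of `u`, extended by zero, is `rot p`. -/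
lemma integral_indicator_mul_pderiv_off_segment {T : Set Plane} (hT : IsClosed T) {a b : Plane}
    {u : Plane → ℝ} {p g : Plane → Plane} (hp : IsRotDensity (Om \ T) a b u p)
    (hg : IntegrableOn g ((Om \ T) \ segment ℝ a b))
    (hug : ∀ φ, IsTest (T ∪ segment ℝ a b)ᶜ φ → ∀ j : Fin 2,
      ∫ x in (Om \ T) \ segment ℝ a b, u x * pderiv j φ x =
        -∫ x in (Om \ T) \ segment ℝ a b, g x j * φ x)
    {φ : Plane → ℝ} (hφ : IsTest (T ∪ segment ℝ a b)ᶜ φ) (j : Fin 2) :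
    ∫ x, (Om \ T).indicator u x * pderiv j φ x =
      -∫ x, φ x * (Om \ T).indicator (fun x => rot (p x) j) x := by
  set D := Om \ T with hD
  set S := segment ℝ a b with hS
  have hSc : IsClosed S := (isCompact_segment a b).isClosed
  have hDo : IsOpen D := Metric.isOpen_ball.sdiff hT
  have hDm := hDo.measurableSet
  have hDO : D ⊆ Om := Set.sdiff_subset
  have hUo : IsOpen (D \ S) := hDo.sdiff hSc
  have hgj : IntegrableOn (fun x => g x j) (D \ S) :=
    (EuclideanSpace.proj (𝕜 := ℝ) j).integrable_comp hg
  have hqj : IntegrableOn (fun x => rot (p x) j) (D \ S) :=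
    (hp.integrableOn_rot hDO j).mono_set Set.sdiff_subset
  have hres : ∀ f : Plane → ℝ, (∀ x ∈ S, f x = 0) → ∫ x in D \ S, f x = ∫ x in D, f x := by
    intro f hf
    refine (setIntegral_eq_of_subset_of_forall_sdiff_eq_zero hDm Set.sdiff_subset
      fun x hx => hf x ?_).symm
    by_contra h
    exact hx.2 ⟨hx.1, h⟩
  -- Off the segment, `g` and `rot p` both represent the distributional gradient of `u`, so they
  -- agree almost everywhere.
  have hae : ∀ᵐ x, x ∈ D \ S → rot (p x) j - g x j = 0 := by
    refine hUo.ae_eq_zero_of_integral_contDiff_smul_eq_zero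
      ((hqj.sub hgj).locallyIntegrableOn) fun ψ h1 h2 h3 => ?_
    have hψ : IsTest (D \ S) ψ := ⟨h1, h2, h3⟩
    have hψD : IsTest D ψ := hψ.mono Set.sdiff_subset
    have hψU : IsTest (T ∪ S)ᶜ ψ := hψ.mono fun x hx => by
      rintro (h | h)
      · exact hx.1.2 h
      · exact hx.2 h
    have e1 := hp.integral_pderiv hDO hψD j
    have e2 := hug ψ hψU j
    have hS0 : ∀ x ∈ S, ψ x = 0 := fun x hx => hψ.eq_zero fun h => h.2 hx
    rw [setIntegral_eq_zero_of_forall_eq_zero hS0, mul_zero, sub_zero] at e1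
    rw [hres _ fun x hx => by rw [hψ.pderiv_eq_zero j fun h => h.2 hx, mul_zero], e1, neg_inj] at e2
    rw [← hres _ fun x hx => by rw [hS0 x hx, zero_mul]] at e2
    obtain ⟨C, -, hC⟩ := exists_bound h1.continuous h2
    have i1 : IntegrableOn (fun x => ψ x * rot (p x) j) (D \ S) :=
      hqj.bdd_mul h1.continuous.aestronglyMeasurable (Eventually.of_forall hC)
    have i2 : IntegrableOn (fun x => g x j * ψ x) (D \ S) :=
      hgj.mul_bdd h1.continuous.aestronglyMeasurable (Eventually.of_forall hC)
    rw [← setIntegral_eq_integral_of_forall_compl_eq_zero (s := D \ S) fun x hx => by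
      rw [hψ.eq_zero hx, zero_smul]]
    rw [← sub_eq_zero, ← integral_sub i1 i2] at e2
    rw [← e2]
    refine integral_congr_ae (Eventually.of_forall fun x => ?_)
    simp only [smul_eq_mul]; ring
  -- Here `φ` need not vanish on `∂Ω`. The formula for `g` holds for such `φ`, and the
  -- identification with `rot p` transfers it.
  rw [integral_indicator_mul_pderiv hDm, ← hres _ fun x hx => by
    rw [hφ.pderiv_eq_zero j fun h => h (Or.inr hx), mul_zero], hug φ hφ j, neg_inj]
  have : ∀ x, φ x * D.indicator (fun x => rot (p x) j) x =
      D.indicator (fun x => φ x * rot (p x) j) x := fun x => by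
    by_cases hx : x ∈ D <;> simp [hx]
  simp_rw [this]
  rw [MeasureTheory.integral_indicator hDm, ← hres _ fun x hx => by
    rw [hφ.eq_zero fun h => h (Or.inr hx), zero_mul]]
  refine integral_congr_ae ((ae_restrict_iff' hUo.measurableSet).2 ?_)
  filter_upwards [hae] with x hx hxU
  rw [sub_eq_zero.1 (hx hxU), mul_comm]

/-- Near the prescribed jump, the gradient of `u` minus the indicator function of a half plane is
`rot p`. -/
lemma integral_indicator_sub_mul_pderiv {T : Set Plane} (hT : IsClosed T) {a b : Plane}
    (hab : a ≠ b) {u : Plane → ℝ} (hu : IntegrableOn u (Om \ T)) {p : Plane → Plane}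
    (hp : IsRotDensity (Om \ T) a b u p) {φ : Plane → ℝ} (hφ : IsTest ((Om \ T) \ rays a b) φ)
    (j : Fin 2) :
    ∫ x, (Om \ T).indicator (fun x => u x - (halfPlane a (dir a b)).indicator 1 x) x * pderiv j φ x =
      -∫ x, φ x * (Om \ T).indicator (fun x => rot (p x) j) x := by
  set D := Om \ T with hD
  have hDm : MeasurableSet D := (Metric.isOpen_ball.sdiff hT).measurableSet
  have hDO : D ⊆ Om := Set.sdiff_subset
  have hφD : IsTest D φ := hφ.mono Set.sdiff_subset
  have hHm := measurableSet_halfPlane a (dir a b)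
  obtain ⟨C, -, hC⟩ := exists_bound (hφ.continuous_pderiv j) (hφ.hasCompactSupport_pderiv j)
  have i1 : IntegrableOn (fun x => u x * pderiv j φ x) D :=
    hu.mul_bdd (hφ.continuous_pderiv j).aestronglyMeasurable (Eventually.of_forall hC)
  have hpi : Integrable (pderiv j φ) :=
    (hφ.continuous_pderiv j).integrable_of_hasCompactSupport (hφ.hasCompactSupport_pderiv j)
  have e : ∀ x, (halfPlane a (dir a b)).indicator 1 x * pderiv j φ x =
      (halfPlane a (dir a b)).indicator (pderiv j φ) x := fun x => by
    by_cases hx : x ∈ halfPlane a (dir a b) <;> simp [hx]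
  rw [integral_indicator_mul_pderiv hDm]
  simp_rw [sub_mul, e]
  -- The prescribed jump of `u` and that of the half plane are the same measure where `φ` is
  -- supported, so they cancel.
  rw [integral_sub i1 (hpi.indicator hHm).integrableOn, hp.integral_pderiv hDO hφD j,
    setIntegral_eq_integral_of_forall_compl_eq_zero (s := D)
      (f := (halfPlane a (dir a b)).indicator (pderiv j φ)) fun x hx => by
        by_cases hxH : x ∈ halfPlane a (dir a b) <;> simp [hxH, hφD.pderiv_eq_zero j hx],
    MeasureTheory.integral_indicator hHm,
    setIntegral_halfPlane_pderiv_segment hab (hφ.mono fun x hx => hx.2)]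
  have : ∀ x, φ x * D.indicator (fun x => rot (p x) j) x =
      D.indicator (fun x => φ x * rot (p x) j) x := fun x => by
    by_cases hx : x ∈ D <;> simp [hx]
  simp_rw [this]
  rw [MeasureTheory.integral_indicator hDm]
  ring

/-- The gradient of `Φ(u)`, where `Φ` is the primitive of `√W`, and `u` is extended by zero. -/
lemma integral_primitive_mul_pderiv {W : ℝ → ℝ} (hW : IsPotential W) {T : Set Plane}
    (hT : IsClosed T) {a b : Plane} (hab : a ≠ b) (ha : a ∈ T) (hb : b ∈ T)
    (hs : segment ℝ a b ⊆ Om) {u : Plane → ℝ} (hu : IntegrableOn u (Om \ T)) {p g : Plane → Plane}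
    (hp : IsRotDensity (Om \ T) a b u p)
    (hg : IntegrableOn g ((Om \ T) \ segment ℝ a b))
    (hug : ∀ φ, IsTest (T ∪ segment ℝ a b)ᶜ φ → ∀ j : Fin 2,
      ∫ x in (Om \ T) \ segment ℝ a b, u x * pderiv j φ x =
        -∫ x in (Om \ T) \ segment ℝ a b, g x j * φ x)
    {φ : Plane → ℝ} (hφ : IsTest Tᶜ φ) (j : Fin 2) :
    ∫ x, primitive W ((Om \ T).indicator u x) * pderiv j φ x =
      -(∫ x, φ x * (Om \ T).indicator (fun x => √(W (u x)) * rot (p x) j) x)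
        - primitive W 1 * (rot (dir a b) j * ∫ x in segment ℝ a b, φ x ∂(μH[1])) := by
  set D := Om \ T with hD
  set S := segment ℝ a b with hS
  have hSk : IsCompact S := isCompact_segment a b
  have hDo : IsOpen D := Metric.isOpen_ball.sdiff hT
  have hDm := hDo.measurableSet
  have hDO : D ⊆ Om := Set.sdiff_subset
  set χ : Plane → ℝ := (halfPlane a (dir a b)).indicator 1 with hχ
  have hχ01 : ∀ x, χ x = 0 ∨ χ x = 1 := fun x => by
    by_cases hx : x ∈ halfPlane a (dir a b)
    · right; simp [hχ, hx]
    · left; simp [hχ, hx]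
  have hHm := measurableSet_halfPlane a (dir a b)
  have hfin := isFiniteMeasure_restrict hDO
  have hχi : IntegrableOn χ D := (integrable_const (1:ℝ)).indicator hHm
  obtain ⟨L, hL⟩ := hW.exists_abs_deriv_primitive_le
  have hΦ := hW.contDiff_primitive
  set q : Plane → ℝ := D.indicator fun x => rot (p x) j with hq
  have hqi : Integrable q := (integrable_indicator_iff hDm).2 (hp.integrableOn_rot hDO j)
  have hui : Integrable (D.indicator u) := (integrable_indicator_iff hDm).2 hu
  have hwi : Integrable (D.indicator fun x => u x - χ x) :=
    (integrable_indicator_iff hDm).2 (hu.sub hχi)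
  set Q : Plane → ℝ := D.indicator fun x => √(W (u x)) * rot (p x) j with hQ
  -- away from the segment
  have off : ∀ ψ, IsTest (T ∪ S)ᶜ ψ →
      ∫ x, primitive W (D.indicator u x) * pderiv j ψ x = -∫ x, ψ x * Q x := fun ψ hψ => by
    rw [integral_comp_mul_pderiv (hT.union hSk.isClosed).isOpen_compl hui hqi
      (fun φ hφ => integral_indicator_mul_pderiv_off_segment hT hp hg hug hφ j) hΦ hL hψ,
      hW.deriv_primitive]
    congr 1
    refine integral_congr_ae (Eventually.of_forall fun x => ?_)
    by_cases hx : x ∈ D <;> simp [hQ, hq, hx]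
  -- near the segment
  have hRo : IsOpen (D \ rays a b) := hDo.sdiff (isClosed_rays hab)
  have near : ∀ ψ, IsTest (D \ rays a b) ψ →
      ∫ x, primitive W (D.indicator u x) * pderiv j ψ x = -(∫ x, ψ x * Q x)
        - primitive W 1 * (rot (dir a b) j * ∫ x in S, ψ x ∂(μH[1])) := fun ψ hψ => by
    have h1 := integral_comp_mul_pderiv hRo hwi hqi
      (fun φ hφ => integral_indicator_sub_mul_pderiv hT hab hu hp hφ j) hΦ hL hψ
    rw [hW.deriv_primitive] at h1
    -- Near the segment the chain rule is applied to `u - χ`, which has no jump. Undoing the shift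
    -- adds the constant `primitive W 1` on the half plane and, by periodicity, does not change
    -- `√W`.
    have hsub : ∀ t, primitive W (t - 1) = primitive W t - primitive W 1 := fun t => by
      have := hW.primitive_add_one (t - 1)
      rw [sub_add_cancel] at this
      linarith
    have hWs : ∀ t, W (t - 1) = W t := fun t => by
      have := hW.periodic (t - 1)
      rw [sub_add_cancel] at this
      exact this.symm
    have e1 : ∀ x, primitive W (D.indicator u x) * pderiv j ψ x =
        primitive W (D.indicator (fun x => u x - χ x) x) * pderiv j ψ x +
          primitive W 1 * (halfPlane a (dir a b)).indicator (pderiv j ψ) x := fun x => by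
      by_cases hx : x ∈ D
      · by_cases hxH : x ∈ halfPlane a (dir a b)
        · simp [hx, hxH, hχ, hsub]; ring
        · simp [hx, hxH, hχ]
      · have : pderiv j ψ x = 0 := hψ.pderiv_eq_zero j fun h => hx h.1
        by_cases hxH : x ∈ halfPlane a (dir a b) <;> simp [hxH, this]
    have e2 : ∀ x, ψ x * (√(W (D.indicator (fun x => u x - χ x) x)) * q x) = ψ x * Q x := fun x => by
      by_cases hx : x ∈ D
      · simp only [hQ, hq, Set.indicator_of_mem hx]
        rcases hχ01 x with h | h
        · rw [h, sub_zero]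
        · rw [h, hWs]
      · simp [hQ, hq, hx]
    simp_rw [e2] at h1
    have hpi : Integrable (pderiv j ψ) :=
      (hψ.continuous_pderiv j).integrable_of_hasCompactSupport (hψ.hasCompactSupport_pderiv j)
    simp_rw [e1]
    rw [integral_add (integrable_comp_mul hwi (hψ.continuous_pderiv j) (hψ.hasCompactSupport_pderiv j)
      hΦ.continuous (abs_sub_le_of_deriv_le hΦ hL)) ((hpi.indicator hHm).const_mul _),
      integral_const_mul, MeasureTheory.integral_indicator hHm, h1,
      setIntegral_halfPlane_pderiv_segment hab (hψ.mono fun x hx => hx.2)]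
    ring
  -- partition of unity
  have hK : IsCompact (tsupport φ ∩ S) := hSk.inter_left (isClosed_tsupport φ)
  -- The segment meets the remaining rays of its line only at `a` and `b`; these lie in `T`, hence
  -- outside the support of `φ`.
  obtain ⟨θ, hθ, -, hθ1⟩ := exists_cutoff hK hRo fun x hx => by
    refine ⟨⟨hs hx.2, hφ.support hx.1⟩, fun hr => ?_⟩
    rcases mem_pair_of_mem_segment_of_mem_rays hab hx.2 hr with rfl | rfl
    · exact hφ.support hx.1 ha
    · exact hφ.support hx.1 hb
  have hn : IsTest (D \ rays a b) fun x => φ x * θ x := hθ.mul_left hφ.smooth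
  have ho : IsTest (T ∪ S)ᶜ fun x => (1 - θ x) * φ x := by
    have h1 := hφ.mul_left (g := fun x => 1 - θ x) (contDiff_const.sub hθ.smooth)
    refine ⟨h1.smooth, h1.compact, fun x hx => ?_⟩
    rintro (h | h)
    · exact h1.support hx h
    · have hxφ : x ∈ tsupport φ := tsupport_mul_subset_right hx
      have hev : ∀ᶠ y in 𝓝 x, θ y = 1 := hθ1.filter_mono (nhds_le_nhdsSet (show x ∈ tsupport φ ∩ S from ⟨hxφ, h⟩))
      exact absurd hx (notMem_tsupport_iff_eventuallyEq.2 (hev.mono fun y hy => by simp [hy]))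
  have hsum : ∀ x, φ x = φ x * θ x + (1 - θ x) * φ x := fun x => by ring
  have hpd : ∀ x, pderiv j φ x = pderiv j (fun x => φ x * θ x) x +
      pderiv j (fun x => (1 - θ x) * φ x) x := fun x => by
    rw [← pderiv_add j hn.differentiable ho.differentiable]
    congr 1
    exact funext hsum
  have hQi : Integrable fun x => φ x * Q x := by
    obtain ⟨C, hC0, hC⟩ := exists_bound hφ.smooth.continuous hφ.compact
    have h1 : Integrable fun x => deriv (primitive W) (D.indicator u x) * q x :=
      hqi.bdd_mul (hΦ.continuous_deriv_one.comp_aestronglyMeasurable hui.1)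
        (Eventually.of_forall fun x => hL _)
    have h2 : Q = fun x => deriv (primitive W) (D.indicator u x) * q x := funext fun x => by
      rw [hW.deriv_primitive]
      by_cases hx : x ∈ D <;> simp [hQ, hq, hx]
    rw [h2]
    exact h1.bdd_mul hφ.smooth.continuous.aestronglyMeasurable (Eventually.of_forall hC)
  have hcomp : ∀ ψ : Plane → ℝ, Continuous ψ → HasCompactSupport ψ →
      Integrable fun x => primitive W (D.indicator u x) * ψ x := fun ψ h1 h2 =>
    integrable_comp_mul hui h1 h2 hΦ.continuous (abs_sub_le_of_deriv_le hΦ hL)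
  simp_rw [hpd, mul_add]
  rw [integral_add (hcomp _ (hn.continuous_pderiv j) (hn.hasCompactSupport_pderiv j))
    (hcomp _ (ho.continuous_pderiv j) (ho.hasCompactSupport_pderiv j)), off _ ho, near _ hn]
  obtain ⟨B, hB0, hB⟩ := exists_bound hθ.smooth.continuous hθ.compact
  have i1 : Integrable fun x => φ x * θ x * Q x := by
    have := hQi.bdd_mul hθ.smooth.continuous.aestronglyMeasurable (Eventually.of_forall hB)
    refine this.congr (Eventually.of_forall fun x => ?_)
    simp only
    ring
  have e3 : ∫ x, φ x * Q x = (∫ x, φ x * θ x * Q x) + ∫ x, (1 - θ x) * φ x * Q x := by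
    rw [← integral_add i1]
    · refine integral_congr_ae (Eventually.of_forall fun x => ?_)
      simp only; ring
    · refine (hQi.sub i1).congr (Eventually.of_forall fun x => ?_)
      simp only [Pi.sub_apply]; ring
  have e4 : ∫ x in S, φ x * θ x ∂(μH[1]) = ∫ x in S, φ x ∂(μH[1]) := by
    refine setIntegral_congr_fun hSk.measurableSet fun x hx => ?_
    by_cases hxφ : x ∈ tsupport φ
    · have : θ x = 1 := subset_of_mem_nhdsSet hθ1 ⟨hxφ, hx⟩
      simp [this]
    · simp [image_eq_zero_of_notMem_tsupport hxφ]
  rw [e3, e4]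
  ring

/-! ### Compactness for one prescribed jump -/

/-- The zero trace enters here: the Gauss-Green boundary term vanishes, so the formula holds for
test functions that do not vanish on `∂Ω`. Two sets are kept because functions may be given on a
larger domain (`E = ∅` for several jumps) than the perforated one. -/
lemma exists_gradient_of_mem_jumpClass {E T s : Set Plane} (hE : MeasurableSet E) (hET : E ⊆ T)
    (hs : MeasurableSet s) {u : Plane → ℝ} (hu : u ∈ jumpClass E s) :
    IntegrableOn u (Om \ T) ∧ ∃ g : Plane → Plane, IntegrableOn g ((Om \ T) \ s) ∧
      ∀ φ, IsTest (T ∪ s)ᶜ φ → ∀ j : Fin 2, ∫ x in (Om \ T) \ s, u x * pderiv j φ x =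
        -∫ x in (Om \ T) \ s, g x j * φ x := by
  obtain ⟨⟨hui, -⟩, g, hg, htr⟩ := hu
  have hsub : Om \ T ⊆ Om \ E := Set.sdiff_subset_sdiff_right hET
  refine ⟨hui.mono_set hsub, g, ?_, fun φ hφ j => ?_⟩
  · have hf := isFiniteMeasure_restrict (D := (Om \ T) \ s)
      (Set.sdiff_subset.trans Set.sdiff_subset)
    exact (hg.memLp_grad.mono_measure (Measure.restrict_mono (Set.sdiff_subset_sdiff_left hsub)
      le_rfl)).integrable one_le_two
  · have hm : MeasurableSet (Om ∩ (E ∪ s)ᶜ) := measurableSet_Om.inter (hE.union hs).compl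
    have hss : (Om \ T) \ s ⊆ Om ∩ (E ∪ s)ᶜ := fun x hx =>
      ⟨hx.1.1, fun h => h.elim (fun h => hx.1.2 (hET h)) hx.2⟩
    have hnot : ∀ x ∈ (Om ∩ (E ∪ s)ᶜ) \ ((Om \ T) \ s), x ∉ (T ∪ s)ᶜ := fun x hx h =>
      hx.2 ⟨⟨hx.1.1, fun hT => h (Or.inl hT)⟩, fun h' => h (Or.inr h')⟩
    have h := htr φ (hφ.mono (Set.compl_subset_compl.2 (Set.union_subset_union_left s hET))) j
    rw [setIntegral_eq_of_subset_of_forall_sdiff_eq_zero hm hss fun x hx => by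
        rw [hφ.pderiv_eq_zero j (hnot x hx), mul_zero],
      setIntegral_eq_of_subset_of_forall_sdiff_eq_zero hm hss fun x hx => by
        rw [hφ.eq_zero (hnot x hx), mul_zero]] at h
    simpa using h

/-! ### Estimates from the energy density. -/

section Energy

variable {W : ℝ → ℝ} {ε : ℝ} {u : Plane → ℝ} {p : Plane → Plane}

lemma density_nonneg (hW : IsPotential W) (hε : 0 < ε) (x : Plane) : 0 ≤ density W ε u p x := by
  have := hW.nonneg (u x)
  unfold density
  positivity

lemma le_mul_density (hε : 0 < ε) (x : Plane) : W (u x) ≤ ε * density W ε u p x := by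
  unfold density
  have : ε * (ε * ‖p x‖ ^ 2 + 1 / ε * W (u x)) = (ε * ‖p x‖) ^ 2 + W (u x) := by
    field_simp
  rw [this]
  exact le_add_of_nonneg_left (sq_nonneg _)

lemma abs_rot_le (p : Plane) (j : Fin 2) : |rot p j| ≤ ‖p‖ := by
  fin_cases j
  · exact PiLp.norm_apply_le p 1
  · simpa using PiLp.norm_apply_le p 0

/-- The Modica-Mortola inequality: the square of `ε |p| - √W` is nonnegative. The factor two that it
gains is discarded. -/
lemma abs_sqrt_mul_rot_le (hW : IsPotential W) (hε : 0 < ε) (j : Fin 2) (x : Plane) :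
    |√(W (u x)) * rot (p x) j| ≤ density W ε u p x := by
  have h0 := Real.sqrt_nonneg (W (u x))
  have h1 := Real.sq_sqrt (hW.nonneg (u x))
  have hd := density_nonneg hW hε (u := u) (p := p) x
  rw [abs_mul, abs_of_nonneg h0]
  refine (mul_le_mul_of_nonneg_left (abs_rot_le _ j) h0).trans ?_
  have h2 : 2 * (√(W (u x)) * ‖p x‖) ≤ density W ε u p x := by
    have : density W ε u p x - 2 * (√(W (u x)) * ‖p x‖) = (ε * ‖p x‖ - √(W (u x))) ^ 2 / ε := by
      unfold density
      rw [← h1]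
      field_simp
      rw [Real.sqrt_sq h0]
      ring
    have h3 : 0 ≤ (ε * ‖p x‖ - √(W (u x))) ^ 2 / ε := by positivity
    linarith
  have := mul_nonneg h0 (norm_nonneg (p x))
  linarith

lemma aestronglyMeasurable_density (hW : IsPotential W) {μ : Measure Plane}
    (hu : AEStronglyMeasurable u μ) (hp : AEStronglyMeasurable p μ) :
    AEStronglyMeasurable (density W ε u p) μ :=
  ((hp.norm.pow 2).const_mul ε).add
    ((hW.smooth.continuous.comp_aestronglyMeasurable hu).const_mul (1 / ε))

/-- The energy is an infimum over densities; the slack `1` makes the inequality strict and selects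
an actual density. -/
lemma exists_isRotDensity_of_energy_le {D : Set Plane} {a b : Plane} (hW : IsPotential W)
    (hε : 0 < ε) (hu : IntegrableOn u D) {C : ℝ≥0} (h : energy W ε D a b u ≤ C) :
    ∃ p, IsRotDensity D a b u p ∧ IntegrableOn (density W ε u p) D ∧
      ∫ x in D, density W ε u p x ≤ C + 1 := by
  have hlt : energy W ε D a b u < (C + 1 : ℝ≥0) :=
    h.trans_lt (by exact_mod_cast lt_add_one C)
  simp only [energy, iInf_lt_iff] at hlt
  obtain ⟨p, hp, hlt⟩ := hlt
  have hm := aestronglyMeasurable_density (ε := ε) hW hu.1 hp.1.1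
  have h0 : ∀ᵐ x ∂(volume.restrict D), 0 ≤ density W ε u p x :=
    Eventually.of_forall (density_nonneg hW hε)
  refine ⟨p, hp, ⟨hm, ?_⟩, ?_⟩
  · rw [hasFiniteIntegral_iff_ofReal h0]
    exact hlt.trans ENNReal.coe_lt_top
  · rw [integral_eq_lintegral_of_nonneg_ae h0 hm]
    exact ENNReal.toReal_le_coe_of_le_coe hlt.le

end Energy

/-- The inverse of the primitive is not Lipschitz, as the derivative of the primitive vanishes at
the integers. The bound `|s - t| ≤ η + C |Φ(s) - Φ(t)|` is enough because `D` has finite area. -/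
lemma tendsto_setIntegral_abs_sub_of_primitive {W : ℝ → ℝ} (hW : IsPotential W) {D : Set Plane}
    (hD : D ⊆ Om) {g : ℝ → ℝ} (hgc : Continuous g) (hg : ∀ y, primitive W (g y) = y)
    {u : ℕ → Plane → ℝ} (hu : ∀ k, IntegrableOn (u k) D) {v : Plane → ℝ} (hv : IntegrableOn v D)
    (h : Tendsto (fun k => ∫ x in D, |primitive W (u k x) - v x|) atTop (𝓝 0)) :
    IntegrableOn (fun x => g (v x)) D ∧
      Tendsto (fun k => ∫ x in D, |u k x - g (v x)|) atTop (𝓝 0) := by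
  have hfin := isFiniteMeasure_restrict hD
  obtain ⟨L, hL⟩ := hW.exists_abs_deriv_primitive_le
  have hΦL := abs_sub_le_of_deriv_le hW.contDiff_primitive hL
  have hΦi : ∀ k, IntegrableOn (fun x => primitive W (u k x)) D := fun k => by
    refine ((hu k).abs.const_mul L).mono'
      (hW.contDiff_primitive.continuous.comp_aestronglyMeasurable (hu k).1)
      (Eventually.of_forall fun x => ?_)
    simpa [primitive_zero] using hΦL (u k x) 0
  have hgi : IntegrableOn (fun x => g (v x)) D := by
    obtain ⟨C, -, hC⟩ := hW.exists_abs_sub_le one_pos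
    refine ((integrable_const (1:ℝ)).add (hv.abs.const_mul C)).mono'
      (hgc.comp_aestronglyMeasurable hv.1) (Eventually.of_forall fun x => ?_)
    simpa [hg, primitive_zero] using hC (g (v x)) 0
  refine ⟨hgi, ?_⟩
  rw [Metric.tendsto_atTop']
  intro e he
  set V := (volume.restrict D).real Set.univ with hV
  have hV0 : 0 ≤ V := measureReal_nonneg
  obtain ⟨C, hC0, hC⟩ := hW.exists_abs_sub_le (η := e / (2 * (V + 1))) (by positivity)
  have hlim : Tendsto (fun k => C * ∫ x in D, |primitive W (u k x) - v x|) atTop (𝓝 0) := by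
    simpa using h.const_mul C
  obtain ⟨N, hN⟩ := (hlim.eventually (gt_mem_nhds (half_pos he))).exists_forall_of_atTop
  refine ⟨N, fun n hn => ?_⟩
  rw [Real.dist_eq, sub_zero, abs_of_nonneg (integral_nonneg fun x => abs_nonneg _)]
  have hi : IntegrableOn (fun x => |primitive W (u n x) - v x|) D := ((hΦi n).sub hv).abs
  calc ∫ x in D, |u n x - g (v x)|
      ≤ ∫ x in D, (e / (2 * (V + 1)) + C * |primitive W (u n x) - v x|) := by
        refine integral_mono ((hu n).sub hgi).abs ((integrable_const _).add (hi.const_mul C))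
          fun x => ?_
        simpa [hg] using hC (u n x) (g (v x))
    _ = e / (2 * (V + 1)) * V + C * ∫ x in D, |primitive W (u n x) - v x| := by
        rw [integral_add (integrable_const _) (hi.const_mul C), integral_const_mul,
          integral_const, smul_eq_mul, mul_comm V]
    _ < e / 2 + e / 2 := by
        refine add_lt_add_of_le_of_lt ?_ (hN n hn.le)
        rw [div_mul_eq_mul_div, div_le_div_iff₀ (by positivity) two_pos]
        nlinarith
    _ = e := add_halves e

/-- A smooth periodic `W` is Lipschitz, so `∫ W(w) ≤ ∫ W(u k) + L ∫ |u k - w|` tends to zero, and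
`W` vanishes only on the integers. -/
lemma ae_int_of_tendsto {W : ℝ → ℝ} (hW : IsPotential W) {D : Set Plane} (hD : D ⊆ Om)
    {u : ℕ → Plane → ℝ} (hu : ∀ k, IntegrableOn (u k) D) {w : Plane → ℝ} (hw : IntegrableOn w D)
    (h : Tendsto (fun k => ∫ x in D, |u k x - w x|) atTop (𝓝 0))
    (hWu : Tendsto (fun k => ∫ x in D, W (u k x)) atTop (𝓝 0)) :
    ∀ᵐ x ∂(volume.restrict D), ∃ k : ℤ, w x = k := by
  have hfin := isFiniteMeasure_restrict hD
  have hW1 : ContDiff ℝ 1 W := hW.smooth.of_le (by exact_mod_cast le_top)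
  have hdp : Function.Periodic (deriv W) 1 := fun t => by
    rw [← deriv_comp_add_const]
    congr 1
    exact funext fun t => hW.periodic t
  obtain ⟨L, hL⟩ := (hdp.compact_of_continuous one_ne_zero
    hW1.continuous_deriv_one).isBounded.exists_norm_le
  have hWL := abs_sub_le_of_deriv_le hW1 fun t => hL _ ⟨t, rfl⟩
  obtain ⟨B, hB⟩ := hW.exists_le
  have hi : ∀ f : Plane → ℝ, IntegrableOn f D → IntegrableOn (fun x => W (f x)) D := fun f hf =>
    Integrable.of_bound (hW.smooth.continuous.comp_aestronglyMeasurable hf.1) B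
      (Eventually.of_forall fun x => by
        rw [Real.norm_eq_abs, abs_of_nonneg (hW.nonneg _)]; exact hB _)
  have hle : ∫ x in D, W (w x) ≤ 0 := by
    have hlim := hWu.add (h.const_mul L)
    rw [mul_zero, add_zero] at hlim
    refine ge_of_tendsto hlim (Eventually.of_forall fun k => ?_)
    have hk : IntegrableOn (fun x => L * |u k x - w x|) D := ((hu k).sub hw).abs.const_mul L
    rw [← integral_const_mul, ← integral_add (hi _ (hu k)) hk]
    refine integral_mono (hi _ hw) ((hi _ (hu k)).add hk) fun x => ?_
    have := (abs_le.1 (hWL (u k x) (w x))).1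
    simp only
    linarith
  have h0 : 0 ≤ᵐ[volume.restrict D] fun x => W (w x) := Eventually.of_forall fun x => hW.nonneg _
  have := (integral_eq_zero_iff_of_nonneg_ae h0 (hi _ hw)).1
    (le_antisymm hle (integral_nonneg fun x => hW.nonneg _))
  filter_upwards [this] with x hx
  exact (hW.zero_iff _).1 hx

lemma tendsto_integral_mul_of_tendsto {v : ℕ → Plane → ℝ} {v₀ f : Plane → ℝ}
    (hv : ∀ k, Integrable (v k)) (hv₀ : Integrable v₀)
    (h : Tendsto (fun k => ∫ x, |v k x - v₀ x|) atTop (𝓝 0)) (hf : Continuous f)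
    (hfc : HasCompactSupport f) :
    Tendsto (fun k => ∫ x, v k x * f x) atTop (𝓝 (∫ x, v₀ x * f x)) := by
  obtain ⟨B, hB0, hB⟩ := exists_bound hf hfc
  rw [tendsto_iff_dist_tendsto_zero]
  have hlim : Tendsto (fun k => B * ∫ x, |v k x - v₀ x|) atTop (𝓝 0) := by
    simpa using h.const_mul B
  refine squeeze_zero (fun _ => dist_nonneg) (fun k => ?_) hlim
  rw [dist_eq_norm, ← integral_sub (integrable_mul_bdd (hv k) hf hB) (integrable_mul_bdd hv₀ hf hB),
    ← integral_const_mul]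
  refine norm_integral_le_of_norm_le (((hv k).sub hv₀).abs.const_mul B)
    (Eventually.of_forall fun x => ?_)
  rw [← sub_mul, norm_mul, Real.norm_eq_abs, Real.norm_eq_abs, mul_comm]
  exact mul_le_mul_of_nonneg_right (hB x) (abs_nonneg _)

/-- Weak limits of gradients that are, up to a fixed multiple of the length of a segment, bounded
in `L¹`. -/
lemma exists_isGradientMeasure_of_tendsto {D : Set Plane} (hD : MeasurableSet D)
    {S : Set Plane} (hS : μH[1] S < ⊤) {c M : ℝ} (hc : 0 < c) {n : Plane}
    {v : ℕ → Plane → ℝ} {v₀ w : Plane → ℝ} {Q : ℕ → Fin 2 → Plane → ℝ}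
    (hv : ∀ k, Integrable (v k)) (hv₀ : Integrable v₀)
    (hlim : Tendsto (fun k => ∫ x, |v k x - v₀ x|) atTop (𝓝 0))
    (hw : ∀ᵐ x ∂(volume.restrict D), v₀ x = c * w x)
    (hQ : ∀ k j, Integrable (Q k j)) (hQM : ∀ k j, ∫ x, |Q k j x| ≤ M)
    (hQ0 : ∀ k j, ∀ x ∉ Om, Q k j x = 0)
    (hvQ : ∀ k φ, IsTest D φ → ∀ j, ∫ x, v k x * pderiv j φ x =
      -(∫ x, φ x * Q k j x) - c * (n j * ∫ x in S, φ x ∂(μH[1]))) :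
    ∃ (μ : Measure Plane) (σ : Plane → Plane), IsGradientMeasure D w μ σ := by
  set 𝒰 : Ultrafilter ℕ := hyperfilter ℕ
  have h𝒰 : (𝒰 : Filter ℕ) ≤ atTop := Nat.hyperfilter_le_atTop
  have hSf : IsFiniteMeasure ((μH[1] : Measure Plane).restrict S) :=
    ⟨by rwa [Measure.restrict_apply_univ]⟩
  have hsupp : ∀ x ∉ Metric.closedBall (0 : Plane) 10, x ∉ Om := fun x hx h =>
    hx (Metric.ball_subset_closedBall h)
  have hpos : ∀ j, ∃ ν : Measure Plane, IsFiniteMeasure ν ∧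
      ∀ f : Plane → ℝ, Continuous f → HasCompactSupport f →
        Tendsto (fun k => ∫ x, f x * max (Q k j x) 0) 𝒰 (𝓝 (∫ x, f x ∂ν)) := fun j =>
    exists_weak_limit 𝒰 (M := M) (R := 10) (fun k => (hQ k j).pos_part)
      (fun k x => le_max_right _ _)
      (fun k => (integral_mono (hQ k j).pos_part (hQ k j).abs fun x =>
        max_le (le_abs_self _) (abs_nonneg _)).trans (hQM k j))
      fun k x hx => by simp [hQ0 k j x (hsupp x hx)]
  have hneg : ∀ j, ∃ ν : Measure Plane, IsFiniteMeasure ν ∧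
      ∀ f : Plane → ℝ, Continuous f → HasCompactSupport f →
        Tendsto (fun k => ∫ x, f x * max (-Q k j x) 0) 𝒰 (𝓝 (∫ x, f x ∂ν)) := fun j =>
    exists_weak_limit 𝒰 (M := M) (R := 10) (fun k => (hQ k j).neg_part)
      (fun k x => le_max_right _ _)
      (fun k => (integral_mono (hQ k j).neg_part (hQ k j).abs fun x =>
        max_le (neg_le_abs _) (abs_nonneg _)).trans (hQM k j))
      fun k x hx => by simp [hQ0 k j x (hsupp x hx)]
  choose α hα hαl using hpos
  choose β hβ hβl using hneg
  -- Positive and negative parts of `Q k` have weak limits `α` and `β`; dividing by `c` undoes `v₀ =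
  -- c w`. The segment contributes its length measure to one side or the other, according to the
  -- sign of `n j`.
  refine exists_isGradientMeasure hD
    (α := fun j => c⁻¹.toNNReal • α j + (n j).toNNReal • (μH[1] : Measure Plane).restrict S)
    (β := fun j => c⁻¹.toNNReal • β j + (-n j).toNNReal • (μH[1] : Measure Plane).restrict S)
    fun φ hφ j => ?_
  have hφc := hφ.smooth.continuous
  obtain ⟨C, -, hC⟩ := exists_bound hφc hφ.compact
  have hi : ∀ ν : Measure Plane, IsFiniteMeasure ν → Integrable φ ν := fun ν _ =>
    Integrable.of_bound hφc.aestronglyMeasurable C (Eventually.of_forall hC)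
  have h1 : Tendsto (fun k => ∫ x, v k x * pderiv j φ x) 𝒰 (𝓝 (∫ x, v₀ x * pderiv j φ x)) :=
    (tendsto_integral_mul_of_tendsto hv hv₀ hlim (hφ.continuous_pderiv j)
      (hφ.hasCompactSupport_pderiv j)).mono_left h𝒰
  have h2 : Tendsto (fun k => ∫ x, v k x * pderiv j φ x) 𝒰
      (𝓝 (-((∫ x, φ x ∂(α j)) - ∫ x, φ x ∂(β j)) - c * (n j * ∫ x in S, φ x ∂(μH[1])))) := by
    refine ((((hαl j φ hφc hφ.compact).sub (hβl j φ hφc hφ.compact)).neg).sub_const _).congr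
      fun k => ?_
    rw [hvQ k φ hφ j, ← integral_sub ((hQ k j).pos_part.bdd_mul hφc.aestronglyMeasurable
      (Eventually.of_forall hC)) ((hQ k j).neg_part.bdd_mul hφc.aestronglyMeasurable
      (Eventually.of_forall hC))]
    congr 2
    refine integral_congr_ae (Eventually.of_forall fun x => ?_)
    simp only
    rw [← mul_sub, max_zero_sub_eq_self]
  have h3 := tendsto_nhds_unique h1 h2
  have h4 : ∫ x, v₀ x * pderiv j φ x = c * ∫ x in D, w x * pderiv j φ x := by
    rw [← setIntegral_eq_integral_of_forall_compl_eq_zero (s := D) fun x hx => by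
      rw [hφ.pderiv_eq_zero j hx, mul_zero], ← integral_const_mul]
    refine integral_congr_ae ?_
    filter_upwards [hw] with x hx
    rw [hx, mul_assoc]
  rw [h4] at h3
  have hn : ((n j).toNNReal : ℝ) - ((-n j).toNNReal : ℝ) = n j := by
    rw [Real.coe_toNNReal', Real.coe_toNNReal', max_zero_sub_eq_self]
  have hfa := hi (α j) (hα j)
  have hfb := hi (β j) (hβ j)
  have hfS := hi _ hSf
  rw [integral_add_measure (hfa.smul_measure_nnreal) (hfS.smul_measure_nnreal),
    integral_add_measure (hfb.smul_measure_nnreal) (hfS.smul_measure_nnreal),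
    integral_smul_nnreal_measure, integral_smul_nnreal_measure, integral_smul_nnreal_measure,
    integral_smul_nnreal_measure]
  simp only [NNReal.smul_def, smul_eq_mul]
  rw [Real.coe_toNNReal _ (inv_nonneg.2 hc.le)]
  have h5 : ∫ x in D, w x * pderiv j φ x =
      c⁻¹ * (c * ∫ x in D, w x * pderiv j φ x) := by
    rw [← mul_assoc, inv_mul_cancel₀ hc.ne', one_mul]
  rw [h5, h3]
  have h6 : c⁻¹ * c = 1 := inv_mul_cancel₀ hc.ne'
  linear_combination (-(n j * ∫ x in S, φ x ∂(μH[1]))) * h6 -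
    (∫ x in S, φ x ∂(μH[1])) * (-hn)

/-- Compactness for sequences of bounded energy with one prescribed jump. -/
theorem exists_subseq_of_energy_le {W : ℝ → ℝ} (hW : IsPotential W) {A : Finset Plane} {δ : ℝ}
    (hδ : 0 < δ) (hδ1 : δ < 1) (hA : ∀ p ∈ A, ‖p‖ ≤ 1)
    (hsep : ∀ p ∈ A, ∀ q ∈ A, p ≠ q → 2 * δ < dist p q) {a b : Plane} (ha : a ∈ A) (hb : b ∈ A)
    (hab : a ≠ b) {E : Set Plane} (hEm : MeasurableSet E) (hE : E ⊆ holes (A : Set Plane) δ)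
    {ε : ℕ → ℝ} {u : ℕ → Plane → ℝ} {C : ℝ≥0} (hε : ∀ k, 0 < ε k) (hε0 : Tendsto ε atTop (𝓝 0))
    (hu : ∀ k, u k ∈ jumpClass E (segment ℝ a b))
    (hF : ∀ k, energy W (ε k) (OmDelta (A : Set Plane) δ) a b (u k) ≤ C) :
    ∃ (u₀ : Plane → ℝ) (ρ : ℕ → ℕ), StrictMono ρ ∧ MemSBVInt (OmDelta (A : Set Plane) δ) u₀ ∧
      Tendsto (fun k => eLpNorm (fun x => u (ρ k) x - u₀ x) 1
        (volume.restrict (OmDelta (A : Set Plane) δ))) atTop (𝓝 0) := by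
  set T := holes (A : Set Plane) δ with hT
  have hTc : IsClosed T := isClosed_holes A δ
  set D := Om \ T with hD
  have hOD : OmDelta (A : Set Plane) δ = D := rfl
  rw [hOD] at hF ⊢
  have hDo : IsOpen D := Metric.isOpen_ball.sdiff hTc
  have hDm := hDo.measurableSet
  have hDO : D ⊆ Om := Set.sdiff_subset
  have hfin := isFiniteMeasure_restrict hDO
  set S := segment ℝ a b with hS
  have hSm : MeasurableSet S := (isCompact_segment a b).measurableSet
  have hSO : S ⊆ Om := (convex_ball (0 : Plane) 10).segment_subset
    (by simpa using (hA a ha).trans_lt (by norm_num))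
    (by simpa using (hA b hb).trans_lt (by norm_num))
  have hmemT : ∀ p ∈ A, p ∈ T := fun p hp =>
    Set.mem_biUnion (show p ∈ (A : Set Plane) from hp) (Metric.mem_closedBall_self hδ.le)
  have hjump := fun k => exists_gradient_of_mem_jumpClass hEm hE hSm (hu k)
  have hui : ∀ k, IntegrableOn (u k) D := fun k => (hjump k).1
  choose g hg hug using fun k => (hjump k).2
  choose p hp hdi hdC using fun k => exists_isRotDensity_of_energy_le hW (hε k) (hui k) (hF k)
  set Q : ℕ → Fin 2 → Plane → ℝ := fun k j =>
    D.indicator fun x => √(W (u k x)) * rot (p k x) j with hQ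
  set c := primitive W 1 with hc
  have hc0 : 0 < c := hW.primitive_one_pos
  -- The primitive vanishes at zero, so `v k` vanishes outside the perforated disc.
  set v : ℕ → Plane → ℝ := fun k x => primitive W (D.indicator (u k) x) with hv
  obtain ⟨L, hL⟩ := hW.exists_abs_deriv_primitive_le
  have hΦL := abs_sub_le_of_deriv_le hW.contDiff_primitive hL
  have hvi : ∀ k, Integrable (v k) := fun k => by
    have h1 : Integrable (D.indicator (u k)) := (integrable_indicator_iff hDm).2 (hui k)
    refine (h1.abs.const_mul L).mono'
      (hW.contDiff_primitive.continuous.comp_aestronglyMeasurable h1.1)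
      (Eventually.of_forall fun x => ?_)
    simpa [primitive_zero] using hΦL (D.indicator (u k) x) 0
  have hQi : ∀ k j, Integrable (Q k j) := fun k j => by
    refine (integrable_indicator_iff hDm).2 ((hdi k).mono' ?_
      (Eventually.of_forall fun x => abs_sqrt_mul_rot_le hW (hε k) j x))
    exact (hW.continuous_sqrt.comp_aestronglyMeasurable (hui k).1).mul
      ((hp k).integrableOn_rot hDO j).1
  have hQM : ∀ k j, ∫ x, |Q k j x| ≤ C + 1 := fun k j => by
    have e : ∀ x, |Q k j x| = D.indicator (fun x => |√(W (u k x)) * rot (p k x) j|) x := fun x => by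
      by_cases hx : x ∈ D <;> simp [hQ, hx]
    simp_rw [e]
    rw [MeasureTheory.integral_indicator hDm]
    refine (integral_mono_of_nonneg (Eventually.of_forall fun x => abs_nonneg _) (hdi k)
      (Eventually.of_forall fun x => abs_sqrt_mul_rot_le hW (hε k) j x)).trans (hdC k)
  have hgrad : ∀ k φ, IsTest Tᶜ φ → ∀ j, ∫ x, v k x * pderiv j φ x =
      -(∫ x, φ x * Q k j x) - c * (rot (dir a b) j * ∫ x in S, φ x ∂(μH[1])) := fun k φ hφ j =>
    integral_primitive_mul_pderiv hW hTc hab (hmemT a ha) (hmemT b hb) hSO (hui k) (hp k) (hg k)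
      (hug k) hφ j
  have hS1 := hausdorffMeasure_segment_lt_top a b
  have hvar : ∀ k, VarBound Tᶜ (v k) (C + 1 + c * (1 * (μH[1] : Measure Plane).real S)) := by
    intro k φ hφ hφ1 j
    rw [hgrad k φ hφ j]
    refine (abs_sub _ _).trans (add_le_add ?_ ?_)
    · rw [abs_neg, ← Real.norm_eq_abs]
      refine (norm_integral_le_of_norm_le (hQi k j).abs (Eventually.of_forall fun x => ?_)).trans
        (hQM k j)
      rw [norm_mul, Real.norm_eq_abs, Real.norm_eq_abs]
      exact mul_le_of_le_one_left (abs_nonneg _) (hφ1 x)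
    · rw [abs_mul, abs_mul, abs_of_pos hc0]
      have h1 : |rot (dir a b) j| ≤ 1 := (abs_rot_le _ j).trans (norm_dir hab).le
      have h2 : |∫ x in S, φ x ∂(μH[1])| ≤ 1 * (μH[1] : Measure Plane).real S := by
        rw [← Real.norm_eq_abs]
        exact norm_setIntegral_le_of_norm_le_const (f := φ) hS1 fun x _ => hφ1 x
      rw [one_mul] at h2
      gcongr
  obtain ⟨v₀, hv₀, ρ, hρ, hlim⟩ := exists_subseq_tendsto_of_varBound hδ hδ1 hA hsep hvi hvar
    fun k x hx => by
      simp only [hv]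
      rw [Set.indicator_of_notMem (show x ∉ D from hx), primitive_zero]
  obtain ⟨f, hf, hΦf⟩ := hW.exists_continuous_rightInverse
  have hlimD : Tendsto (fun k => ∫ x in D, |primitive W (u (ρ k) x) - v₀ x|) atTop (𝓝 0) := by
    refine squeeze_zero (fun k => integral_nonneg fun x => abs_nonneg _) (fun k => ?_) hlim
    refine le_trans (le_of_eq ?_) (setIntegral_le_integral (s := D) ((hvi (ρ k)).sub hv₀).abs
      (Eventually.of_forall fun x => abs_nonneg _))
    refine setIntegral_congr_fun hDm fun x hx => ?_
    simp [hv, hx]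
  obtain ⟨hwi, hwlim⟩ := tendsto_setIntegral_abs_sub_of_primitive hW hDO hf hΦf
    (fun k => hui (ρ k)) hv₀.integrableOn hlimD
  -- The potential is at most `ε` times the energy density, so its integral is at most `ε (C + 1)`.
  have hWlim : Tendsto (fun k => ∫ x in D, W (u (ρ k) x)) atTop (𝓝 0) := by
    have h1 : Tendsto (fun k => ε (ρ k) * (C + 1 : ℝ)) atTop (𝓝 0) := by
      simpa using (hε0.comp hρ.tendsto_atTop).mul_const (C + 1 : ℝ)
    refine squeeze_zero (fun k => integral_nonneg fun x => hW.nonneg _) (fun k => ?_) h1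
    refine (integral_mono_of_nonneg (Eventually.of_forall fun x => hW.nonneg _)
      ((hdi (ρ k)).const_mul (ε (ρ k)))
      (Eventually.of_forall fun x => le_mul_density (hε (ρ k)) x)).trans ?_
    rw [integral_const_mul]
    exact mul_le_mul_of_nonneg_left (hdC (ρ k)) (hε (ρ k)).le
  have hint := ae_int_of_tendsto hW hDO (fun k => hui (ρ k)) hwi hwlim hWlim
  -- At an integer `k` the primitive equals `k * c`, so the limit of the transformed functions is
  -- linear in the limit of the original ones.
  have hcw : ∀ᵐ x ∂(volume.restrict D), v₀ x = c * f (v₀ x) := by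
    filter_upwards [hint] with x ⟨k, hk⟩
    rw [← hΦf (v₀ x), hΦf (v₀ x), hk, mul_comm, ← hW.primitive_int, ← hk, hΦf]
  obtain ⟨μ, σ, hμ⟩ := exists_isGradientMeasure_of_tendsto hDm hS1 hc0 (n := rot (dir a b))
    (fun k => hvi (ρ k)) hv₀ hlim hcw (fun k => hQi (ρ k)) (fun k => hQM (ρ k))
    (fun k j x hx => Set.indicator_of_notMem (fun h => hx (hDO h)) _)
    fun k φ hφ j => hgrad (ρ k) φ (hφ.mono fun x hx => hx.2) j
  refine ⟨fun x => f (v₀ x), ρ, hρ, memSBVInt_of_isGradientMeasure hDo hDO hwi hint hμ, ?_⟩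
  have hE1 : ∀ k, eLpNorm (fun x => u (ρ k) x - f (v₀ x)) 1 (volume.restrict D) =
      ENNReal.ofReal (∫ x in D, |u (ρ k) x - f (v₀ x)|) := fun k => by
    rw [eLpNorm_one_eq_lintegral_enorm]
    exact (ofReal_integral_norm_eq_lintegral_enorm ((hui (ρ k)).sub hwi)).symm
  simp_rw [hE1]
  simpa using ENNReal.tendsto_ofReal hwlim

/-! ### Several prescribed jumps -/

/-- In finite dimension a seminorm is convex, hence continuous, and so attains a positive minimum on
the unit sphere. The sphere is empty for `n = 0`, where there is nothing to prove. -/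
lemma exists_abs_le_mul_seminorm {n : ℕ} (Ψ : Seminorm ℝ (Fin n → ℝ))
    (hΨ : ∀ v, Ψ v = 0 → v = 0) : ∃ κ, 0 < κ ∧ ∀ v i, |v i| ≤ κ * Ψ v := by
  have hc : Continuous Ψ := continuousOn_univ.1 (Ψ.convexOn.continuousOn isOpen_univ)
  rcases n.eq_zero_or_pos with rfl | hn
  · exact ⟨1, one_pos, fun v i => i.elim0⟩
  have : Nonempty (Fin n) := ⟨⟨0, hn⟩⟩
  obtain ⟨w, hw, hmin⟩ := (isCompact_sphere (0 : Fin n → ℝ) 1).exists_isMinOn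
    (NormedSpace.sphere_nonempty.2 zero_le_one) hc.continuousOn
  have hpos : 0 < Ψ w := by
    refine lt_of_le_of_ne (apply_nonneg Ψ w) fun h => ?_
    rw [hΨ w h.symm] at hw
    simp at hw
  refine ⟨(Ψ w)⁻¹, inv_pos.2 hpos, fun v i => (norm_le_pi_norm v i).trans ?_⟩
  rw [inv_mul_eq_div, le_div_iff₀ hpos]
  rcases eq_or_ne v 0 with rfl | hv
  · simp
  have hv0 : 0 < ‖v‖ := norm_pos_iff.2 hv
  have h1 : Ψ w ≤ Ψ (‖v‖⁻¹ • v) := hmin (by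
    rw [mem_sphere_zero_iff_norm, norm_smul, norm_inv, norm_norm, inv_mul_cancel₀ hv0.ne'])
  rw [map_smul_eq_mul, norm_inv, norm_norm, inv_mul_eq_div, le_div_iff₀ hv0] at h1
  linarith

/-- The mass controls the norm of each component. -/
lemma lintegral_le_of_psiMass_le {n : ℕ} {Ψ : Seminorm ℝ (Fin n → ℝ)} {κ : ℝ} (hκ : 0 < κ)
    (hΨ : ∀ v i, |v i| ≤ κ * Ψ v) {D : Set Plane} (hD : IsOpen D) {e : Fin n → Plane → ℝ}
    {C : ℝ≥0} (h : psiMass Ψ D e ≤ C) {i : Fin n} (hi : IntegrableOn (e i) D) :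
    ∫⁻ x in D, ENNReal.ofReal (e i x) ≤ (κ.toNNReal * C : ℝ≥0) := by
  have hw : Integrable (D.indicator (e i)) := (integrable_indicator_iff hD.measurableSet).2 hi
  have key := lintegral_enorm_le_of_isTest hD hw (c := κ * C) fun g hg hg1 => by
    -- A field with a single nonzero component isolates `e i`; the factor `κ⁻¹` brings its dual norm
    -- below one, because `|v i| ≤ κ Ψ(v)`.
    set φ : Fin n → Plane → ℝ := fun l x => if l = i then κ⁻¹ * g x else 0 with hφ
    have h1 : ∀ l, IsTest D (φ l) := fun l => by
      by_cases hl : l = i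
      · simpa [hφ, hl] using hg.const_mul κ⁻¹
      · simpa [hφ, hl] using isTest_zero D
    have h2 : ∀ x, dualNorm Ψ (fun l => φ l x) ≤ 1 := fun x => by
      refine iSup₂_le fun v hv => ENNReal.ofReal_le_one.2 ?_
      have : ∑ l, φ l x * v l = κ⁻¹ * (g x * v i) := by simp [hφ, mul_assoc]
      rw [this, inv_mul_le_iff₀ hκ, mul_one]
      calc g x * v i ≤ |g x| * |v i| := by rw [← abs_mul]; exact le_abs_self _
        _ ≤ 1 * (κ * 1) := by
            gcongr
            · exact hg1 x
            · exact (hΨ v i).trans (by gcongr)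
        _ = κ := by ring
    have h3 : ENNReal.ofReal (∑ l, ∫ x in D, φ l x * e l x) ≤ C :=
      le_trans (by
        unfold psiMass
        exact le_iSup_of_le φ (le_iSup_of_le h1 (le_iSup_of_le h2 le_rfl))) h
    have h4 : ∑ l, ∫ x in D, φ l x * e l x = κ⁻¹ * ∫ x in D, g x * e i x := by
      rw [Finset.sum_eq_single i]
      · simp only [hφ, if_true, mul_assoc]
        rw [integral_const_mul]
      · intro l _ hl
        simp [hφ, hl]
      · simp
    have h5 : ∫ x, D.indicator (e i) x * g x = ∫ x in D, g x * e i x := by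
      rw [← MeasureTheory.integral_indicator hD.measurableSet]
      refine integral_congr_ae (Eventually.of_forall fun x => ?_)
      by_cases hx : x ∈ D <;> simp [hx, mul_comm]
    rw [h4, ENNReal.ofReal_le_iff_le_toReal ENNReal.coe_ne_top, ENNReal.coe_toReal,
      inv_mul_le_iff₀ hκ] at h3
    rw [h5]
    exact h3
  calc ∫⁻ x in D, ENNReal.ofReal (e i x) ≤ ∫⁻ x in D, ‖D.indicator (e i) x‖ₑ := by
        refine setLIntegral_mono_ae' hD.measurableSet (Eventually.of_forall fun x hx => ?_)
        rw [Set.indicator_of_mem hx]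
        exact Real.ofReal_le_enorm _
    _ ≤ ENNReal.ofReal (κ * C) := key
    _ = _ := by
        rw [ENNReal.ofReal_mul hκ.le, ENNReal.ofReal_coe_nnreal, ENNReal.coe_mul]; rfl

lemma integrableOn_density {W : ℝ → ℝ} (hW : IsPotential W) {D : Set Plane} (hD : D ⊆ Om) (ε : ℝ)
    {a b : Plane} {u : Plane → ℝ} (hu : IntegrableOn u D) {p : Plane → Plane}
    (hp : IsRotDensity D a b u p) : IntegrableOn (density W ε u p) D := by
  have hfin := isFiniteMeasure_restrict hD
  obtain ⟨B, hB⟩ := hW.exists_le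
  refine (hp.1.norm.integrable_sq.const_mul ε).add (Integrable.const_mul ?_ (1 / ε))
  exact Integrable.of_bound (hW.smooth.continuous.comp_aestronglyMeasurable hu.1) B
    (Eventually.of_forall fun x => by
      rw [Real.norm_eq_abs, abs_of_nonneg (hW.nonneg _)]; exact hB _)

/-- This reduces several jumps to one jump per component. The added `1` again selects densities from
an infimum. -/
lemma energy_le_of_psiEnergy_le {n : ℕ} {Ψ : Seminorm ℝ (Fin n → ℝ)} {κ : ℝ} (hκ : 0 < κ)
    (hΨ : ∀ v i, |v i| ≤ κ * Ψ v) {W : ℝ → ℝ} (hW : IsPotential W) {ε : ℝ} {D : Set Plane}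
    (hD : IsOpen D) (hDO : D ⊆ Om) {P : Fin (n + 1) → Plane} {U : Fin n → Plane → ℝ}
    (hU : ∀ i, IntegrableOn (U i) D) {C : ℝ≥0} (h : psiEnergy Ψ W ε D P U ≤ C) (i : Fin n) :
    energy W ε D (P i.castSucc) (P (Fin.last n)) (U i) ≤ (κ.toNNReal * (C + 1) : ℝ≥0) := by
  have hlt : psiEnergy Ψ W ε D P U < (C + 1 : ℝ≥0) :=
    h.trans_lt (by exact_mod_cast lt_add_one C)
  simp only [psiEnergy, iInf_lt_iff] at hlt
  obtain ⟨p, hp, hlt⟩ := hlt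
  exact (iInf₂_le (p i) (hp i)).trans
    (lintegral_le_of_psiMass_le hκ hΨ hD hlt.le (integrableOn_density hW hDO ε (hU i) (hp i)))

/-- Extraction of a common subsequence for finitely many sequences. -/
lemma exists_common_subseq {n : ℕ} {α : Type*} {p : Fin n → (ℕ → ℕ) → α → Prop}
    (hp : ∀ i ρ x (θ : ℕ → ℕ), StrictMono θ → p i ρ x → p i (ρ ∘ θ) x)
    (h : ∀ i ρ, StrictMono ρ → ∃ (x : α) (θ : ℕ → ℕ), StrictMono θ ∧ p i (ρ ∘ θ) x) :
    ∃ (x : Fin n → α) (ρ : ℕ → ℕ), StrictMono ρ ∧ ∀ i, p i ρ (x i) := by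
  induction n with
  | zero => exact ⟨fun i => i.elim0, id, strictMono_id, fun i => i.elim0⟩
  | succ n ih =>
    obtain ⟨x, ρ, hρ, hx⟩ := ih (p := fun i => p i.castSucc) (fun i => hp _) (fun i => h _)
    obtain ⟨y, θ, hθ, hy⟩ := h (Fin.last n) ρ hρ
    refine ⟨Fin.snoc x y, ρ ∘ θ, hρ.comp hθ, fun i => ?_⟩
    refine Fin.lastCases ?_ (fun i => ?_) i
    · simpa using hy
    · simpa using hp _ _ _ θ hθ (hx i)

end ModicaMortola

end

/-! ### The two compactness statements. -/

theorem mainTheorem5 (W : ℝ → ℝ) (hW : IsPotential W) :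
    -- a single prescribed jump, along the segment from `P` to `Q`
    (∀ (P Q : Plane) (δ : ℝ), P ≠ Q → max ‖P‖ ‖Q‖ = 1 → 0 < δ → 2 * δ < dist P Q →
      ∀ (ε : ℕ → ℝ) (u : ℕ → Plane → ℝ) (C : ℝ≥0),
        (∀ k, 0 < ε k) → Tendsto ε atTop (𝓝 0) →
        (∀ k, u k ∈ jumpClass (holes {P, Q} δ) (segment ℝ P Q)) →
        (∀ k, energy W (ε k) (OmDelta {P, Q} δ) P Q (u k) ≤ C) →
        ∃ (u₀ : Plane → ℝ) (ρ : ℕ → ℕ), StrictMono ρ ∧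
          MemSBVInt (OmDelta {P, Q} δ) u₀ ∧
          Tendsto (fun k => eLpNorm (fun x => u (ρ k) x - u₀ x) 1
            (volume.restrict (OmDelta {P, Q} δ))) atTop (𝓝 0)) ∧
    -- prescribed jumps along the segments from `P i` to the last terminal point
    (∀ (n : ℕ) (P : Fin (n + 1) → Plane) (Ψ : Seminorm ℝ (Fin n → ℝ)) (δ : ℝ),
      Function.Injective P → (⨆ i, ‖P i‖) = 1 → (∀ v, Ψ v = 0 → v = 0) →
      0 < δ → (∀ i j, i ≠ j → 2 * δ < dist (P i) (P j)) →
      ∀ (ε : ℕ → ℝ) (U : ℕ → Fin n → Plane → ℝ) (C : ℝ≥0),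
        (∀ k, 0 < ε k) → Tendsto ε atTop (𝓝 0) →
        (∀ k i, U k i ∈ jumpClass ∅ (segment ℝ (P i.castSucc) (P (Fin.last n)))) →
        (∀ k, psiEnergy Ψ W (ε k) (OmDelta (Set.range P) δ) P (U k) ≤ C) →
        ∃ (U₀ : Fin n → Plane → ℝ) (ρ : ℕ → ℕ), StrictMono ρ ∧
          (∀ i, MemSBVInt (OmDelta (Set.range P) δ) (U₀ i)) ∧
          ∀ i, Tendsto (fun k => eLpNorm (fun x => U (ρ k) i x - U₀ i x) 1
            (volume.restrict (OmDelta (Set.range P) δ))) atTop (𝓝 0)) := by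
  refine ⟨fun P Q δ hPQ hmax hδ hsep ε u C hε hε0 hu hF => ?_,
    fun n P Ψ δ hP hsup hΨ hδ hsep ε U C hε hε0 hU hF => ?_⟩
  · have hP : ‖P‖ ≤ 1 := (le_max_left _ _).trans hmax.le
    have hQ : ‖Q‖ ≤ 1 := (le_max_right _ _).trans hmax.le
    have hA : (({P, Q} : Finset Plane) : Set Plane) = {P, Q} := Finset.coe_pair
    -- Two points of the closed unit disc are at distance at most `2`, which exceeds `2 δ`; so all
    -- the holes lie well inside `Ω`.
    have hδ1 : δ < 1 := by
      have := dist_le_norm_add_norm P Q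
      linarith
    rw [← hA] at hu hF ⊢
    refine exists_subseq_of_energy_le hW hδ hδ1 (A := {P, Q}) ?_ ?_ (by simp) (by simp) hPQ
      (isClosed_holes _ δ).measurableSet le_rfl hε hε0 hu hF
    · simp [hP, hQ]
    · intro p hp q hq hpq
      simp only [Finset.mem_insert, Finset.mem_singleton] at hp hq
      rcases hp with rfl | rfl <;> rcases hq with rfl | rfl
      · exact absurd rfl hpq
      · exact hsep
      · rwa [dist_comm]
      · exact absurd rfl hpq
  · have hA : ((Finset.univ.image P : Finset Plane) : Set Plane) = Set.range P := by simp
    have hP1 : ∀ i, ‖P i‖ ≤ 1 := fun i =>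
      hsup ▸ le_ciSup (Set.finite_range fun i => ‖P i‖).bddAbove i
    obtain ⟨κ, hκ, hκΨ⟩ := exists_abs_le_mul_seminorm Ψ hΨ
    rw [← hA] at hF ⊢
    have hTc := isClosed_holes (Finset.univ.image P) δ
    set T := holes ((Finset.univ.image P : Finset Plane) : Set Plane) δ
    have hDo : IsOpen (Om \ T) := Metric.isOpen_ball.sdiff hTc
    have hUi : ∀ k i, IntegrableOn (U k i) (Om \ T) := fun k i =>
      (hU k i).1.1.mono_set (Set.sdiff_subset_sdiff_right (Set.empty_subset T))
    have hE := fun k i => energy_le_of_psiEnergy_le hκ hκΨ hW hDo Set.sdiff_subset (hUi k) (hF k) i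
    obtain ⟨G, hG⟩ : ∃ G : Fin n → (Plane → ℝ) → ℕ → ℝ≥0∞, ∀ i u₀ k, G i u₀ k =
        eLpNorm (fun x => U k i x - u₀ x) 1 (volume.restrict (Om \ T)) :=
      ⟨fun i u₀ k => eLpNorm (fun x => U k i x - u₀ x) 1 (volume.restrict (Om \ T)),
        fun _ _ _ => rfl⟩
    obtain ⟨U₀, ρ, hρ, h⟩ := exists_common_subseq
      (p := fun i ρ u₀ => MemSBVInt (Om \ T) u₀ ∧ Tendsto (fun k => G i u₀ (ρ k)) atTop (𝓝 0))
      (fun i ρ x θ hθ hx => ⟨hx.1, hx.2.comp hθ.tendsto_atTop⟩) fun i ρ hρ => by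
        have hne : i.castSucc ≠ Fin.last n := (Fin.castSucc_lt_last i).ne
        -- This needs two distinct points, which the index `i` provides; if `n = 0` there is no
        -- component and no bound on `δ`.
        have hδ1 : δ < 1 := by
          have := dist_le_norm_add_norm (P i.castSucc) (P (Fin.last n))
          linarith [hP1 i.castSucc, hP1 (Fin.last n), hsep _ _ hne]
        simp_rw [hG]
        have key := exists_subseq_of_energy_le hW hδ hδ1 (A := Finset.univ.image P)
          (u := fun k => U (ρ k) i) (ε := fun k => ε (ρ k)) (a := P i.castSucc)
          (b := P (Fin.last n)) ?_ ?_ ?_ ?_ (hP.ne hne) MeasurableSet.empty (Set.empty_subset _)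
          (fun k => hε (ρ k)) (hε0.comp hρ.tendsto_atTop) (fun k => hU (ρ k) i)
          (fun k => hE (ρ k) i)
        · obtain ⟨u₀, θ, hθ, h1, h2⟩ := key
          exact ⟨u₀, θ, hθ, h1, h2⟩
        · simpa using hP1
        · intro p hp q hq hpq
          obtain ⟨i, -, rfl⟩ := Finset.mem_image.1 hp
          obtain ⟨l, -, rfl⟩ := Finset.mem_image.1 hq
          exact hsep i l fun h => hpq (h ▸ rfl)
        · exact Finset.mem_image_of_mem P (Finset.mem_univ _)
        · exact Finset.mem_image_of_mem P (Finset.mem_univ _)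
    simp_rw [hG] at h
    exact ⟨U₀, ρ, hρ, fun i => (h i).1, fun i => (h i).2⟩
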